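/- There is an absolute constant $C > 0$ such that the following holds for all integers $d \ge 2$ and $n \ge 1$, all $0 < \sigma \le 1$, and all points $y_1, \dots, y_n \in [-1,1]^d$. Let $x_i = y_i + g_i$, where $g_1, \dots, g_n$ are independent $d$-dimensional Gaussian random vectors with mean $0$ and standard deviation $\sigma$ (covariance matrix $\sigma^2 I_d$). A tour is a cyclic order in which the points $x_1, \dots, x_n$ are visited, up to reversal, and its length is the sum of the Euclidean distances between consecutive points. An iteration of 2-opt exchanges two edges of the current tour for two others so that the result is again a tour and is strictly shorter; 2-opt stops when this is impossible. Let $T$ be the number of iterations that 2-opt performs on $x_1, \dots, x_n$, in the worst case over the initial tour and over the choice of the improving exchange in each iteration. Then $$ \mathbb{E}[T] \;\le\; C \cdot \frac{d\, D^2\, n^{4 + 1/3}}{\sigma^2}, \qquad D = 1 + \sigma \sqrt{n \log n}. $$ That is, the smoothed complexity of 2-opt is $O(d D^2 n^{4+1/3}/\sigma^2)$ with $D = \Theta(1 + \sigma\sqrt{n \log n})$, and the implied constant depends on none of $n$, $d$, $\sigma$, or the $y_i$. -/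

import Mathlib

open MeasureTheory ProbabilityTheory
open scoped ENNReal

namespace TwoOpt

/-- The set of edges of the tour that visits the cities `0, …, n - 1` in the cyclic order
`π 0, π 1, …, π (n - 1), π 0`. The map `finRotate n` sends `i` to `i + 1` modulo `n`.
Two permutations describe the same (undirected) tour if and only if they have the same
`tourEdges`. -/
def tourEdges {n : ℕ} (π : Equiv.Perm (Fin n)) : Finset (Sym2 (Fin n)) :=
  Finset.univ.image fun i => s(π i, π (finRotate n i))

/-- The Euclidean length of the tour `π`, when city `i` is the point `x i`. -/
noncomputable def tourLength {n d : ℕ} (x : Fin n → EuclideanSpace ℝ (Fin d))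
    (π : Equiv.Perm (Fin n)) : ℝ :=
  ∑ i, ‖x (π i) - x (π (finRotate n i))‖

/-- The tour `π'` arises from the tour `π` by a 2-change: two edges `e₁, e₂` of `π` are
exchanged for two edges `f₁, f₂`, not both in `π`, and the result is again a tour. -/
def IsTwoChange {n : ℕ} (π π' : Equiv.Perm (Fin n)) : Prop :=
  ∃ e₁ e₂ f₁ f₂ : Sym2 (Fin n), e₁ ≠ e₂ ∧ f₁ ≠ f₂ ∧
    {e₁, e₂} ⊆ tourEdges π ∧ ¬ ({f₁, f₂} ⊆ tourEdges π) ∧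
    tourEdges π' = (tourEdges π \ {e₁, e₂}) ∪ {f₁, f₂}

/-- One iteration of 2-opt on the instance `x`: a 2-change that makes the tour strictly
shorter. -/
def IsIteration {n d : ℕ} (x : Fin n → EuclideanSpace ℝ (Fin d))
    (π π' : Equiv.Perm (Fin n)) : Prop :=
  IsTwoChange π π' ∧ tourLength x π' < tourLength x π

/-- `T 0, T 1, …, T k` is a run of `k` iterations of 2-opt on the instance `x`: each tour
arises from the preceding one by an iteration. -/
def IsRun {n d : ℕ} (x : Fin n → EuclideanSpace ℝ (Fin d)) (k : ℕ)
    (T : Fin (k + 1) → Equiv.Perm (Fin n)) : Prop :=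
  ∀ i : Fin k, IsIteration x (T i.castSucc) (T i.succ)

/-- The number of iterations of 2-opt on the instance `x`, in the worst case over the
initial tour and over the choice of the improving 2-change in every iteration. -/
noncomputable def numIterations {n d : ℕ} (x : Fin n → EuclideanSpace ℝ (Fin d)) : ℝ≥0∞ :=
  ⨆ (k : ℕ) (T : Fin (k + 1) → Equiv.Perm (Fin n)) (_ : IsRun x k T), (k : ℝ≥0∞)

/-- The law of `y + g`, where `g` is a `d`-dimensional Gaussian random vector with mean `0`
and standard deviation `σ` (covariance matrix `σ² • 1`). -/
noncomputable def perturbedPoint {d : ℕ} (y : EuclideanSpace ℝ (Fin d)) (σ : ℝ) :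
    Measure (EuclideanSpace ℝ (Fin d)) :=
  (stdGaussian (EuclideanSpace ℝ (Fin d))).map fun v => y + σ • v

/-- The law of the smoothed instance: the points `y i` are perturbed independently. -/
noncomputable def smoothedInstance {n d : ℕ} (y : Fin n → EuclideanSpace ℝ (Fin d)) (σ : ℝ) :
    Measure (Fin n → EuclideanSpace ℝ (Fin d)) :=
  Measure.pi fun i => perturbedPoint (y i) σ

instance isProbabilityMeasure_perturbedPoint {d : ℕ} (y : EuclideanSpace ℝ (Fin d)) (σ : ℝ) :
    IsProbabilityMeasure (perturbedPoint y σ) :=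
  Measure.isProbabilityMeasure_map (by fun_prop)

instance isProbabilityMeasure_smoothedInstance {n d : ℕ}
    (y : Fin n → EuclideanSpace ℝ (Fin d)) (σ : ℝ) :
    IsProbabilityMeasure (smoothedInstance y σ) := by
  unfold smoothedInstance
  infer_instance

/-- The number of iterations is a random variable, so its expectation makes sense. -/
theorem measurable_numIterations {n d : ℕ} :
    Measurable (numIterations : (Fin n → EuclideanSpace ℝ (Fin d)) → ℝ≥0∞) := by
  have hL : ∀ π : Equiv.Perm (Fin n), Measurable
      fun x : Fin n → EuclideanSpace ℝ (Fin d) => tourLength x π := by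
    intro π
    unfold tourLength
    fun_prop
  refine Measurable.iSup fun k => Measurable.iSup fun T => ?_
  have hs : MeasurableSet {x : Fin n → EuclideanSpace ℝ (Fin d) | IsRun x k T} := by
    simp only [IsRun, IsIteration, Set.ofPred_forall, Set.ofPred_and]
    exact MeasurableSet.iInter fun i =>
      (MeasurableSet.const _).inter (measurableSet_lt (hL _) (hL _))
  classical
  have : (fun x : Fin n → EuclideanSpace ℝ (Fin d) => ⨆ (_ : IsRun x k T), (k : ℝ≥0∞)) =
      Set.indicator {x | IsRun x k T} fun _ => (k : ℝ≥0∞) := by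
    funext x
    by_cases h : IsRun x k T <;> simp [h]
  rw [this]
  exact measurable_const.indicator hs

/-- The expected number of iterations of 2-opt on the smoothed instance. -/
noncomputable def expectedIterations {n d : ℕ} (y : Fin n → EuclideanSpace ℝ (Fin d))
    (σ : ℝ) : ℝ≥0∞ :=
  ∫⁻ x, numIterations x ∂(smoothedInstance y σ)

end TwoOpt

open scoped RealInnerProductSpace

namespace TwoOpt

/-! ### Bounds for Gaussian densities -/

/-! If all distances are at most `2r`, the initial tour has length at most `2rn`, so at most `2rn/ε`
iterations gain more than `ε`. The proof shows that, outside an unlikely event, the whole run is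
longer than this by at most a constant factor, up to `O(n²)`.

Combinatorics. Two iterations are linked if the first adds an edge and the second is the next one to
remove it. An iteration is bad if it gains more than `ε` or one of its four edges has no link; there
are at most `2rn/ε + 2n` of these (`card_bad_le`). Each iteration trades the sides of a 4-cycle.
Suppose that no two 4-cycles with small alternating sum of side lengths share exactly one edge, and
none share exactly three points without a common diagonal. Then linked iterations away from the bad
ones share a diagonal (`link_shares_diagonal`), and each iteration shares the same one with all its
neighbours (`exists_common_diag`). An exchange with diagonal `ab` moves a tour neighbour `x` of `a`
to `b` and a neighbour `y` of `b` to `a`, and its gain is `η x - η y` with `η v = |va| - |vb|`.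
Hence it lowers the number of inversions between the neighbours of `a` and those of `b`. Only `2 ·
2` pairs exist, so at most four such exchanges fit between two disturbances from outside
(`card_window_le`). Summing over all diagonals bounds the run by a multiple of the number of bad
iterations plus `O(n²)` (`length_le_bad`, `run_length_le`).

Probability. For a perturbed point `x` and fixed `a`, `b`, the chance that `|xa| - |xb|` lies within
`ε` of `t` is controlled by `setLIntegral_dist_sub_dist_le`, with constants independent of the
dimension. Two 4-cycles that share an edge each have a private point. Given the other points these
are independent, so two such bounds multiply, and negative moments of heights of triangles finish
the estimate. The outcome is `(rε/σ²)^(9/5)` for six points (`measure_sixEvent_le`) and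
`(rε/σ²)^(3/2)` for five (`measure_fiveEvent_le`).

Balance. There are at most `n⁶` and `n⁵` choices of the points, and both union bounds become
constants at the same scale `rε/σ² = n^(-10/3)`. With `r = 4√d D` this gives `rn/ε = 16 d D²
n^(4+1/3)/σ²`. Halving `ε` doubles the bound on the run but shrinks the probabilities by the factor
`2^(-3/2)` or better, so the expectation is a geometric series. Instances with a distance above `2r`
are so rare that the trivial bound `n!` suffices there. -/

theorem pi_gaussianReal_eq_withDensity {ι : Type*} [Fintype ι] :
    Measure.pi (fun _ : ι => gaussianReal 0 1) =
      (volume : Measure (ι → ℝ)).withDensity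
        fun x => ENNReal.ofReal (∏ i, gaussianPDFReal 0 1 (x i)) := by
  symm
  refine (Measure.pi_eq fun s hs => ?_).symm
  rw [withDensity_apply _ (MeasurableSet.univ_pi hs), volume_pi, Measure.restrict_pi_pi,
    ← ofReal_integral_eq_lintegral_ofReal, integral_fintype_prod_eq_prod,
    ENNReal.ofReal_prod_of_nonneg]
  · refine Finset.prod_congr rfl fun i _ => ?_
    rw [gaussianReal_apply_eq_integral 0 one_ne_zero]
  · intro i _
    exact integral_nonneg fun x => gaussianPDFReal_nonneg _ _ _
  · exact Integrable.fintype_prod fun i => (integrable_gaussianPDFReal 0 1).restrict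
  · exact Filter.Eventually.of_forall fun x =>
      Finset.prod_nonneg fun i _ => gaussianPDFReal_nonneg _ _ _

theorem gaussianReal_le {σ : ℝ} (hσ : 0 < σ) (m : ℝ) :
    gaussianReal m (σ ^ 2).toNNReal ≤ ENNReal.ofReal (1 / σ) • volume := by
  have hv : (σ ^ 2).toNNReal ≠ 0 := by
    simp only [ne_eq, Real.toNNReal_eq_zero, not_le]; positivity
  rw [gaussianReal_of_var_ne_zero _ hv, ← withDensity_const]
  refine withDensity_mono (Filter.Eventually.of_forall fun x => ?_)
  refine ENNReal.ofReal_le_ofReal ?_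
  rw [gaussianPDFReal_def, Real.coe_toNNReal _ (by positivity), one_div]
  have h1 : σ ≤ √(2 * Real.pi * σ ^ 2) := by
    apply Real.le_sqrt_of_sq_le
    nlinarith [Real.pi_gt_three, sq_nonneg σ]
  calc _ ≤ (√(2 * Real.pi * σ ^ 2))⁻¹ * 1 := by
        refine mul_le_mul_of_nonneg_left ?_ (by positivity)
        rw [Real.exp_le_one_iff]
        have : 0 ≤ (x - m) ^ 2 / (2 * σ ^ 2) := by positivity
        rw [neg_div]; linarith
    _ ≤ σ⁻¹ := by rw [mul_one]; gcongr

/-- The unnormalised density of the norm in dimension `k + 1` has its mode at `√k`. After taking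
logarithms this is `log u ≤ u - 1` at `u = x ^ 2 / k`. -/
theorem pow_mul_exp_le (k : ℕ) {x : ℝ} (hx : 0 < x) :
    x ^ k * Real.exp (-x ^ 2 / 2) ≤ √k ^ k * Real.exp (-√k ^ 2 / 2) := by
  rcases Nat.eq_zero_or_pos k with rfl | hk
  · have : 0 ≤ x ^ 2 / 2 := by positivity
    simp only [pow_zero, one_mul, Nat.cast_zero, Real.sqrt_zero]
    apply Real.exp_le_exp.2; rw [neg_div]; norm_num; exact this
  have hk' : (0 : ℝ) < k := by exact_mod_cast hk
  have hs : 0 < √(k : ℝ) := Real.sqrt_pos.2 hk'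
  rw [← Real.log_le_log_iff (by positivity) (by positivity),
    Real.log_mul (by positivity) (by positivity), Real.log_mul (by positivity) (by positivity),
    Real.log_exp, Real.log_exp, Real.log_pow, Real.log_pow, Real.log_sqrt hk'.le,
    Real.sq_sqrt hk'.le]
  have h := Real.log_le_sub_one_of_pos (x := x ^ 2 / k) (by positivity)
  rw [Real.log_div (by positivity) (by positivity), Real.log_pow] at h
  have : (k : ℝ) * (x ^ 2 / k) = x ^ 2 := by field_simp
  push_cast at h
  nlinarith

/-- To the right of the mode the density falls off no faster than `exp (-y ^ 2)`, because `log (1 +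
u) ≥ u - u ^ 2 / 2`. The rate does not involve `k`, which is what makes the later bounds free of the
dimension. -/
theorem le_pow_mul_exp (k : ℕ) {y : ℝ} (hy : 0 ≤ y) :
    √k ^ k * Real.exp (-√k ^ 2 / 2) * Real.exp (-y ^ 2) ≤
      (√k + y) ^ k * Real.exp (-(√k + y) ^ 2 / 2) := by
  rcases Nat.eq_zero_or_pos k with rfl | hk
  · simp only [Nat.cast_zero, Real.sqrt_zero, pow_zero, one_mul, ← Real.exp_add]
    apply Real.exp_le_exp.2; nlinarith [sq_nonneg y]
  have hk' : (0 : ℝ) < k := by exact_mod_cast hk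
  have hs : 0 < √(k : ℝ) := Real.sqrt_pos.2 hk'
  have hs2 : √(k : ℝ) ^ 2 = k := Real.sq_sqrt hk'.le
  set s := √(k : ℝ) with hsdef
  have hu : 0 ≤ y / s := by positivity
  have hlog : y / s - (y / s) ^ 2 / 2 ≤ Real.log (1 + y / s) := by
    have h1 := Real.le_log_one_add_of_nonneg hu
    refine le_trans ?_ h1
    rw [le_div_iff₀ (by positivity)]
    nlinarith [mul_nonneg hu (mul_nonneg hu hu)]
  have hadd : s + y = s * (1 + y / s) := by field_simp
  have key : s ^ k * Real.exp (k * (y / s - (y / s) ^ 2 / 2)) ≤ (s + y) ^ k := by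
    rw [hadd, mul_pow, Real.exp_nat_mul]
    gcongr
    calc _ ≤ Real.exp (Real.log (1 + y / s)) := Real.exp_le_exp.2 hlog
      _ = _ := Real.exp_log (by positivity)
  calc _ = s ^ k * Real.exp (k * (y / s - (y / s) ^ 2 / 2)) * Real.exp (-(s + y) ^ 2 / 2) := by
        rw [mul_assoc, mul_assoc, ← Real.exp_add, ← Real.exp_add]
        congr 2
        rw [← hs2]; field_simp; ring
    _ ≤ _ := by gcongr

theorem integrableOn_pow_mul_exp (k : ℕ) :
    IntegrableOn (fun y : ℝ => y ^ k * Real.exp (-y ^ 2 / 2)) (Set.Ioi 0) := by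
  have h := integrableOn_rpow_mul_exp_neg_mul_sq (b := 1 / 2) (s := k) (by norm_num)
    (by have : (0 : ℝ) ≤ k := by positivity
        linarith)
  refine h.congr_fun (fun y _ => ?_) measurableSet_Ioi
  simp only [Real.rpow_natCast]
  congr 2; ring

/-- By `le_pow_mul_exp`, the mass to the right of the mode alone is at least `√π / 2` times the
maximum. Hence the maximum of the normalised density is at most `2`. -/
theorem sqrt_pow_mul_exp_le_integral (k : ℕ) :
    √k ^ k * Real.exp (-√k ^ 2 / 2) ≤
      2 * ∫ y in Set.Ioi (0 : ℝ), y ^ k * Real.exp (-y ^ 2 / 2) := by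
  set M := √k ^ k * Real.exp (-√k ^ 2 / 2) with hM
  have hM0 : 0 ≤ M := by positivity
  have h1 : ∫ y in Set.Ioi (0 : ℝ), M * Real.exp (-y ^ 2) = M * (√Real.pi / 2) := by
    rw [integral_const_mul]
    have := integral_gaussian_Ioi 1
    simp only [neg_mul, one_mul, div_one] at this
    rw [this]
  have hsub : ∫ y in Set.Ioi (0 : ℝ), (√k + y) ^ k * Real.exp (-(√k + y) ^ 2 / 2) =
      ∫ y in Set.Ioi √k, y ^ k * Real.exp (-y ^ 2 / 2) := by
    have := (measurePreserving_add_left volume √(k : ℝ)).setIntegral_preimage_emb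
      (measurableEmbedding_addLeft _) (fun y => y ^ k * Real.exp (-y ^ 2 / 2)) (Set.Ioi √k)
    rw [← this]
    congr 2
    ext; simp
  have hsubset : Set.Ioi √(k : ℝ) ⊆ Set.Ioi 0 := Set.Ioi_subset_Ioi (Real.sqrt_nonneg _)
  have h2 : ∫ y in Set.Ioi √k, y ^ k * Real.exp (-y ^ 2 / 2) ≤
      ∫ y in Set.Ioi (0 : ℝ), y ^ k * Real.exp (-y ^ 2 / 2) :=
    setIntegral_mono_set (integrableOn_pow_mul_exp k)
      ((ae_restrict_iff' measurableSet_Ioi).2 (Filter.Eventually.of_forall fun y hy => by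
        have : (0 : ℝ) < y := hy
        simp only [Pi.zero_apply]; positivity))
      (Filter.Eventually.of_forall hsubset)
  have h3 : ∫ y in Set.Ioi (0 : ℝ), M * Real.exp (-y ^ 2) ≤
      ∫ y in Set.Ioi (0 : ℝ), (√k + y) ^ k * Real.exp (-(√k + y) ^ 2 / 2) := by
    refine setIntegral_mono_on ?_ ?_ measurableSet_Ioi
      fun y hy => le_pow_mul_exp k (le_of_lt hy)
    · have := (integrable_exp_neg_mul_sq (b := 1) one_pos).integrableOn (s := Set.Ioi 0)
      simp only [neg_mul, one_mul] at this
      exact this.const_mul M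
    · have := (measurePreserving_add_left volume √(k : ℝ)).integrableOn_comp_preimage
        (measurableEmbedding_addLeft _) (f := fun y => y ^ k * Real.exp (-y ^ 2 / 2))
        (s := Set.Ioi √k)
      have h5 := this.2 ((integrableOn_pow_mul_exp k).mono_set hsubset)
      have h6 : (fun x : ℝ => √(k : ℝ) + x) ⁻¹' Set.Ioi √(k : ℝ) = Set.Ioi 0 := by ext; simp
      rw [h6] at h5
      exact h5
  have hpi : 1 ≤ √Real.pi := by
    rw [Real.one_le_sqrt]; linarith [Real.pi_gt_three]
  have : M ≤ M * √Real.pi := le_mul_of_one_le_right hM0 hpi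
  linarith

theorem lintegral_pi_gaussianReal_norm {ι : Type*} [Fintype ι] (A : Set ℝ) (hA : MeasurableSet A) :
    ((Measure.pi fun _ : ι => gaussianReal 0 1).map fun x => √(∑ i, x i ^ 2)) A =
      ENNReal.ofReal (∫ x : EuclideanSpace ℝ ι,
        A.indicator (fun r => (√(2 * Real.pi))⁻¹ ^ Fintype.card ι * Real.exp (-r ^ 2 / 2)) ‖x‖) :=
          by
  have hm : Measurable fun x : ι → ℝ => √(∑ i, x i ^ 2) := by fun_prop
  have hpre : MeasurableSet ((fun x : ι → ℝ => √(∑ i, x i ^ 2)) ⁻¹' A) := hm hA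
  have hprod : ∀ x : ι → ℝ, ∏ i, gaussianPDFReal 0 1 (x i) =
      (√(2 * Real.pi))⁻¹ ^ Fintype.card ι * Real.exp (-√(∑ i, x i ^ 2) ^ 2 / 2) := by
    intro x
    simp only [gaussianPDFReal_def, NNReal.coe_one, mul_one, sub_zero, Finset.prod_mul_distrib,
      Finset.prod_const, Finset.card_univ, ← Real.exp_sum]
    rw [Real.sq_sqrt (Finset.sum_nonneg fun i _ => sq_nonneg _)]
    simp [Finset.sum_div, neg_div]
  have hint : Integrable fun x : ι → ℝ => ∏ i, gaussianPDFReal 0 1 (x i) :=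
    Integrable.fintype_prod fun i => integrable_gaussianPDFReal 0 1
  rw [Measure.map_apply hm hA, pi_gaussianReal_eq_withDensity, withDensity_apply _ hpre,
    ← ofReal_integral_eq_lintegral_ofReal hint.integrableOn
      (Filter.Eventually.of_forall fun x =>
        Finset.prod_nonneg fun i _ => gaussianPDFReal_nonneg _ _ _),
    ← integral_indicator hpre]
  congr 1
  have hvp := PiLp.volume_preserving_toLp ι
  rw [← hvp.integral_comp (MeasurableEquiv.toLp 2 (ι → ℝ)).measurableEmbedding]
  refine integral_congr_ae (Filter.Eventually.of_forall fun x => ?_)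
  simp only [EuclideanSpace.norm_eq, Real.norm_eq_abs, sq_abs]
  by_cases hx : √(∑ i, x i ^ 2) ∈ A
  · rw [Set.indicator_of_mem hx, Set.indicator_of_mem (by exact hx), hprod]
  · rw [Set.indicator_of_notMem hx, Set.indicator_of_notMem (by exact hx)]

/-- The Euclidean norm of a standard Gaussian vector has a density at most `2`, in every
positive dimension. -/
theorem map_norm_pi_gaussianReal_le {ι : Type*} [Fintype ι] [Nonempty ι] :
    ((Measure.pi fun _ : ι => gaussianReal 0 1).map fun x => √(∑ i, x i ^ 2)) ≤
      (2 : ℝ≥0∞) • volume := by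
  have hm : Measurable fun x : ι → ℝ => √(∑ i, x i ^ 2) := by fun_prop
  have := Measure.isProbabilityMeasure_map (μ := Measure.pi fun _ : ι => gaussianReal 0 1)
    hm.aemeasurable
  set k := Fintype.card ι - 1 with hk
  set c : ℝ := (√(2 * Real.pi))⁻¹ ^ Fintype.card ι with hc
  set K : ℝ := (Fintype.card ι : ℝ) * (volume : Measure (EuclideanSpace ℝ ι)).real (Metric.ball 0 1)
    with hK
  have hK0 : 0 ≤ K := by positivity
  have hc0 : 0 < c := by positivity
  have polar : ∀ A : Set ℝ, ∫ x : EuclideanSpace ℝ ι,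
      A.indicator (fun r => c * Real.exp (-r ^ 2 / 2)) ‖x‖ =
        K * c * ∫ y in Set.Ioi (0 : ℝ), A.indicator (fun y => y ^ k * Real.exp (-y ^ 2 / 2)) y := by
    intro A
    have h := integral_fun_norm_addHaar (volume : Measure (EuclideanSpace ℝ ι))
      (A.indicator fun r => c * Real.exp (-r ^ 2 / 2))
    have h2 : ∀ y : ℝ, y ^ (Module.finrank ℝ (EuclideanSpace ℝ ι) - 1) •
        A.indicator (fun r => c * Real.exp (-r ^ 2 / 2)) y =
          c * A.indicator (fun y => y ^ k * Real.exp (-y ^ 2 / 2)) y := by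
      intro y
      rw [finrank_euclideanSpace]
      by_cases hy : y ∈ A
      · simp only [Set.indicator_of_mem hy, smul_eq_mul]; ring
      · simp only [Set.indicator_of_notMem hy, smul_zero, mul_zero]
    simp only [h2] at h
    rw [h, finrank_euclideanSpace, nsmul_eq_mul, smul_eq_mul, integral_const_mul]
    ring
  -- Total mass one determines the normalising constant `K * c`, so the volume of the ball never has
  -- to be computed.
  have htot : K * c * ∫ y in Set.Ioi (0 : ℝ), y ^ k * Real.exp (-y ^ 2 / 2) = 1 := by
    have h1 := lintegral_pi_gaussianReal_norm (ι := ι) Set.univ MeasurableSet.univ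
    rw [measure_univ, polar] at h1
    simp only [Set.indicator_univ] at h1
    have := h1.symm
    rwa [ENNReal.ofReal_eq_one] at this
  refine Measure.le_iff.2 fun A hA => ?_
  rw [lintegral_pi_gaussianReal_norm A hA, polar, Measure.smul_apply, smul_eq_mul]
  by_cases hfin : volume A = ∞
  · simp [hfin]
  have hb : ∫ y in Set.Ioi (0 : ℝ), A.indicator (fun y => y ^ k * Real.exp (-y ^ 2 / 2)) y ≤
      volume.real A * (√k ^ k * Real.exp (-√k ^ 2 / 2)) := by
    rw [← smul_eq_mul, ← integral_indicator_const (μ := volume) _ hA]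
    have hintc : Integrable (A.indicator fun _ : ℝ => √k ^ k * Real.exp (-√k ^ 2 / 2)) :=
      (integrable_indicator_iff hA).2 (integrableOn_const hfin)
    refine le_trans (setIntegral_mono_on ?_ hintc.integrableOn measurableSet_Ioi
      (g := A.indicator fun _ : ℝ => √k ^ k * Real.exp (-√k ^ 2 / 2)) fun y hy => ?_) ?_
    · exact (integrableOn_pow_mul_exp k).indicator hA
    · by_cases hyA : y ∈ A
      · simp only [Set.indicator_of_mem hyA]; exact pow_mul_exp_le k hy
      · simp only [Set.indicator_of_notMem hyA]; exact le_rfl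
    · exact setIntegral_le_integral hintc (Filter.Eventually.of_forall fun y =>
        Set.indicator_nonneg (fun _ _ => by positivity) y)
  rw [← ofReal_measureReal hfin, ← ENNReal.ofReal_ofNat, ← ENNReal.ofReal_mul (by norm_num)]
  refine ENNReal.ofReal_le_ofReal ?_
  calc _ ≤ K * c * (volume.real A * (√k ^ k * Real.exp (-√k ^ 2 / 2))) := by gcongr
    _ ≤ K * c * (volume.real A * (2 * ∫ y in Set.Ioi (0 : ℝ), y ^ k * Real.exp (-y ^ 2 / 2))) := by
        refine mul_le_mul_of_nonneg_left (mul_le_mul_of_nonneg_left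
          (sqrt_pow_mul_exp_le_integral k) measureReal_nonneg) (by positivity)
    _ = 2 * volume.real A * (K * c * ∫ y in Set.Ioi (0 : ℝ), y ^ k * Real.exp (-y ^ 2 / 2)) := by
        ring
    _ = _ := by rw [htot]; simp

theorem map_mul_norm_pi_gaussianReal_le {ι : Type*} [Fintype ι] [Nonempty ι] {σ : ℝ}
    (hσ : 0 < σ) :
    ((Measure.pi fun _ : ι => gaussianReal 0 1).map fun x => σ * √(∑ i, x i ^ 2)) ≤
      ENNReal.ofReal (2 / σ) • volume := by
  have hm : Measurable fun x : ι → ℝ => √(∑ i, x i ^ 2) := by fun_prop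
  have h1 := Measure.map_mono (f := fun r : ℝ => σ * r)
    (map_norm_pi_gaussianReal_le (ι := ι)) (by fun_prop)
  rw [Measure.map_map (by fun_prop) hm, Measure.map_smul,
    show (fun r : ℝ => σ * r) = (σ * ·) from rfl, Real.map_volume_mul_left hσ.ne', smul_smul] at h1
  refine h1.trans (le_of_eq ?_)
  rw [abs_of_pos (inv_pos.2 hσ), div_eq_mul_inv, ENNReal.ofReal_mul (by norm_num)]
  simp

/-! ### Orthonormal frames and cylindrical coordinates -/

/-- In an orthonormal frame the coordinates of a perturbed point are independent Gaussians. -/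
theorem map_inner_perturbedPoint {d : ℕ} (b : OrthonormalBasis (Fin d) ℝ (EuclideanSpace ℝ (Fin d)))
    (y a : EuclideanSpace ℝ (Fin d)) {σ : ℝ} :
    (perturbedPoint y σ).map (fun x i => ⟪b i, x - a⟫) =
      Measure.pi fun i => (gaussianReal 0 1).map fun t => ⟪b i, y - a⟫ + σ * t := by
  have hmb : Measurable fun x : Fin d → ℝ => ∑ i, x i • b i := by fun_prop
  have hm2 : Measurable fun (x : EuclideanSpace ℝ (Fin d)) (i : Fin d) => ⟪b i, x - a⟫ :=
    measurable_pi_lambda _ fun i => by fun_prop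
  rw [perturbedPoint, stdGaussian_eq_map_pi_orthonormalBasis b, Measure.map_map (by fun_prop) hmb,
    Measure.map_map hm2 ((by fun_prop : Measurable fun v : EuclideanSpace ℝ (Fin d) =>
      y + σ • v).comp hmb), ← Measure.pi_map_pi (fun i => by fun_prop)]
  congr 1
  funext g i
  simp only [Function.comp_apply]
  rw [show y + σ • ∑ j, g j • b j - a = (y - a) + σ • ∑ j, g j • b j by abel, inner_add_right,
    inner_smul_right, inner_sum]
  simp [inner_smul_right, b.inner_eq_ite]

theorem map_affine_gaussianReal (m σ : ℝ) :
    (gaussianReal 0 1).map (fun t => m + σ * t) = gaussianReal m (σ ^ 2).toNNReal := by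
  have : (fun t : ℝ => m + σ * t) = (fun t => m + t) ∘ fun t => σ * t := rfl
  rw [this, ← Measure.map_map (by fun_prop) (by fun_prop), gaussianReal_map_const_mul,
    gaussianReal_map_const_add]
  simp only [mul_zero, zero_add, mul_one]
  congr 1
  ext; simp [sq_nonneg]

/-- The second axis is the normalised component of `z` orthogonal to `e`. If that component
vanishes, any unit vector orthogonal to `e` serves, and `2 ≤ d` provides one. With `z` the
displacement of the mean, all further coordinates of the Gaussian are centred. -/
theorem exists_unit_orthogonal {d : ℕ} (hd : 2 ≤ d) (e z : EuclideanSpace ℝ (Fin d))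
    (he : ‖e‖ = 1) :
    ∃ n : EuclideanSpace ℝ (Fin d), ‖n‖ = 1 ∧ ⟪e, n⟫ = 0 ∧ z = ⟪e, z⟫ • e + ⟪n, z⟫ • n := by
  have hee : ⟪e, e⟫ = 1 := by rw [real_inner_self_eq_norm_sq, he]; norm_num
  by_cases hq : z - ⟪e, z⟫ • e = 0
  · have hfin : 1 < Module.finrank ℝ (EuclideanSpace ℝ (Fin d)) := by
      rw [finrank_euclideanSpace, Fintype.card_fin]; omega
    have : ∃ w : EuclideanSpace ℝ (Fin d), w ≠ 0 ∧ ⟪e, w⟫ = 0 := by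
      by_contra! hcon
      have htop : (Submodule.span ℝ {e})ᗮ = ⊥ := by
        rw [Submodule.eq_bot_iff]
        intro w hw
        by_contra hw0
        exact hcon w hw0 (Submodule.mem_orthogonal_singleton_iff_inner_right.1 hw)
      rw [Submodule.orthogonal_eq_bot_iff] at htop
      have h1 := finrank_span_singleton (K := ℝ) (v := e) (by
        intro h0; rw [h0, norm_zero] at he; norm_num at he)
      rw [htop, finrank_top] at h1
      omega
    obtain ⟨w, hw0, hw⟩ := this
    refine ⟨‖w‖⁻¹ • w, norm_smul_inv_norm hw0, by rw [inner_smul_right, hw, mul_zero], ?_⟩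
    have hz : z = ⟪e, z⟫ • e := sub_eq_zero.1 hq
    have : ⟪‖w‖⁻¹ • w, z⟫ = 0 := by
      rw [hz, inner_smul_right, inner_smul_left, real_inner_comm e w, hw]; simp
    rw [this, zero_smul, add_zero]; exact hz
  · set q := z - ⟪e, z⟫ • e with hqdef
    have heq : ⟪e, q⟫ = 0 := by
      rw [hqdef, inner_sub_right, inner_smul_right, hee]; ring
    refine ⟨‖q‖⁻¹ • q, norm_smul_inv_norm hq, by rw [inner_smul_right, heq, mul_zero], ?_⟩
    have hz : z = ⟪e, z⟫ • e + q := by rw [hqdef]; abel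
    have hqz : ⟪q, z⟫ = ‖q‖ ^ 2 := by
      conv_lhs => rw [hz]
      rw [inner_add_right, inner_smul_right, real_inner_comm e q, heq, real_inner_self_eq_norm_sq];
        ring
    have hq0 : ‖q‖ ≠ 0 := norm_ne_zero_iff.2 hq
    have : ⟪‖q‖⁻¹ • q, z⟫ • (‖q‖⁻¹ • q) = q := by
      rw [real_inner_smul_left, hqz, smul_smul,
        show ‖q‖⁻¹ * ‖q‖ ^ 2 * ‖q‖⁻¹ = 1 by field_simp, one_smul]
    rw [this]; exact hz

theorem exists_orthonormalBasis_frame {k : ℕ} {e n : EuclideanSpace ℝ (Fin (k + 2))}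
    (he : ‖e‖ = 1) (hn : ‖n‖ = 1) (hen : ⟪e, n⟫ = 0) :
    ∃ b : OrthonormalBasis (Fin (k + 2)) ℝ (EuclideanSpace ℝ (Fin (k + 2))), b 0 = e ∧ b 1 = n := by
  classical
  have h01 : (1 : Fin (k + 2)) ≠ 0 := by simp
  have hv : Orthonormal ℝ (({0, 1} : Set (Fin (k + 2))).domRestrict
      fun i => if i = 0 then e else n) := by
    refine ⟨fun i => ?_, fun i j hij => ?_⟩
    · change ‖if i.1 = 0 then e else n‖ = 1
      split_ifs <;> assumption
    · change ⟪if i.1 = 0 then e else n, if j.1 = 0 then e else n⟫ = 0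
      have hij' : i.1 ≠ j.1 := fun h => hij (Subtype.ext h)
      have hi : i.1 = 0 ∨ i.1 = 1 := i.2
      have hj : j.1 = 0 ∨ j.1 = 1 := j.2
      rcases hi with hi | hi <;> rcases hj with hj | hj
      · exact absurd (hi.trans hj.symm) hij'
      · rw [if_pos hi, if_neg (by rw [hj]; exact h01)]; exact hen
      · rw [if_neg (by rw [hi]; exact h01), if_pos hj, real_inner_comm]; exact hen
      · exact absurd (hi.trans hj.symm) hij'
  obtain ⟨b, hb⟩ := hv.exists_orthonormalBasis_extension_of_card_eq (by simp)
  exact ⟨b, by simpa using hb 0 (by simp), by simpa using hb 1 (by simp)⟩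

theorem measurePreserving_pi_succ_succ {k : ℕ} (μ : Fin (k + 2) → Measure ℝ)
    [∀ i, IsProbabilityMeasure (μ i)] :
    MeasurePreserving (fun g : Fin (k + 2) → ℝ => (g 0, g 1, fun j : Fin k => g j.succ.succ))
      (Measure.pi μ) ((μ 0).prod ((μ 1).prod (Measure.pi fun j : Fin k => μ j.succ.succ))) := by
  have h1 := measurePreserving_piFinSuccAbove μ 0
  have h2 := measurePreserving_piFinSuccAbove (fun j : Fin (k + 1) => μ
    ((0 : Fin (k + 2)).succAbove j)) 0
  have h3 := ((MeasurePreserving.id (μ 0)).prod h2).comp h1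
  convert! h3 using 1

theorem map_frame_perturbedPoint {k : ℕ}
    (b : OrthonormalBasis (Fin (k + 2)) ℝ (EuclideanSpace ℝ (Fin (k + 2))))
    (y a : EuclideanSpace ℝ (Fin (k + 2))) (σ : ℝ) :
    MeasurePreserving (fun x => (⟪b 0, x - a⟫, ⟪b 1, x - a⟫, fun j : Fin k => ⟪b j.succ.succ, x -
      a⟫))
      (perturbedPoint y σ)
      ((gaussianReal ⟪b 0, y - a⟫ (σ ^ 2).toNNReal).prod
        ((gaussianReal ⟪b 1, y - a⟫ (σ ^ 2).toNNReal).prod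
          (Measure.pi fun j : Fin k => gaussianReal ⟪b j.succ.succ, y - a⟫ (σ ^ 2).toNNReal))) := by
  have hm2 : Measurable fun (x : EuclideanSpace ℝ (Fin (k + 2))) (i : Fin (k + 2)) =>
      ⟪b i, x - a⟫ := measurable_pi_lambda _ fun i => by fun_prop
  have h1 := map_inner_perturbedPoint b y a (σ := σ)
  simp only [map_affine_gaussianReal] at h1
  exact (measurePreserving_pi_succ_succ _).comp ⟨hm2, h1⟩

/-- Two orthonormal coordinates of a perturbed point are independent Gaussians. -/
theorem measurePreserving_inner_pair {d : ℕ} {e n : EuclideanSpace ℝ (Fin d)}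
    (hd : 2 ≤ d) (he : ‖e‖ = 1) (hn : ‖n‖ = 1) (hen : ⟪e, n⟫ = 0) (y a : EuclideanSpace ℝ (Fin d))
    (σ : ℝ) :
    MeasurePreserving (fun x => (⟪e, x - a⟫, ⟪n, x - a⟫)) (perturbedPoint y σ)
      ((gaussianReal ⟪e, y - a⟫ (σ ^ 2).toNNReal).prod
        (gaussianReal ⟪n, y - a⟫ (σ ^ 2).toNNReal)) := by
  obtain ⟨k, rfl⟩ : ∃ k, d = k + 2 := ⟨d - 2, by omega⟩
  obtain ⟨b, rfl, rfl⟩ := exists_orthonormalBasis_frame he hn hen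
  exact ((MeasurePreserving.id _).prod measurePreserving_fst).comp
    (map_frame_perturbedPoint b y a σ)

theorem norm_sq_eq_frame {k : ℕ}
    (b : OrthonormalBasis (Fin (k + 2)) ℝ (EuclideanSpace ℝ (Fin (k + 2))))
    (x : EuclideanSpace ℝ (Fin (k + 2))) :
    ‖x‖ ^ 2 = ⟪b 0, x⟫ ^ 2 + ⟪b 1, x⟫ ^ 2 + ∑ j : Fin k, ⟪b j.succ.succ, x⟫ ^ 2 := by
  rw [← b.sum_sq_inner_right, Fin.sum_univ_succ, Fin.sum_univ_succ, ← add_assoc]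
  rfl

/-- Cylindrical coordinates around the line through `a` and `b`, adapted to the mean. -/
theorem exists_cylindrical {d : ℕ} (hd : 2 ≤ d) {σ : ℝ} (hσ : 0 < σ)
    (y a b : EuclideanSpace ℝ (Fin d)) (hab : a ≠ b) :
    ∃ (m₁ m₂ : ℝ) (ν : Measure ℝ) (f : EuclideanSpace ℝ (Fin d) → ℝ × ℝ × ℝ),
      IsProbabilityMeasure ν ∧ (ν = Measure.dirac 0 ∨ ν ≤ ENNReal.ofReal (2 / σ) • volume) ∧
      MeasurePreserving f (perturbedPoint y σ)
        ((gaussianReal m₁ (σ ^ 2).toNNReal).prod ((gaussianReal m₂ (σ ^ 2).toNNReal).prod ν)) ∧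
      ∀ x, 0 ≤ (f x).2.2 ∧ ‖x - a‖ = √((f x).1 ^ 2 + ((f x).2.1 ^ 2 + (f x).2.2 ^ 2)) ∧
        ‖x - b‖ = √(((f x).1 - ‖b - a‖) ^ 2 + ((f x).2.1 ^ 2 + (f x).2.2 ^ 2)) := by
  obtain ⟨k, rfl⟩ : ∃ k, d = k + 2 := ⟨d - 2, by omega⟩
  have hba : b - a ≠ 0 := sub_ne_zero.2 hab.symm
  have hR : ‖b - a‖ ≠ 0 := norm_ne_zero_iff.2 hba
  have he : ‖‖b - a‖⁻¹ • (b - a)‖ = 1 := norm_smul_inv_norm hba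
  obtain ⟨n, hn, hen, hz⟩ := exists_unit_orthogonal hd _ (y - a) he
  obtain ⟨B, hB0, hB1⟩ := exists_orthonormalBasis_frame he hn hen
  -- The mean lies in the plane of the first two axes, so the norm of the remaining coordinates is
  -- that of a centred Gaussian, whose density is bounded in every dimension.
  have hmean : ∀ j : Fin k, ⟪B j.succ.succ, y - a⟫ = 0 := by
    intro j
    rw [hz, ← hB0, ← hB1, inner_add_right, inner_smul_right (B j.succ.succ) (B 0),
      inner_smul_right (B j.succ.succ) (B 1), B.inner_eq_ite, B.inner_eq_ite,
      if_neg (Fin.succ_ne_zero _), if_neg]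
    · simp
    · rw [show (1 : Fin (k + 2)) = Fin.succ 0 from rfl, Fin.succ_inj]
      exact Fin.succ_ne_zero _
  have hdir : ∀ i, ⟪B i, b - a⟫ = if i = 0 then ‖b - a‖ else 0 := by
    intro i
    have : b - a = ‖b - a‖ • B 0 := by rw [hB0, smul_smul, mul_inv_cancel₀ hR, one_smul]
    conv_lhs => rw [this]
    rw [inner_smul_right, B.inner_eq_ite]
    split_ifs <;> simp
  have hfr := map_frame_perturbedPoint B y a σ
  simp only [hmean] at hfr
  have hmn : Measurable fun v : Fin k → ℝ => √(∑ j, v j ^ 2) := by fun_prop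
  refine ⟨_, _, (Measure.pi fun _ : Fin k => gaussianReal 0 (σ ^ 2).toNNReal).map
    fun v => √(∑ j, v j ^ 2), _, Measure.isProbabilityMeasure_map hmn.aemeasurable, ?_,
    ((MeasurePreserving.id _).prod ((MeasurePreserving.id _).prod ⟨hmn, rfl⟩)).comp hfr, ?_⟩
  -- In the plane no further coordinate remains, and the radial law is the point mass at zero.
  · rcases Nat.eq_zero_or_pos k with rfl | hk
    · left
      have : (fun v : Fin 0 → ℝ => √(∑ j, v j ^ 2)) = fun _ => 0 := by funext; simp
      rw [this, Measure.map_const, measure_univ, one_smul]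
    · right
      have : Nonempty (Fin k) := ⟨⟨0, hk⟩⟩
      convert map_mul_norm_pi_gaussianReal_le (ι := Fin k) hσ using 1
      have h0 : (gaussianReal 0 (σ ^ 2).toNNReal) = (gaussianReal 0 1).map fun t => σ * t := by
        have := map_affine_gaussianReal 0 σ
        simp only [zero_add] at this
        exact this.symm
      rw [h0, ← Measure.pi_map_pi (fun i => by fun_prop), Measure.map_map hmn (by fun_prop)]
      congr 1
      funext v
      simp only [Function.comp_apply, mul_pow, ← Finset.mul_sum]
      rw [Real.sqrt_mul (sq_nonneg _), Real.sqrt_sq hσ.le]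
  · intro x
    have hx := norm_sq_eq_frame B (x - a)
    have hxb := norm_sq_eq_frame B (x - b)
    have hsub : ∀ i, ⟪B i, x - b⟫ = ⟪B i, x - a⟫ - if i = 0 then ‖b - a‖ else 0 := by
      intro i
      rw [← hdir, ← inner_sub_right]; congr 1; abel
    simp only [hsub, if_neg (Fin.succ_ne_zero _), sub_zero, if_true] at hxb
    rw [if_neg (by simp), sub_zero] at hxb
    have hs0 : 0 ≤ ∑ j : Fin k, ⟪B j.succ.succ, x - a⟫ ^ 2 :=
      Finset.sum_nonneg fun _ _ => sq_nonneg _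
    refine ⟨Real.sqrt_nonneg _, ?_, ?_⟩
    · simp only [Function.comp_apply, Prod.map_apply, id_eq, Real.sq_sqrt hs0, ← add_assoc, ← hx,
        Real.sqrt_sq (norm_nonneg _)]
    · simp only [Function.comp_apply, Prod.map_apply, id_eq, Real.sq_sqrt hs0, ← add_assoc, ← hxb,
        Real.sqrt_sq (norm_nonneg _)]

/-! ### The difference of the distances to two points -/

/-- For `u ≥ ε` multiply by the sum of the roots. For `u ≤ ε` the first root alone is at most `2 *
√ε`, whatever the second one is. -/
theorem sqrt_window {u ε : ℝ} (hε : 0 < ε) :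
    √(u + ε) - √(u - ε) ≤ 2 * ε / √(max u ε) := by
  have hm : 0 < max u ε := lt_max_of_lt_right hε
  rw [le_div_iff₀ (Real.sqrt_pos.2 hm)]
  rcases le_total ε u with h | h
  · rw [max_eq_left h]
    have h1 : √u ≤ √(u + ε) := Real.sqrt_le_sqrt (by linarith)
    have h2 := Real.sq_sqrt (show 0 ≤ u + ε by linarith)
    have h3 := Real.sq_sqrt (show 0 ≤ u - ε by linarith)
    have h4 : √(u - ε) ≤ √(u + ε) := Real.sqrt_le_sqrt (by linarith)
    nlinarith [Real.sqrt_nonneg (u - ε), Real.sqrt_nonneg u]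
  · rw [max_eq_right h]
    have h1 : √(u + ε) ≤ √(4 * ε) := Real.sqrt_le_sqrt (by linarith)
    have h2 : √(4 * ε) = 2 * √ε := by
      rw [Real.sqrt_mul (by norm_num), show (4 : ℝ) = 2 ^ 2 by norm_num,
        Real.sqrt_sq (by norm_num)]
    have h3 := Real.mul_self_sqrt hε.le
    nlinarith [Real.sqrt_nonneg (u - ε), Real.sqrt_nonneg ε]

/-- Substitution: since `f` is injective, the integral of `|f'|` over `s` is the measure of the
image, which lies in an interval of length `v - u`. -/
theorem setLIntegral_le_of_hasDerivAt {s : Set ℝ} (hs : MeasurableSet s) {f f' g : ℝ → ℝ}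
    (hf : ∀ x ∈ s, HasDerivAt f (f' x) x) (hinj : Set.InjOn f s) {k u v : ℝ} (hk : 0 ≤ k)
    (hg : ∀ x ∈ s, g x ≤ k * |f' x|) (hI : ∀ x ∈ s, f x ∈ Set.Icc u v) :
    ∫⁻ x in s, ENNReal.ofReal (g x) ≤ ENNReal.ofReal (k * (v - u)) := by
  have h := lintegral_image_eq_lintegral_abs_deriv_mul hs
    (fun x hx => (hf x hx).hasDerivWithinAt) hinj fun _ => 1
  simp only [lintegral_const, Measure.restrict_apply MeasurableSet.univ, Set.univ_inter, one_mul,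
    mul_one] at h
  calc ∫⁻ x in s, ENNReal.ofReal (g x)
      ≤ ∫⁻ x in s, ENNReal.ofReal k * ENNReal.ofReal |f' x| := by
        refine setLIntegral_mono' hs fun x hx => ?_
        rw [← ENNReal.ofReal_mul hk]
        exact ENNReal.ofReal_le_ofReal (hg x hx)
    _ = ENNReal.ofReal k * volume (f '' s) := by
        rw [h, lintegral_const_mul' _ _ ENNReal.ofReal_ne_top]
    _ ≤ ENNReal.ofReal k * volume (Set.Icc u v) := by
        gcongr
        rintro _ ⟨x, hx, rfl⟩
        exact hI x hx
    _ = _ := by rw [Real.volume_Icc, ENNReal.ofReal_mul hk]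

/-! ### Derivative estimates for the distances to two foci -/

section Focal

variable {p R q α β : ℝ}

/-- Here `α` and `β` are the distances to the foci `0` and `R` from a point with axial position `p`
and squared distance `q` from the axis. The triangle is not degenerate because `q > 0`, so the
triangle inequality is strict. -/
theorem focal_lt (hq : 0 < q) (hR : 0 < R) (hα : 0 < α) (hβ : 0 < β) (h1 : α ^ 2 = p ^ 2 + q)
    (h2 : β ^ 2 = (p - R) ^ 2 + q) : α - β < R := by
  have hb : p - R < β := by
    by_contra! h
    nlinarith
  by_contra! h
  nlinarith

theorem focal_sum_ge (hq : 0 < q) (hα : 0 < α) (hβ : 0 < β)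
    (h1 : α ^ 2 = p ^ 2 + q) (h2 : β ^ 2 = (p - R) ^ 2 + q) : R ≤ α + β := by
  have h3 : p ≤ α := by
    by_contra! h
    nlinarith
  have h4 : R - p ≤ β := by
    by_contra! h
    nlinarith
  linarith

/-- Heron's formula: both sides are sixteen times the squared area of the triangle over the base
`R`. The other two sides enter through their sum and difference only. -/
theorem focal_identity (h1 : α ^ 2 = p ^ 2 + q) (h2 : β ^ 2 = (p - R) ^ 2 + q) :
    4 * R ^ 2 * q = (R ^ 2 - (α - β) ^ 2) * ((α + β) ^ 2 - R ^ 2) := by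
  have hq : q = α ^ 2 - p ^ 2 := by linarith
  subst hq
  have h3 : 2 * R * p = α ^ 2 - β ^ 2 + R ^ 2 := by nlinarith
  have h4 : 4 * R ^ 2 * (α ^ 2 - p ^ 2) = 4 * R ^ 2 * α ^ 2 - (2 * R * p) ^ 2 := by ring
  rw [h4, h3]; ring

/-- With `η = α - β` and `ξ = α + β`, the axial derivative of `η` is `ξ (R² - η²) / (2 R α β)`. If
`α² + β² ≤ R²`, then `2αβ ≤ R² - η²`; if `2η ≤ R`, then `R - η ≥ R / 2` and `4αβ ≤ ξ²`. Either fact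
gives the bound. -/
theorem focal_deriv_axial (hq : 0 < q) (hR : 0 < R) (hα : 0 < α) (hβ : 0 < β)
    (h1 : α ^ 2 = p ^ 2 + q) (h2 : β ^ 2 = (p - R) ^ 2 + q) (hη : 0 ≤ α - β)
    (hreg : α ^ 2 + β ^ 2 ≤ R ^ 2 ∨ 2 * (α - β) ≤ R) :
    R * (R - (α - β)) / 16 ≤ α * β * (p / α - (p - R) / β) ^ 2 := by
  have hlt := focal_lt hq hR hα hβ h1 h2
  have hge := focal_sum_ge hq hα hβ h1 h2
  have h3 : 2 * R * p = α ^ 2 - β ^ 2 + R ^ 2 := by nlinarith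
  have hD : p / α - (p - R) / β = (α + β) * (R ^ 2 - (α - β) ^ 2) / (2 * R * (α * β)) := by
    field_simp
    linear_combination (β - α) * h3
  have hX : α * β * (p / α - (p - R) / β) ^ 2 =
      (α + β) ^ 2 * (R ^ 2 - (α - β) ^ 2) ^ 2 / (4 * R ^ 2 * (α * β)) := by
    rw [hD]; field_simp; ring
  rw [hX, div_le_div_iff₀ (by norm_num) (by positivity)]
  set η := α - β with hηd
  set ξ := α + β with hξd
  have hαβ : 4 * (α * β) = ξ ^ 2 - η ^ 2 := by rw [hηd, hξd]; ring
  have hw : R ^ 2 - η ^ 2 = (R - η) * (R + η) := by ring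
  have hRη : 0 < R - η := by linarith
  have hab : 0 < α * β := by positivity
  have hpos : 0 ≤ ξ ^ 2 * (R ^ 2 - η ^ 2) ^ 2 := by positivity
  rcases hreg with h | h
  · have h5 : 2 * (α * β) ≤ R ^ 2 - η ^ 2 := by nlinarith
    have h6 : R ^ 2 ≤ ξ ^ 2 := by nlinarith
    have h7 : R * (R - η) ≤ R ^ 2 - η ^ 2 := by nlinarith
    have h8 : 0 ≤ R ^ 2 - η ^ 2 := by nlinarith
    calc R * (R - η) * (4 * R ^ 2 * (α * β)) ≤
          (R ^ 2 - η ^ 2) * (4 * R ^ 2 * (α * β)) := by gcongr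
      _ = R ^ 2 * (R ^ 2 - η ^ 2) * (2 * (2 * (α * β))) := by ring
      _ ≤ ξ ^ 2 * (R ^ 2 - η ^ 2) * (2 * (R ^ 2 - η ^ 2)) := by gcongr
      _ = 2 * (ξ ^ 2 * (R ^ 2 - η ^ 2) ^ 2) := by ring
      _ ≤ _ := by linarith
  · have h6 : 4 * (α * β) ≤ ξ ^ 2 := by nlinarith [sq_nonneg η]
    have h7 : (R - η) * R ≤ R ^ 2 - η ^ 2 := by nlinarith
    calc R * (R - η) * (4 * R ^ 2 * (α * β)) = (4 * (α * β)) * (R ^ 2 * (R * (R - η))) := by ring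
      _ ≤ ξ ^ 2 * (R ^ 2 * (2 * (R - η) * (R - η))) := by gcongr; linarith
      _ = 2 * (ξ ^ 2 * ((R - η) * R) ^ 2) := by ring
      _ ≤ 2 * (ξ ^ 2 * (R ^ 2 - η ^ 2) ^ 2) := by gcongr
      _ ≤ _ := by linarith

/-- In the complementary region the transversal derivative of `η = α - β` is used; it equals `-cη /
(αβ)`. There `2αβ ≤ (α + β)² - R²`, so `focal_identity` bounds `q`, and with it `c ^ 2`, from below,
while `R < 2η` handles the factor `η`. -/
theorem focal_deriv_transversal {c : ℝ} (hq : 0 < q) (hR : 0 < R) (hα : 0 < α) (hβ : 0 < β)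
    (h1 : α ^ 2 = p ^ 2 + q) (h2 : β ^ 2 = (p - R) ^ 2 + q) (hc : q ≤ 2 * c ^ 2)
    (hreg1 : R ^ 2 < α ^ 2 + β ^ 2) (hreg2 : R < 2 * (α - β)) :
    R * (R - (α - β)) / 16 ≤ α * β * (c / α - c / β) ^ 2 := by
  have hlt := focal_lt hq hR hα hβ h1 h2
  have hid := focal_identity h1 h2
  have hD : α * β * (c / α - c / β) ^ 2 = c ^ 2 * (α - β) ^ 2 / (α * β) := by
    field_simp; ring
  rw [hD, div_le_div_iff₀ (by norm_num) (by positivity)]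
  set η := α - β with hηd
  set ξ := α + β with hξd
  have hαβ : 4 * (α * β) = ξ ^ 2 - η ^ 2 := by rw [hηd, hξd]; ring
  have hs : α ^ 2 + β ^ 2 = (ξ ^ 2 + η ^ 2) / 2 := by rw [hηd, hξd]; ring
  have h5 : 2 * (α * β) ≤ ξ ^ 2 - R ^ 2 := by nlinarith
  have h7 : R * (R - η) ≤ R ^ 2 - η ^ 2 := by nlinarith
  have h8 : 0 ≤ R * (R - η) := mul_nonneg hR.le (by linarith)
  have h9 : (R * (R - η)) * (2 * (α * β)) ≤ 4 * R ^ 2 * q := by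
    rw [hid]; exact mul_le_mul h7 h5 (by positivity) (h8.trans h7)
  have h10 : R ^ 2 ≤ 4 * η ^ 2 := by nlinarith
  calc R * (R - η) * (α * β) = (R * (R - η)) * (2 * (α * β)) / 2 := by ring
    _ ≤ 4 * R ^ 2 * q / 2 := by gcongr
    _ ≤ 4 * (4 * η ^ 2) * (2 * c ^ 2) / 2 := by gcongr
    _ = _ := by ring

end Focal

/-- The substitution is `√(R - η)` and not `η`. Its derivative carries the factor `1 / √(R - η)`,
which matches the lower bound for `g * η' ^ 2`, so the integrand is at most `8 / √R` times that
derivative. `sqrt_window` measures the image. -/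
theorem setLIntegral_slice_le {μ : Measure ℝ} {C : ℝ} (hμ : μ ≤ ENNReal.ofReal C • volume)
    {s : Set ℝ} (hs : MeasurableSet s) {η η' g : ℝ → ℝ} (hη : ∀ x ∈ s, HasDerivAt η (η' x) x)
    (hinj : Set.InjOn η s) {R t ε : ℝ} (hR : 0 < R) (hε : 0 < ε) (hlt : ∀ x ∈ s, η x < R)
    (hwin : ∀ x ∈ s, |η x - t| ≤ ε)
    (hg : ∀ x ∈ s, 0 < g x ∧ R * (R - η x) / 16 ≤ g x * η' x ^ 2) :
    ∫⁻ x in s, ENNReal.ofReal (1 / √(g x)) ∂μ ≤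
      ENNReal.ofReal C * ENNReal.ofReal (16 * (ε / (√R * √(max (R - t) ε)))) := by
  have hsR : 0 < √R := Real.sqrt_pos.2 hR
  have h1 : ∫⁻ x in s, ENNReal.ofReal (1 / √(g x)) ≤
      ENNReal.ofReal (8 / √R * (√(R - t + ε) - √(R - t - ε))) := by
    refine setLIntegral_le_of_hasDerivAt hs (f := fun x => √(R - η x))
      (f' := fun x => -η' x / (2 * √(R - η x))) (fun x hx => ?_) (fun x hx x' hx' h => ?_)
      (by positivity) (fun x hx => ?_) fun x hx => ?_
    · exact ((hη x hx).const_sub R).sqrt (by have := hlt x hx; linarith)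
    · have := (Real.sqrt_inj (by have := hlt x hx; linarith)
        (by have := hlt x' hx'; linarith)).1 h
      exact hinj hx hx' (by linarith)
    · obtain ⟨hg0, hg1⟩ := hg x hx
      have hpos : 0 < R - η x := by have := hlt x hx; linarith
      have hsq : 0 < √(R - η x) := Real.sqrt_pos.2 hpos
      rw [abs_div, abs_neg, abs_of_pos (a := 2 * √(R - η x)) (by positivity), div_mul_div_comm,
        div_le_div_iff₀ (Real.sqrt_pos.2 hg0) (by positivity)]
      have h2 : √(R * (R - η x) / 16) ≤ √(g x * η' x ^ 2) := Real.sqrt_le_sqrt hg1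
      rw [Real.sqrt_div (by positivity), Real.sqrt_mul hR.le, Real.sqrt_mul hg0.le,
        Real.sqrt_sq_eq_abs, show (16 : ℝ) = 4 ^ 2 by norm_num, Real.sqrt_sq (by norm_num)] at h2
      linarith
    · have := abs_le.1 (hwin x hx)
      exact ⟨Real.sqrt_le_sqrt (by linarith), Real.sqrt_le_sqrt (by linarith)⟩
  have h3 := sqrt_window (u := R - t) hε
  calc ∫⁻ x in s, ENNReal.ofReal (1 / √(g x)) ∂μ
      ≤ ∫⁻ x in s, ENNReal.ofReal (1 / √(g x)) ∂(ENNReal.ofReal C • volume) :=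
        lintegral_mono' (Measure.restrict_mono le_rfl hμ) le_rfl
    _ = ENNReal.ofReal C * ∫⁻ x in s, ENNReal.ofReal (1 / √(g x)) := by
        rw [Measure.restrict_smul, lintegral_smul_measure, smul_eq_mul]
    _ ≤ _ := by
        gcongr
        refine h1.trans (ENNReal.ofReal_le_ofReal ?_)
        calc 8 / √R * (√(R - t + ε) - √(R - t - ε)) ≤ 8 / √R * (2 * ε / √(max (R - t) ε)) := by
              gcongr
          _ = _ := by field_simp; norm_num

theorem hasDerivAt_sqrt_sq_add {x q : ℝ} (a : ℝ) (h : 0 < (x - a) ^ 2 + q) :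
    HasDerivAt (fun x => √((x - a) ^ 2 + q)) ((x - a) / √((x - a) ^ 2 + q)) x := by
  have h1 : HasDerivAt (fun x : ℝ => (x - a) ^ 2 + q) (2 * (x - a)) x := by
    have := (((hasDerivAt_id x).sub_const a).pow 2).add_const q
    simpa using this
  have := h1.sqrt h.ne'
  convert this using 1
  field_simp

/-- The set of points, in cylindrical coordinates, at which the difference of the distances to the
two foci is nonnegative and lies in a given window. -/
def focalWindow (R t ε : ℝ) : Set (ℝ × ℝ × ℝ) :=
  {z | 0 ≤ √(z.1 ^ 2 + (z.2.1 ^ 2 + z.2.2 ^ 2)) - √((z.1 - R) ^ 2 + (z.2.1 ^ 2 + z.2.2 ^ 2)) ∧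
    |√(z.1 ^ 2 + (z.2.1 ^ 2 + z.2.2 ^ 2)) - √((z.1 - R) ^ 2 + (z.2.1 ^ 2 + z.2.2 ^ 2)) - t| ≤ ε}

/-- The part of the cylindrical coordinate space in which one differentiates along the axis. -/
def axialRegion (R : ℝ) : Set (ℝ × ℝ × ℝ) :=
  {z | (z.1 ^ 2 + (z.2.1 ^ 2 + z.2.2 ^ 2)) + ((z.1 - R) ^ 2 + (z.2.1 ^ 2 + z.2.2 ^ 2)) ≤ R ^ 2 ∨
    2 * (√(z.1 ^ 2 + (z.2.1 ^ 2 + z.2.2 ^ 2)) - √((z.1 - R) ^ 2 + (z.2.1 ^ 2 + z.2.2 ^ 2))) ≤ R}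

/-- The weight by which the window is integrated. -/
noncomputable def focalWeight (R : ℝ) (z : ℝ × ℝ × ℝ) : ℝ :=
  √(z.1 ^ 2 + (z.2.1 ^ 2 + z.2.2 ^ 2)) * √((z.1 - R) ^ 2 + (z.2.1 ^ 2 + z.2.2 ^ 2))

theorem measurableSet_focalWindow (R t ε : ℝ) : MeasurableSet (focalWindow R t ε) := by
  simp only [focalWindow, Set.ofPred_and]
  exact (measurableSet_le (by fun_prop) (by fun_prop)).inter
    (measurableSet_le (by fun_prop) (by fun_prop))

theorem measurableSet_axialRegion (R : ℝ) : MeasurableSet (axialRegion R) := by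
  simp only [axialRegion, Set.ofPred_or]
  exact (measurableSet_le (by fun_prop) (by fun_prop)).union
    (measurableSet_le (by fun_prop) (by fun_prop))

/-- Off the axis (`c ≠ 0`) the difference of the distances is strictly increasing in the axial
coordinate, which supplies the injectivity for `setLIntegral_slice_le`. -/
theorem setLIntegral_axial {μ : Measure ℝ} {C : ℝ} (hμ : μ ≤ ENNReal.ofReal C • volume)
    {R t ε : ℝ} (hR : 0 < R) (hε : 0 < ε) {c w : ℝ} (hc : c ≠ 0) :
    ∫⁻ p in {p | (p, c, w) ∈ focalWindow R t ε ∩ axialRegion R},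
      ENNReal.ofReal (1 / √(focalWeight R (p, c, w))) ∂μ ≤
      ENNReal.ofReal C * ENNReal.ofReal (16 * (ε / (√R * √(max (R - t) ε)))) := by
  have hq : 0 < c ^ 2 + w ^ 2 := by positivity
  set q := c ^ 2 + w ^ 2 with hqd
  have hder : ∀ p, HasDerivAt (fun p => √(p ^ 2 + q) - √((p - R) ^ 2 + q))
      (p / √(p ^ 2 + q) - (p - R) / √((p - R) ^ 2 + q)) p := by
    intro p
    have h1 := hasDerivAt_sqrt_sq_add (x := p) (q := q) 0 (by positivity)
    simp only [sub_zero] at h1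
    exact h1.sub (hasDerivAt_sqrt_sq_add R (by positivity))
  have hmono : StrictMono fun p => √(p ^ 2 + q) - √((p - R) ^ 2 + q) := by
    refine strictMono_of_deriv_pos fun p => ?_
    rw [(hder p).deriv]
    have hα : 0 < √(p ^ 2 + q) := Real.sqrt_pos.2 (by positivity)
    have hβ : 0 < √((p - R) ^ 2 + q) := Real.sqrt_pos.2 (by positivity)
    have h1 := Real.sq_sqrt (show 0 ≤ p ^ 2 + q by positivity)
    have h2 := Real.sq_sqrt (show 0 ≤ (p - R) ^ 2 + q by positivity)
    set α := √(p ^ 2 + q)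
    set β := √((p - R) ^ 2 + q)
    have hlt := focal_lt hq hR hα hβ h1 h2
    have hlt' := focal_lt (p := R - p) (R := R) hq hR hβ hα (by rw [h2]; ring) (by rw [h1]; ring)
    have h3 : 2 * R * p = α ^ 2 - β ^ 2 + R ^ 2 := by nlinarith
    have hD : p / α - (p - R) / β =
        (α + β) * ((R - (α - β)) * (R - (β - α))) / (2 * R * (α * β)) := by
      field_simp
      linear_combination (β - α) * h3
    rw [hD]
    have h5 : 0 < R - (α - β) := by linarith
    have h6 : 0 < R - (β - α) := by linarith
    positivity
  refine setLIntegral_slice_le hμ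
    (measurableSet_preimage (f := fun p : ℝ => (p, c, w)) (by fun_prop)
      ((measurableSet_focalWindow R t ε).inter (measurableSet_axialRegion R)))
    (fun p _ => hder p) hmono.injective.injOn hR hε
    (g := fun p => focalWeight R (p, c, w)) (fun p hp => ?_) (fun p hp => hp.1.2) fun p hp => ?_
  all_goals
    have hα : 0 < √(p ^ 2 + q) := Real.sqrt_pos.2 (by positivity)
    have hβ : 0 < √((p - R) ^ 2 + q) := Real.sqrt_pos.2 (by positivity)
    have h1 := Real.sq_sqrt (show 0 ≤ p ^ 2 + q by positivity)
    have h2 := Real.sq_sqrt (show 0 ≤ (p - R) ^ 2 + q by positivity)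
  · exact focal_lt hq hR hα hβ h1 h2
  · refine ⟨mul_pos hα hβ, focal_deriv_axial hq hR hα hβ h1 h2 hp.1.1 ?_⟩
    rw [h1, h2]
    exact hp.2

/-- Injectivity in `c`: the product of the difference and the sum of the two distances is `2pR -
R²`, free of `c`. The difference is nonzero in this region, so it determines the sum, hence both
distances, hence `c > 0`. The condition `w ^ 2 ≤ c ^ 2` gives `q ≤ 2 * c ^ 2`. -/
theorem setLIntegral_transversal {μ : Measure ℝ} {C : ℝ} (hμ : μ ≤ ENNReal.ofReal C • volume)
    {R t ε : ℝ} (hR : 0 < R) (hε : 0 < ε) {p w : ℝ} :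
    ∫⁻ c in {c | (p, c, w) ∈ focalWindow R t ε \ axialRegion R ∧ w ^ 2 ≤ c ^ 2 ∧ 0 < c},
      ENNReal.ofReal (1 / √(focalWeight R (p, c, w))) ∂μ ≤
      ENNReal.ofReal C * ENNReal.ofReal (16 * (ε / (√R * √(max (R - t) ε)))) := by
  have hder : ∀ c : ℝ, 0 < c → HasDerivAt
      (fun c => √(p ^ 2 + (c ^ 2 + w ^ 2)) - √((p - R) ^ 2 + (c ^ 2 + w ^ 2)))
      (c / √(p ^ 2 + (c ^ 2 + w ^ 2)) - c / √((p - R) ^ 2 + (c ^ 2 + w ^ 2))) c := by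
    intro c hc
    have h1 := hasDerivAt_sqrt_sq_add (x := c) (q := p ^ 2 + w ^ 2) 0 (by positivity)
    have h2 := hasDerivAt_sqrt_sq_add (x := c) (q := (p - R) ^ 2 + w ^ 2) 0 (by positivity)
    simp only [sub_zero] at h1 h2
    have e1 : ∀ c : ℝ, p ^ 2 + (c ^ 2 + w ^ 2) = c ^ 2 + (p ^ 2 + w ^ 2) := fun c => by ring
    have e2 : ∀ c : ℝ, (p - R) ^ 2 + (c ^ 2 + w ^ 2) = c ^ 2 + ((p - R) ^ 2 + w ^ 2) :=
      fun c => by ring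
    simp only [e1, e2]
    exact h1.sub h2
  have hmeas : MeasurableSet
      {c | (p, c, w) ∈ focalWindow R t ε \ axialRegion R ∧ w ^ 2 ≤ c ^ 2 ∧ 0 < c} := by
    simp only [Set.ofPred_and]
    refine (measurableSet_preimage (f := fun c : ℝ => (p, c, w)) (by fun_prop)
      ((measurableSet_focalWindow R t ε).diff (measurableSet_axialRegion R))).inter ?_
    exact (measurableSet_le (by fun_prop) (by fun_prop)).inter
      (measurableSet_lt (by fun_prop) (by fun_prop))
  have hfacts : ∀ c ∈ {c | (p, c, w) ∈ focalWindow R t ε \ axialRegion R ∧ w ^ 2 ≤ c ^ 2 ∧ 0 < c},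
      0 < c ∧ R ^ 2 < (p ^ 2 + (c ^ 2 + w ^ 2)) + ((p - R) ^ 2 + (c ^ 2 + w ^ 2)) ∧
      R < 2 * (√(p ^ 2 + (c ^ 2 + w ^ 2)) - √((p - R) ^ 2 + (c ^ 2 + w ^ 2))) := by
    intro c hc
    have := hc.1.2
    simp only [axialRegion, Set.mem_ofPred_eq, not_or, not_le] at this
    exact ⟨hc.2.2, this⟩
  refine setLIntegral_slice_le hμ hmeas (fun c hc => hder c hc.2.2) ?_ hR hε
    (g := fun c => focalWeight R (p, c, w)) (fun c hc => ?_) (fun c hc => hc.1.1.2) fun c hc => ?_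
  · intro c hc c' hc' h
    obtain ⟨hc0, -, hη⟩ := hfacts c hc
    obtain ⟨hc0', -, -⟩ := hfacts c' hc'
    have key : ∀ c : ℝ, (√(p ^ 2 + (c ^ 2 + w ^ 2)) - √((p - R) ^ 2 + (c ^ 2 + w ^ 2))) *
        (√(p ^ 2 + (c ^ 2 + w ^ 2)) + √((p - R) ^ 2 + (c ^ 2 + w ^ 2))) = 2 * p * R - R ^ 2 := by
      intro c
      have h1 := Real.sq_sqrt (show 0 ≤ p ^ 2 + (c ^ 2 + w ^ 2) by positivity)
      have h2 := Real.sq_sqrt (show 0 ≤ (p - R) ^ 2 + (c ^ 2 + w ^ 2) by positivity)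
      linear_combination h1 - h2
    have hsum : √(p ^ 2 + (c ^ 2 + w ^ 2)) + √((p - R) ^ 2 + (c ^ 2 + w ^ 2)) =
        √(p ^ 2 + (c' ^ 2 + w ^ 2)) + √((p - R) ^ 2 + (c' ^ 2 + w ^ 2)) := by
      have h1 := key c
      have h2 := key c'
      simp only at h
      rw [← h, ← h1] at h2
      exact (mul_left_cancel₀ (by linarith) h2).symm
    simp only at h
    have hsq : √(p ^ 2 + (c ^ 2 + w ^ 2)) = √(p ^ 2 + (c' ^ 2 + w ^ 2)) := by linarith
    rw [Real.sqrt_inj (by positivity) (by positivity)] at hsq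
    have : c ^ 2 = c' ^ 2 := by linarith
    exact (pow_left_inj₀ hc0.le hc0'.le two_ne_zero).1 this
  all_goals
    obtain ⟨hc0, hr1, hr2⟩ := hfacts c hc
    have hq : 0 < c ^ 2 + w ^ 2 := by positivity
    have hα : 0 < √(p ^ 2 + (c ^ 2 + w ^ 2)) := Real.sqrt_pos.2 (by positivity)
    have hβ : 0 < √((p - R) ^ 2 + (c ^ 2 + w ^ 2)) := Real.sqrt_pos.2 (by positivity)
    have h1 := Real.sq_sqrt (show 0 ≤ p ^ 2 + (c ^ 2 + w ^ 2) by positivity)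
    have h2 := Real.sq_sqrt (show 0 ≤ (p - R) ^ 2 + (c ^ 2 + w ^ 2) by positivity)
  · exact focal_lt hq hR hα hβ h1 h2
  · refine ⟨mul_pos hα hβ, focal_deriv_transversal hq hR hα hβ h1 h2 ?_ ?_ hr2⟩
    · have := hc.2.1; linarith
    · rw [h1, h2]; exact hr1

/-- The part of the cylindrical coordinate space in which one differentiates along the second
coordinate. -/
def transversalRegion (R t ε : ℝ) : Set (ℝ × ℝ × ℝ) :=
  {z | z ∈ focalWindow R t ε \ axialRegion R ∧ z.2.2 ^ 2 ≤ z.2.1 ^ 2 ∧ z.2.1 ≠ 0}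

theorem measurableSet_transversalRegion (R t ε : ℝ) :
    MeasurableSet (transversalRegion R t ε) := by
  simp only [transversalRegion, Set.ofPred_and]
  refine ((measurableSet_focalWindow R t ε).diff (measurableSet_axialRegion R)).inter ?_
  refine (measurableSet_le (by fun_prop) (by fun_prop)).inter ?_
  exact (measurableSet_eq_fun (by fun_prop) (by fun_prop)).compl

/-- Negative `c` are reflected to positive ones. Window and weight are even in `c`, and the
reflected measure obeys the same density bound. -/
theorem setLIntegral_transversalRegion {μ : Measure ℝ} {C : ℝ}
    (hμ : μ ≤ ENNReal.ofReal C • volume) {R t ε : ℝ} (hR : 0 < R) (hε : 0 < ε) {p w : ℝ} :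
    ∫⁻ c in {c | (p, c, w) ∈ transversalRegion R t ε},
      ENNReal.ofReal (1 / √(focalWeight R (p, c, w))) ∂μ ≤
      2 * (ENNReal.ofReal C * ENNReal.ofReal (16 * (ε / (√R * √(max (R - t) ε))))) := by
  set S := {c | (p, c, w) ∈ focalWindow R t ε \ axialRegion R ∧ w ^ 2 ≤ c ^ 2 ∧ 0 < c} with hS
  have hneg : μ.map (fun c => -c) ≤ ENNReal.ofReal C • volume := by
    have h := Measure.map_mono (f := fun c : ℝ => -c) hμ (by fun_prop)
    rw [Measure.map_smul] at h
    have h2 : (volume : Measure ℝ).map (fun c => -c) = volume := Measure.map_neg_eq_self volume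
    rwa [h2] at h
  have hmS : MeasurableSet S := by
    rw [hS]
    simp only [Set.ofPred_and]
    refine (measurableSet_preimage (f := fun c : ℝ => (p, c, w)) (by fun_prop)
      ((measurableSet_focalWindow R t ε).diff (measurableSet_axialRegion R))).inter ?_
    exact (measurableSet_le (by fun_prop) (by fun_prop)).inter
      (measurableSet_lt (by fun_prop) (by fun_prop))
  have hmg : Measurable fun c : ℝ => ENNReal.ofReal (1 / √(focalWeight R (p, c, w))) := by
    unfold focalWeight; fun_prop
  have hsub : {c | (p, c, w) ∈ transversalRegion R t ε} ⊆ S ∪ (fun c : ℝ => -c) ⁻¹' S := by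
    intro c hc
    obtain ⟨h1, h2, h3⟩ := hc
    rcases lt_or_gt_of_ne h3 with h | h
    · right
      refine ⟨?_, by simpa using h2, by simpa using h⟩
      simpa [focalWindow, axialRegion] using h1
    · left
      exact ⟨h1, h2, h⟩
  calc _ ≤ ∫⁻ c in S ∪ (fun c : ℝ => -c) ⁻¹' S,
        ENNReal.ofReal (1 / √(focalWeight R (p, c, w))) ∂μ := lintegral_mono_set hsub
    _ ≤ (∫⁻ c in S, ENNReal.ofReal (1 / √(focalWeight R (p, c, w))) ∂μ) +
        ∫⁻ c in (fun c : ℝ => -c) ⁻¹' S, ENNReal.ofReal (1 / √(focalWeight R (p, c, w))) ∂μ :=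
        lintegral_union_le _ _ _
    _ = (∫⁻ c in S, ENNReal.ofReal (1 / √(focalWeight R (p, c, w))) ∂μ) +
        ∫⁻ c in S, ENNReal.ofReal (1 / √(focalWeight R (p, c, w))) ∂(μ.map fun c => -c) := by
        rw [setLIntegral_map hmS hmg (by fun_prop)]
        simp only [focalWeight, neg_sq]
    _ ≤ _ := by
        rw [two_mul]
        exact add_le_add (setLIntegral_transversal hμ hR hε) (setLIntegral_transversal hneg hR hε)

/-- Integrate along the axis on the axial region, and elsewhere along whichever of the other two
coordinates is larger in absolute value, so that it carries at least half of `q`. The constant is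
`16 · (1 + 2 · 1 + 2 · 2) = 112`, the last term using the density bound `2 / σ` of the radial part.
-/
theorem lintegral_prod_focalWindow {N₁ N₂ ν : Measure ℝ} [IsProbabilityMeasure N₁]
    [IsProbabilityMeasure N₂] [IsProbabilityMeasure ν] {σ : ℝ} (hσ : 0 < σ)
    (h₁ : N₁ ≤ ENNReal.ofReal (1 / σ) • volume) (h₂ : N₂ ≤ ENNReal.ofReal (1 / σ) • volume)
    (hν : ν = Measure.dirac 0 ∨ ν ≤ ENNReal.ofReal (2 / σ) • volume) {R t ε : ℝ} (hR : 0 < R)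
    (hε : 0 < ε) :
    ∫⁻ z in focalWindow R t ε, ENNReal.ofReal (1 / √(focalWeight R z)) ∂(N₁.prod (N₂.prod ν)) ≤
      ENNReal.ofReal (112 / σ * (ε / (√R * √(max (R - t) ε)))) := by
  set K := ENNReal.ofReal (16 * (ε / (√R * √(max (R - t) ε)))) with hK
  set F : ℝ × ℝ × ℝ → ℝ≥0∞ := fun z => ENNReal.ofReal (1 / √(focalWeight R z)) with hF
  have hmF : Measurable F := by rw [hF]; unfold focalWeight; fun_prop
  let sw : ℝ × ℝ × ℝ → ℝ × ℝ × ℝ := fun z => (z.1, z.2.2, z.2.1)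
  have hsw : Measurable sw := by fun_prop
  have hmT := measurableSet_transversalRegion R t ε
  have hFsw : ∀ z, F (sw z) = F z := by
    intro z
    simp only [hF, focalWeight, sw, add_comm (z.2.2 ^ 2)]
  have hwinsw : ∀ z, z ∈ focalWindow R t ε → sw z ∈ focalWindow R t ε := by
    intro z hz
    simp only [focalWindow, sw, Set.mem_ofPred_eq, add_comm (z.2.2 ^ 2)] at hz ⊢
    exact hz
  have haxsw : ∀ z, sw z ∈ axialRegion R → z ∈ axialRegion R := by
    intro z hz
    simp only [axialRegion, sw, Set.mem_ofPred_eq, add_comm (z.2.2 ^ 2)] at hz ⊢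
    exact hz
  set A : Set (ℝ × ℝ × ℝ) := {z | z ∈ focalWindow R t ε ∩ axialRegion R ∧ z.2.1 ≠ 0} with hA
  set Z : Set (ℝ × ℝ × ℝ) := {z | z.2.1 = 0} with hZ
  have hmZ : MeasurableSet Z := measurableSet_eq_fun (by fun_prop) (by fun_prop)
  have hmA : MeasurableSet A := by
    have : A = (focalWindow R t ε ∩ axialRegion R) ∩ Zᶜ := rfl
    rw [this]
    exact ((measurableSet_focalWindow R t ε).inter (measurableSet_axialRegion R)).inter hmZ.compl
  have hcover : focalWindow R t ε ⊆
      Z ∪ (A ∪ (transversalRegion R t ε ∪ sw ⁻¹' transversalRegion R t ε)) := by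
    intro z hz
    by_cases h0 : z.2.1 = 0
    · exact Or.inl h0
    right
    by_cases hax : z ∈ axialRegion R
    · exact Or.inl ⟨⟨hz, hax⟩, h0⟩
    right
    rcases le_total (z.2.2 ^ 2) (z.2.1 ^ 2) with h | h
    · exact Or.inl ⟨⟨hz, hax⟩, h, h0⟩
    · right
      refine ⟨⟨hwinsw z hz, fun h' => hax (haxsw z h')⟩, h, ?_⟩
      intro h1
      change z.2.2 = 0 at h1
      rw [h1] at h
      exact h0 (by nlinarith)
  -- Discarding this null set keeps the axial slices off the axis.
  have hZ0 : (N₁.prod (N₂.prod ν)) Z = 0 := by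
    have h0 : N₂ {0} = 0 := by
      have := h₂ {0}
      simpa using this
    have : Z = Set.univ ×ˢ ({0} ×ˢ Set.univ) := by
      ext z; simp [hZ]
    rw [this, Measure.prod_prod, Measure.prod_prod, h0]; simp
  have hbA : ∫⁻ z in A, F z ∂(N₁.prod (N₂.prod ν)) ≤ ENNReal.ofReal (1 / σ) * K := by
    rw [← lintegral_indicator hmA, lintegral_prod_symm' _ (hmF.indicator hmA)]
    calc _ ≤ ∫⁻ _ : ℝ × ℝ, ENNReal.ofReal (1 / σ) * K ∂(N₂.prod ν) := by
          refine lintegral_mono fun m => ?_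
          by_cases hc : m.1 = 0
          · have : ∀ p, A.indicator F (p, m) = 0 := fun p =>
              Set.indicator_of_notMem (fun h => h.2 hc) _
            simp only [this, lintegral_zero, zero_le]
          · have := setLIntegral_axial h₁ hR hε (t := t) (w := m.2) hc
            rw [← lintegral_indicator] at this
            · refine le_trans (lintegral_mono fun p => ?_) this
              by_cases hz : (p, m) ∈ A
              · rw [Set.indicator_of_mem hz, Set.indicator_of_mem (by exact hz.1)]
              · rw [Set.indicator_of_notMem hz]
                exact bot_le
            · exact measurableSet_preimage (f := fun p : ℝ => (p, m.1, m.2)) (by fun_prop)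
                ((measurableSet_focalWindow R t ε).inter (measurableSet_axialRegion R))
      _ = _ := by simp
  have hbB : ∫⁻ z in transversalRegion R t ε, F z ∂(N₁.prod (N₂.prod ν)) ≤
      2 * (ENNReal.ofReal (1 / σ) * K) := by
    rw [← lintegral_indicator hmT, lintegral_prod _ (hmF.indicator hmT).aemeasurable]
    calc _ ≤ ∫⁻ _ : ℝ, ∫⁻ _ : ℝ, 2 * (ENNReal.ofReal (1 / σ) * K) ∂ν ∂N₁ := by
          refine lintegral_mono fun p => ?_
          rw [lintegral_prod_symm' _ (show Measurable fun z : ℝ × ℝ =>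
            (transversalRegion R t ε).indicator F (p, z) from
            (hmF.indicator hmT).comp measurable_prodMk_left)]
          refine lintegral_mono fun w => ?_
          have := setLIntegral_transversalRegion h₂ hR hε (t := t) (p := p) (w := w)
          rw [← lintegral_indicator] at this
          · exact this
          · exact measurableSet_preimage (f := fun c : ℝ => (p, c, w)) (by fun_prop) hmT
      _ = _ := by simp
  have hbC : ∫⁻ z in sw ⁻¹' transversalRegion R t ε, F z ∂(N₁.prod (N₂.prod ν)) ≤
      2 * (ENNReal.ofReal (2 / σ) * K) := by
    rw [← lintegral_indicator (hsw hmT),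
      lintegral_prod _ (hmF.indicator (hsw hmT)).aemeasurable]
    calc _ ≤ ∫⁻ _ : ℝ, ∫⁻ _ : ℝ, 2 * (ENNReal.ofReal (2 / σ) * K) ∂N₂ ∂N₁ := by
          refine lintegral_mono fun p => ?_
          have hmp : Measurable fun z : ℝ × ℝ => (sw ⁻¹' transversalRegion R t ε).indicator F
            (p, z) :=
            (hmF.indicator (hsw hmT)).comp measurable_prodMk_left
          rw [lintegral_prod _ hmp.aemeasurable]
          refine lintegral_mono fun c => ?_
          -- A point mass at zero contributes nothing: the swapped region requires the radial
          -- coordinate to be nonzero.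
          rcases hν with rfl | hν
          · rw [lintegral_dirac' _ (show Measurable fun w => (sw ⁻¹' transversalRegion R t
              ε).indicator F
              (p, c, w) from hmp.comp measurable_prodMk_left),
              Set.indicator_of_notMem]
            · exact bot_le
            · exact fun h => h.2.2 rfl
          · have := setLIntegral_transversalRegion hν hR hε (t := t) (p := p) (w := c)
            rw [← lintegral_indicator] at this
            · refine le_trans (lintegral_mono fun w => ?_) this
              by_cases hz : (p, c, w) ∈ sw ⁻¹' transversalRegion R t ε
              · rw [Set.indicator_of_mem hz, Set.indicator_of_mem (by exact hz), ← hFsw]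
              · rw [Set.indicator_of_notMem hz]
                exact bot_le
            · exact measurableSet_preimage (f := fun w : ℝ => (p, w, c)) (by fun_prop) hmT
      _ = _ := by simp
  calc _ ≤ ∫⁻ z in Z ∪ (A ∪ (transversalRegion R t ε ∪ sw ⁻¹' transversalRegion R t ε)), F z
        ∂(N₁.prod (N₂.prod ν)) := lintegral_mono_set hcover
    _ ≤ 0 + (ENNReal.ofReal (1 / σ) * K + (2 * (ENNReal.ofReal (1 / σ) * K) +
        2 * (ENNReal.ofReal (2 / σ) * K))) := by
        refine (lintegral_union_le _ _ _).trans (add_le_add ?_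
          ((lintegral_union_le _ _ _).trans (add_le_add hbA
          ((lintegral_union_le _ _ _).trans (add_le_add hbB hbC)))))
        exact (setLIntegral_measure_zero _ _ hZ0).le
    _ = ENNReal.ofReal (112 / σ * (ε / (√R * √(max (R - t) ε)))) := by
        rw [hK, zero_add, ← ENNReal.ofReal_mul (by positivity), ← ENNReal.ofReal_mul
          (by positivity),
          ← ENNReal.ofReal_ofNat, ← ENNReal.ofReal_mul (by positivity),
          ← ENNReal.ofReal_mul (by positivity), ← ENNReal.ofReal_add (by positivity)
            (by positivity),
          ← ENNReal.ofReal_add (by positivity) (by positivity)]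
        congr 1; ring

/-- The density of the difference of the distances of a perturbed point to two fixed points. -/
theorem setLIntegral_dist_sub_dist_le {d : ℕ} (hd : 2 ≤ d) {σ : ℝ} (hσ : 0 < σ)
    (y a b : EuclideanSpace ℝ (Fin d)) (hab : a ≠ b) (t : ℝ) {ε : ℝ} (hε : 0 < ε) :
    ∫⁻ x in {x | 0 ≤ ‖x - a‖ - ‖x - b‖ ∧ |‖x - a‖ - ‖x - b‖ - t| ≤ ε},
      ENNReal.ofReal (1 / √(‖x - a‖ * ‖x - b‖)) ∂(perturbedPoint y σ) ≤
      ENNReal.ofReal (112 / σ * (ε / (√‖b - a‖ * √(max (‖b - a‖ - t) ε)))) := by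
  obtain ⟨m₁, m₂, ν, f, hν, hν', hf, hfx⟩ := exists_cylindrical hd hσ y a b hab
  have hR : 0 < ‖b - a‖ := norm_pos_iff.2 (sub_ne_zero.2 hab.symm)
  have h := lintegral_prod_focalWindow hσ (gaussianReal_le hσ m₁) (gaussianReal_le hσ m₂) hν' hR hε
    (t := t)
  rw [← hf.setLIntegral_comp_preimage (measurableSet_focalWindow _ _ _)
    (show Measurable fun z => ENNReal.ofReal (1 / √(focalWeight ‖b - a‖ z)) by
      unfold focalWeight; fun_prop)] at h
  convert h using 4 with x
  · ext x
    simp only [focalWindow, Set.mem_preimage, Set.mem_ofPred_eq, ← (hfx x).2.1, ← (hfx x).2.2]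
  · simp only [focalWeight, ← (hfx x).2.1, ← (hfx x).2.2]

/-! ### Power integrals on the line and one-dimensional negative moments -/

theorem lintegral_comp_abs {f : ℝ → ℝ≥0∞} (hf : Measurable f) :
    ∫⁻ s, f |s| = 2 * ∫⁻ s in Set.Ioi 0, f s := by
  rw [← lintegral_add_compl (fun s => f |s|) (measurableSet_Ioi (a := (0 : ℝ))), two_mul,
    Set.compl_Ioi, ← setLIntegral_congr (Iio_ae_eq_Iic (a := (0 : ℝ)))]
  congr 1
  · exact setLIntegral_congr_fun measurableSet_Ioi fun s hs => by
      rw [abs_of_pos (Set.mem_Ioi.1 hs)]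
  · have h := (Measure.measurePreserving_neg (volume : Measure ℝ)).setLIntegral_comp_preimage
      (measurableSet_Ioi (a := (0 : ℝ))) hf
    rw [← h]
    have : (fun x : ℝ => -x) ⁻¹' Set.Ioi 0 = Set.Iio 0 := by ext; simp
    change _ = ∫⁻ a in (fun x : ℝ => -x) ⁻¹' Set.Ioi 0, _
    rw [this]
    exact setLIntegral_congr_fun measurableSet_Iio fun s hs => by
      rw [abs_of_neg (Set.mem_Iio.1 hs)]

theorem setLIntegral_abs_le_rpow {M q : ℝ} (hM : 0 < M) (hq : q < 1) :
    ∫⁻ s in {s : ℝ | |s| ≤ M}, ENNReal.ofReal |s| ^ (-q) ≤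
      ENNReal.ofReal (2 / (1 - q) * M ^ (1 - q)) := by
  have hq' : 0 < 1 - q := by linarith
  have hm : Measurable ((Set.Iic M).indicator fun s : ℝ => ENNReal.ofReal s ^ (-q)) :=
    (by fun_prop : Measurable fun s : ℝ => ENNReal.ofReal s ^ (-q)).indicator measurableSet_Iic
  rw [← lintegral_indicator (measurableSet_le (by fun_prop) (by fun_prop))]
  have h := lintegral_comp_abs hm
  have e : ∀ s : ℝ, ({s : ℝ | |s| ≤ M}.indicator fun s : ℝ => ENNReal.ofReal |s| ^ (-q)) s =
      (Set.Iic M).indicator (fun s : ℝ => ENNReal.ofReal s ^ (-q)) |s| := fun s => rfl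
  simp only [e]
  rw [h, setLIntegral_indicator measurableSet_Iic, Set.inter_comm, Set.Ioi_inter_Iic]
  have h1 : ∫⁻ s in Set.Ioc 0 M, ENNReal.ofReal s ^ (-q) =
      ∫⁻ s in Set.Ioc 0 M, ENNReal.ofReal (s ^ (-q)) :=
    setLIntegral_congr_fun measurableSet_Ioc fun s hs => ENNReal.ofReal_rpow_of_pos hs.1
  have hint : IntegrableOn (fun s : ℝ => s ^ (-q)) (Set.Ioc 0 M) :=
    (intervalIntegrable_iff_integrableOn_Ioc_of_le hM.le).1
      (intervalIntegral.intervalIntegrable_rpow' (by linarith))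
  rw [h1, ← ofReal_integral_eq_lintegral_ofReal hint, ← intervalIntegral.integral_of_le hM.le,
    integral_rpow (Or.inl (by linarith)), Real.zero_rpow (by linarith), sub_zero,
    ← ENNReal.ofReal_ofNat, ← ENNReal.ofReal_mul (by norm_num)]
  · refine le_of_eq ?_
    congr 1
    rw [show -q + 1 = 1 - q by ring]
    ring
  · filter_upwards [ae_restrict_mem measurableSet_Ioc] with s hs
    exact Real.rpow_nonneg hs.1.le _

theorem setLIntegral_lt_abs_rpow {M q : ℝ} (hM : 0 < M) (hq : 1 < q) :
    ∫⁻ s in {s : ℝ | M < |s|}, ENNReal.ofReal |s| ^ (-q) ≤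
      ENNReal.ofReal (2 / (q - 1) * M ^ (1 - q)) := by
  have hq' : 0 < q - 1 := by linarith
  have hm : Measurable ((Set.Ioi M).indicator fun s : ℝ => ENNReal.ofReal s ^ (-q)) :=
    (by fun_prop : Measurable fun s : ℝ => ENNReal.ofReal s ^ (-q)).indicator measurableSet_Ioi
  rw [← lintegral_indicator (measurableSet_lt (by fun_prop) (by fun_prop))]
  have h := lintegral_comp_abs hm
  have e : ∀ s : ℝ, ({s : ℝ | M < |s|}.indicator fun s : ℝ => ENNReal.ofReal |s| ^ (-q)) s =
      (Set.Ioi M).indicator (fun s : ℝ => ENNReal.ofReal s ^ (-q)) |s| := fun s => rfl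
  simp only [e]
  rw [h, setLIntegral_indicator measurableSet_Ioi, Set.Ioi_inter_Ioi, max_eq_left hM.le]
  have h1 : ∫⁻ s in Set.Ioi M, ENNReal.ofReal s ^ (-q) =
      ∫⁻ s in Set.Ioi M, ENNReal.ofReal (s ^ (-q)) :=
    setLIntegral_congr_fun measurableSet_Ioi fun s hs =>
      ENNReal.ofReal_rpow_of_pos (hM.trans hs)
  rw [h1, ← ofReal_integral_eq_lintegral_ofReal
    (integrableOn_Ioi_rpow_of_lt (by linarith) hM),
    integral_Ioi_rpow_of_lt (by linarith) hM,
    ← ENNReal.ofReal_ofNat, ← ENNReal.ofReal_mul (by norm_num)]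
  · refine le_of_eq ?_
    congr 1
    rw [show -q + 1 = 1 - q by ring, show 1 - q = -(q - 1) by ring]
    field_simp
  · filter_upwards [ae_restrict_mem measurableSet_Ioi] with s hs
    exact Real.rpow_nonneg (hM.trans hs).le _

theorem setLIntegral_le_of_le_smul_volume {μ : Measure ℝ} {c : ℝ≥0∞} (hμ : μ ≤ c • volume)
    (s : Set ℝ) (f : ℝ → ℝ≥0∞) : ∫⁻ x in s, f x ∂μ ≤ c * ∫⁻ x in s, f x := by
  calc ∫⁻ x in s, f x ∂μ ≤ ∫⁻ x in s, f x ∂(c • volume) :=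
        lintegral_mono' (Measure.restrict_mono le_rfl hμ) le_rfl
    _ = _ := by rw [Measure.restrict_smul, lintegral_smul_measure, smul_eq_mul]

/-- Split at `|s| = σ`. Inside, the density bound applies and `q < 1` is integrability at zero;
outside, the integrand is at most `σ ^ (-q)`. -/
theorem lintegral_abs_rpow_le {μ : Measure ℝ} [IsProbabilityMeasure μ] {σ : ℝ} (hσ : 0 < σ)
    (hμ : μ ≤ ENNReal.ofReal (1 / σ) • volume) {q : ℝ} (hq0 : 0 ≤ q) (hq : q < 1) :
    ∫⁻ s, ENNReal.ofReal |s| ^ (-q) ∂μ ≤ ENNReal.ofReal (3 / (1 - q) * σ ^ (-q)) := by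
  have hq' : 0 < 1 - q := by linarith
  have hms : MeasurableSet {s : ℝ | |s| ≤ σ} := measurableSet_le (by fun_prop) (by fun_prop)
  rw [← lintegral_add_compl _ hms]
  have h1 := (setLIntegral_le_of_le_smul_volume hμ {s : ℝ | |s| ≤ σ} _).trans
    (mul_le_mul_right (setLIntegral_abs_le_rpow hσ hq) _)
  have h2 : ∫⁻ s in {s : ℝ | |s| ≤ σ}ᶜ, ENNReal.ofReal |s| ^ (-q) ∂μ ≤
      ENNReal.ofReal (σ ^ (-q)) := by
    calc _ ≤ ∫⁻ _ in {s : ℝ | |s| ≤ σ}ᶜ, ENNReal.ofReal (σ ^ (-q)) ∂μ := by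
          refine setLIntegral_mono measurable_const fun s hs => ?_
          have hs' : σ < |s| := not_le.1 hs
          rw [ENNReal.ofReal_rpow_of_pos (hσ.trans hs')]
          exact ENNReal.ofReal_le_ofReal
            (Real.rpow_le_rpow_of_nonpos hσ hs'.le (by linarith))
      _ ≤ _ := by
          rw [setLIntegral_const]
          exact mul_le_of_le_one_right' prob_le_one
  refine (add_le_add h1 h2).trans ?_
  rw [← ENNReal.ofReal_mul (by positivity), ← ENNReal.ofReal_add (by positivity) (by positivity)]
  refine ENNReal.ofReal_le_ofReal ?_
  have e : 1 / σ * (2 / (1 - q) * σ ^ (1 - q)) = 2 / (1 - q) * σ ^ (-q) := by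
    rw [show 1 - q = -q + 1 by ring, Real.rpow_add_one hσ.ne']
    field_simp
  rw [e, ← add_one_mul]
  gcongr
  rw [div_add_one hq'.ne', div_le_div_iff_of_pos_right hq']
  linarith

/-! ### Heights of triangles: Gram identities and negative moments -/

/-- The distance of `v` to the line through `a` and `b`. -/
noncomputable def hgt {d : ℕ} (a b v : EuclideanSpace ℝ (Fin d)) : ℝ :=
  ‖(v - a) - (⟪b - a, v - a⟫ / ‖b - a‖ ^ 2) • (b - a)‖

theorem hgt_nonneg {d : ℕ} (a b v : EuclideanSpace ℝ (Fin d)) : 0 ≤ hgt a b v := norm_nonneg _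

theorem measurable_hgt {d : ℕ} :
    Measurable fun z : EuclideanSpace ℝ (Fin d) × EuclideanSpace ℝ (Fin d) ×
      EuclideanSpace ℝ (Fin d) => hgt z.1 z.2.1 z.2.2 := by
  unfold hgt; fun_prop

theorem norm_sub_inner_smul_sq {d : ℕ} {e w : EuclideanSpace ℝ (Fin d)} (he : ‖e‖ = 1) :
    ‖w - ⟪e, w⟫ • e‖ ^ 2 = ‖w‖ ^ 2 - ⟪e, w⟫ ^ 2 := by
  rw [norm_sub_sq_real, inner_smul_right, norm_smul, real_inner_comm, he, mul_one, Real.norm_eq_abs,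
    sq_abs]
  ring

theorem exists_unit {d : ℕ} (hd : 2 ≤ d) (u : EuclideanSpace ℝ (Fin d)) :
    ∃ e : EuclideanSpace ℝ (Fin d), ‖e‖ = 1 ∧ u = ‖u‖ • e := by
  by_cases hu : u = 0
  · refine ⟨EuclideanSpace.single ⟨0, by omega⟩ 1, by simp, by simp [hu]⟩
  · have hu' : ‖u‖ ≠ 0 := norm_ne_zero_iff.2 hu
    exact ⟨‖u‖⁻¹ • u, norm_smul_inv_norm hu, by rw [smul_smul, mul_inv_cancel₀ hu', one_smul]⟩

/-- The frame depends on the line only: `e` points along it and `n` is any unit normal. The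
coordinate along `n` bounds the height from below, so negative moments of heights reduce to
one-dimensional Gaussians. For `a = b` the height degenerates to `‖v - a‖` and the inequalities
persist. -/
theorem exists_frame_hgt {d : ℕ} (hd : 2 ≤ d) (a b : EuclideanSpace ℝ (Fin d)) :
    ∃ e n : EuclideanSpace ℝ (Fin d), ‖e‖ = 1 ∧ ‖n‖ = 1 ∧ ⟪e, n⟫ = 0 ∧ ∀ v,
      |⟪e, v - a⟫| ≤ ‖v - a‖ ∧ |⟪n, v - a⟫| ≤ hgt a b v ∧ hgt a b v ≤ ‖v - a‖ ∧
      ‖v - a‖ ^ 2 ≤ ⟪e, v - a⟫ ^ 2 + hgt a b v ^ 2 := by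
  obtain ⟨e, he, hue⟩ := exists_unit hd (b - a)
  obtain ⟨n, hn, hen, -⟩ := exists_unit_orthogonal hd e 0 he
  have hbound : ∀ {e : EuclideanSpace ℝ (Fin d)} (w : EuclideanSpace ℝ (Fin d)), ‖e‖ = 1 →
      |⟪e, w⟫| ≤ ‖w‖ := fun {e} w he => by
    simpa [he] using abs_real_inner_le_norm e w
  refine ⟨e, n, he, hn, hen, fun v => ⟨hbound _ he, ?_⟩⟩
  by_cases h0 : ‖b - a‖ = 0
  · have : hgt a b v = ‖v - a‖ := by simp [hgt, norm_eq_zero.1 h0]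
    rw [this]
    exact ⟨hbound _ hn, le_rfl, by nlinarith [sq_nonneg ⟪e, v - a⟫]⟩
  · have hh : hgt a b v = ‖(v - a) - ⟪e, v - a⟫ • e‖ := by
      unfold hgt
      congr 2
      conv_lhs => rw [hue]
      rw [norm_smul, he, inner_smul_left, smul_smul]
      congr 1
      simp only [norm_norm, mul_one, conj_trivial]
      field_simp
    have h2 := norm_sub_inner_smul_sq (w := v - a) he
    rw [← hh] at h2
    refine ⟨?_, ?_, by linarith⟩
    · have := hbound (e := n) ((v - a) - ⟪e, v - a⟫ • e) hn
      rwa [inner_sub_right, inner_smul_right, real_inner_comm e n, hen, mul_zero, sub_zero, ← hh]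
        at this
    · refine abs_le_of_sq_le_sq' ?_ (norm_nonneg _) |>.2
      nlinarith [sq_nonneg ⟪e, v - a⟫]

/-- The Gram determinant: both sides are the squared area of the parallelogram spanned by `a - p`
and `b - p`. -/
theorem mul_hgt_sq {d : ℕ} (p a b : EuclideanSpace ℝ (Fin d)) :
    ‖a - p‖ ^ 2 * hgt p a b ^ 2 = ‖a - p‖ ^ 2 * ‖b - p‖ ^ 2 - ⟪a - p, b - p⟫ ^ 2 := by
  by_cases h0 : ‖a - p‖ = 0
  · simp [norm_eq_zero.1 h0]
  unfold hgt
  rw [norm_sub_sq_real (b - p), inner_smul_right, norm_smul, real_inner_comm (a - p) (b - p),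
    Real.norm_eq_abs,
    mul_pow, sq_abs]
  field_simp
  ring

theorem norm_sub_sq_eq {d : ℕ} (p a b : EuclideanSpace ℝ (Fin d)) :
    ‖a - b‖ ^ 2 = ‖a - p‖ ^ 2 + ‖b - p‖ ^ 2 - 2 * ⟪a - p, b - p⟫ := by
  rw [show a - b = (a - p) - (b - p) by abel, norm_sub_sq_real]
  ring

/-- Write `A`, `B` for the sides at `p` and `c` for their inner product. The squared area is `(AB -
c)(AB + c)`. The second factor is at most `2AB`, and twice the first is `‖a - b‖² - (A - B)²`. -/
theorem mul_hgt_sq_le {d : ℕ} (p a b : EuclideanSpace ℝ (Fin d)) :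
    ‖p - a‖ * hgt p a b ^ 2 ≤ ‖p - b‖ * (‖a - b‖ ^ 2 - (‖p - a‖ - ‖p - b‖) ^ 2) := by
  have h1 := mul_hgt_sq p a b
  have h2 := norm_sub_sq_eq p a b
  have h3 := abs_le.1 (abs_real_inner_le_norm (a - p) (b - p))
  rw [norm_sub_rev p a, norm_sub_rev p b]
  set A := ‖a - p‖
  set B := ‖b - p‖
  set c := ⟪a - p, b - p⟫
  have hA : 0 ≤ A := norm_nonneg _
  have hB : 0 ≤ B := norm_nonneg _
  rw [h2, show B * (A ^ 2 + B ^ 2 - 2 * c - (A - B) ^ 2) = 2 * B * (A * B - c) by ring]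
  rcases hA.eq_or_lt with h0 | h0
  · have hA0 : A = 0 := h0.symm
    simp only [hA0, zero_mul] at h3 ⊢
    nlinarith
  · refine le_of_mul_le_mul_left ?_ h0
    calc A * (A * hgt p a b ^ 2) = (A * B - c) * (A * B + c) := by linarith
      _ ≤ (A * B - c) * (2 * (A * B)) := by
          apply mul_le_mul_of_nonneg_left <;> linarith
      _ = _ := by ring

/-- Now the other factor of the squared area is kept: with `D = ‖a - b‖` one has `2(AB + c) = (A + B
- D)(A + B + D)`, and `A + B + D ≤ 4A` since `B ≤ A`. The excess in the triangle inequality thus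
controls the squared height. -/
theorem hgt_sq_le_mul_add_sub {d : ℕ} (p a b : EuclideanSpace ℝ (Fin d))
    (hab : ‖b - p‖ ≤ ‖a - p‖) :
    hgt p a b ^ 2 ≤ 4 * ‖b - p‖ * (‖b - p‖ + ‖a - p‖ - ‖a - b‖) := by
  have h1 := mul_hgt_sq p a b
  have h2 := norm_sub_sq_eq p a b
  have h3 := abs_le.1 (abs_real_inner_le_norm (a - p) (b - p))
  have h4 : ‖a - b‖ ≤ ‖b - p‖ + ‖a - p‖ := by
    have := norm_sub_le (a - p) (b - p)
    rw [sub_sub_sub_cancel_right] at this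
    linarith
  have hD : 0 ≤ ‖a - b‖ := norm_nonneg _
  have hA : 0 ≤ ‖a - p‖ := norm_nonneg _
  have hB : 0 ≤ ‖b - p‖ := norm_nonneg _
  set A := ‖a - p‖
  set B := ‖b - p‖
  set D := ‖a - b‖
  set c := ⟪a - p, b - p⟫
  rcases hA.eq_or_lt with h0 | h0
  · have hB0 : b - p = 0 := norm_eq_zero.1 (le_antisymm (by rw [h0]; exact hab) hB)
    have : hgt p a b = 0 := by simp [hgt, hB0]
    rw [this]
    have : 0 ≤ 4 * B * (B + A - D) := by
      have : 0 ≤ B + A - D := by linarith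
      positivity
    linarith
  · refine le_of_mul_le_mul_left ?_ (show 0 < A ^ 2 by positivity)
    have h5 : 2 * (A * B + c) ≤ 4 * A * (B + A - D) := by
      have : 2 * (A * B + c) = (B + A - D) * (B + A + D) := by nlinarith
      rw [this]
      nlinarith
    calc A ^ 2 * hgt p a b ^ 2 = (A * B - c) * (A * B + c) := by linarith
      _ ≤ (2 * (A * B)) * (A * B + c) := by
          apply mul_le_mul_of_nonneg_right <;> linarith
      _ ≤ _ := by nlinarith [mul_nonneg h0.le hB]

theorem perturbedPoint_singleton {d : ℕ} (hd : 2 ≤ d) {σ : ℝ} (hσ : 0 < σ)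
    (y a : EuclideanSpace ℝ (Fin d)) : perturbedPoint y σ {a} = 0 := by
  obtain ⟨e, n, he, hn, hen, -⟩ := exists_frame_hgt hd a a
  have hp := measurePreserving_inner_pair hd he hn hen y a σ
  have hz : (gaussianReal ⟪e, y - a⟫ (σ ^ 2).toNNReal) {0} = 0 := by
    have := gaussianReal_le hσ ⟪e, y - a⟫ {0}
    simpa using this
  have h2 : ((gaussianReal ⟪e, y - a⟫ (σ ^ 2).toNNReal).prod
      (gaussianReal ⟪n, y - a⟫ (σ ^ 2).toNNReal)) ({0} ×ˢ Set.univ) = 0 := by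
    rw [Measure.prod_prod, hz, zero_mul]
  refine measure_mono_null (t := (fun x => (⟪e, x - a⟫, ⟪n, x - a⟫)) ⁻¹' ({0} ×ˢ Set.univ)) ?_ ?_
  · rintro x rfl
    simp
  · rw [hp.measure_preimage
      ((measurableSet_singleton 0).prod MeasurableSet.univ).nullMeasurableSet, h2]

theorem ae_perturbedPoint_ne {d : ℕ} (hd : 2 ≤ d) {σ : ℝ} (hσ : 0 < σ)
    (y a : EuclideanSpace ℝ (Fin d)) : ∀ᵐ x ∂(perturbedPoint y σ), x ≠ a := by
  rw [ae_iff]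
  simpa using perturbedPoint_singleton hd hσ y a

theorem ennreal_rpow_neg_anti {a b : ℝ≥0∞} {q : ℝ} (hq : 0 ≤ q) (h : a ≤ b) :
    b ^ (-q) ≤ a ^ (-q) := by
  rw [ENNReal.rpow_neg, ENNReal.rpow_neg]
  exact ENNReal.inv_le_inv.2 (ENNReal.rpow_le_rpow h hq)

/-- Negative moments of the distance to a point and of the distance to a line. -/
theorem lintegral_norm_hgt_rpow_le {d : ℕ} (hd : 2 ≤ d) {σ : ℝ} (hσ : 0 < σ)
    (y a b : EuclideanSpace ℝ (Fin d)) {q q' : ℝ} (hq0 : 0 ≤ q) (hq : q < 1) (hq0' : 0 ≤ q')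
    (hq' : q' < 1) :
    ∫⁻ v, ENNReal.ofReal ‖v - a‖ ^ (-q) * ENNReal.ofReal (hgt a b v) ^ (-q') ∂(perturbedPoint y σ) ≤
      ENNReal.ofReal (9 / ((1 - q) * (1 - q')) * σ ^ (-(q + q'))) := by
  obtain ⟨e, n, he, hn, hen, hv⟩ := exists_frame_hgt hd a b
  have hp := measurePreserving_inner_pair hd he hn hen y a σ
  have h1q : 0 < 1 - q := by linarith
  have h1q' : 0 < 1 - q' := by linarith
  calc _ ≤ ∫⁻ v, (fun z : ℝ × ℝ => ENNReal.ofReal |z.1| ^ (-q) * ENNReal.ofReal |z.2| ^ (-q'))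
        (⟪e, v - a⟫, ⟪n, v - a⟫) ∂(perturbedPoint y σ) := by
        refine lintegral_mono fun v => ?_
        obtain ⟨h1, h2, -, -⟩ := hv v
        exact mul_le_mul'
          (ennreal_rpow_neg_anti (by linarith) (ENNReal.ofReal_le_ofReal h1))
          (ennreal_rpow_neg_anti (by linarith) (ENNReal.ofReal_le_ofReal h2))
    _ = (∫⁻ s, ENNReal.ofReal |s| ^ (-q) ∂(gaussianReal ⟪e, y - a⟫ (σ ^ 2).toNNReal)) *
        ∫⁻ s, ENNReal.ofReal |s| ^ (-q') ∂(gaussianReal ⟪n, y - a⟫ (σ ^ 2).toNNReal) := by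
        refine (hp.lintegral_comp (f := fun z : ℝ × ℝ => ENNReal.ofReal |z.1| ^ (-q) *
          ENNReal.ofReal |z.2| ^ (-q')) (by fun_prop)).trans ?_
        exact lintegral_prod_mul (f := fun s : ℝ => ENNReal.ofReal |s| ^ (-q))
          (g := fun s : ℝ => ENNReal.ofReal |s| ^ (-q')) (by fun_prop) (by fun_prop)
    _ ≤ ENNReal.ofReal (3 / (1 - q) * σ ^ (-q)) * ENNReal.ofReal (3 / (1 - q') * σ ^ (-q')) :=
        mul_le_mul' (lintegral_abs_rpow_le hσ (gaussianReal_le hσ _) hq0 hq)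
          (lintegral_abs_rpow_le hσ (gaussianReal_le hσ _) hq0' hq')
    _ = _ := by
        rw [← ENNReal.ofReal_mul (by positivity), neg_add, Real.rpow_add hσ]
        congr 1
        field_simp
        norm_num

theorem lintegral_norm_rpow_le {d : ℕ} (hd : 2 ≤ d) {σ : ℝ} (hσ : 0 < σ)
    (y a : EuclideanSpace ℝ (Fin d)) {q : ℝ} (hq0 : 0 ≤ q) (hq : q < 1) :
    ∫⁻ v, ENNReal.ofReal ‖v - a‖ ^ (-q) ∂(perturbedPoint y σ) ≤
      ENNReal.ofReal (9 / (1 - q) * σ ^ (-q)) := by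
  simpa using lintegral_norm_hgt_rpow_le hd hσ y a a hq0 hq le_rfl one_pos

theorem lintegral_hgt_rpow_le {d : ℕ} (hd : 2 ≤ d) {σ : ℝ} (hσ : 0 < σ)
    (y a b : EuclideanSpace ℝ (Fin d)) {q : ℝ} (hq0 : 0 ≤ q) (hq : q < 1) :
    ∫⁻ v, ENNReal.ofReal (hgt a b v) ^ (-q) ∂(perturbedPoint y σ) ≤
      ENNReal.ofReal (9 / (1 - q) * σ ^ (-q)) := by
  simpa using lintegral_norm_hgt_rpow_le hd hσ y a b le_rfl one_pos hq0 hq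

theorem measurableSet_dist_sub_dist {d : ℕ} (a b : EuclideanSpace ℝ (Fin d)) (t ε : ℝ) :
    MeasurableSet {x | 0 ≤ ‖x - a‖ - ‖x - b‖ ∧ |‖x - a‖ - ‖x - b‖ - t| ≤ ε} := by
  rw [Set.ofPred_and]
  exact (measurableSet_le (by fun_prop) (by fun_prop)).inter
    (measurableSet_le (by fun_prop) (by fun_prop))

/-! ### The window probability for one perturbed point -/

/-- The probability that the difference of the distances to two points lies in a window. -/
theorem perturbedPoint_dist_sub_dist_le {d : ℕ} (hd : 2 ≤ d) {σ : ℝ} (hσ : 0 < σ)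
    (y a b : EuclideanSpace ℝ (Fin d)) (t : ℝ) {r ε : ℝ} (hr : 0 < r) (hε : 0 < ε) {u : ℝ}
    (hu : 0 ≤ u) (hu2 : u ^ 2 ≤ ‖b - a‖ * max (‖b - a‖ - |t|) ε) :
    perturbedPoint y σ {x | |‖x - a‖ - ‖x - b‖ - t| ≤ ε ∧ ‖x - a‖ ≤ 2 * r ∧ ‖x - b‖ ≤ 2 * r} ≤
      ENNReal.ofReal (448 * (r * ε / σ)) * (ENNReal.ofReal u)⁻¹ := by
  by_cases hab : a = b
  -- For coinciding foci the bound is vacuous, since the inverse of zero is infinite.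
  · have : u = 0 := by
      rw [hab, sub_self, norm_zero, zero_mul] at hu2
      nlinarith
    rw [this, ENNReal.ofReal_zero, ENNReal.inv_zero, ENNReal.mul_top
      (by simp only [ne_eq, ENNReal.ofReal_eq_zero, not_le]; positivity)]
    exact le_top
  have key : ∀ (a b : EuclideanSpace ℝ (Fin d)) (t : ℝ), a ≠ b →
      u ^ 2 ≤ ‖b - a‖ * max (‖b - a‖ - |t|) ε →
      perturbedPoint y σ {x | (0 ≤ ‖x - a‖ - ‖x - b‖ ∧ |‖x - a‖ - ‖x - b‖ - t| ≤ ε) ∧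
        ‖x - a‖ ≤ 2 * r ∧ ‖x - b‖ ≤ 2 * r} ≤
      ENNReal.ofReal (224 * (r * ε / σ)) * (ENNReal.ofReal u)⁻¹ := by
    intro a b t hab hu2
    set S := {x | 0 ≤ ‖x - a‖ - ‖x - b‖ ∧ |‖x - a‖ - ‖x - b‖ - t| ≤ ε}
    have hR : 0 < ‖b - a‖ := norm_pos_iff.2 (sub_ne_zero.2 (Ne.symm hab))
    have hW := setLIntegral_dist_sub_dist_le hd hσ y a b hab t hε
    have hmS : MeasurableSet S := measurableSet_dist_sub_dist a b t ε
    have h1 : perturbedPoint y σ {x | (0 ≤ ‖x - a‖ - ‖x - b‖ ∧ |‖x - a‖ - ‖x - b‖ - t| ≤ ε) ∧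
        ‖x - a‖ ≤ 2 * r ∧ ‖x - b‖ ≤ 2 * r} ≤ ENNReal.ofReal (2 * r) *
        ∫⁻ x in S, ENNReal.ofReal (1 / √(‖x - a‖ * ‖x - b‖)) ∂(perturbedPoint y σ) := by
      rw [← lintegral_const_mul' _ _ ENNReal.ofReal_ne_top, ← lintegral_indicator hmS]
      calc _ = ∫⁻ x, {x | (0 ≤ ‖x - a‖ - ‖x - b‖ ∧ |‖x - a‖ - ‖x - b‖ - t| ≤ ε) ∧
            ‖x - a‖ ≤ 2 * r ∧ ‖x - b‖ ≤ 2 * r}.indicator 1 x ∂(perturbedPoint y σ) := by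
            rw [lintegral_indicator_one]
            exact hmS.inter ((measurableSet_le (f := fun x => ‖x - a‖) (g := fun _ => 2 * r)
              (by fun_prop) (by fun_prop)).inter (measurableSet_le (f := fun x => ‖x - b‖)
              (g := fun _ => 2 * r) (by fun_prop) (by fun_prop)))
        _ ≤ _ := by
          refine lintegral_mono_ae ?_
          filter_upwards [ae_perturbedPoint_ne hd hσ y a, ae_perturbedPoint_ne hd hσ y b]
            with x hxa hxb
          by_cases hx : x ∈ {x | (0 ≤ ‖x - a‖ - ‖x - b‖ ∧ |‖x - a‖ - ‖x - b‖ - t| ≤ ε) ∧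
            ‖x - a‖ ≤ 2 * r ∧ ‖x - b‖ ≤ 2 * r}
          · have hxS : x ∈ S := hx.1
            rw [Set.indicator_of_mem hx, Set.indicator_of_mem hxS,
              ← ENNReal.ofReal_mul (by positivity), Pi.one_apply, ENNReal.one_le_ofReal,
              mul_one_div]
            have ha : 0 < ‖x - a‖ := norm_pos_iff.2 (sub_ne_zero.2 hxa)
            have hb : 0 < ‖x - b‖ := norm_pos_iff.2 (sub_ne_zero.2 hxb)
            rw [one_le_div (by positivity)]
            refine Real.sqrt_le_iff.2 ⟨by positivity, ?_⟩
            rw [sq]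
            exact mul_le_mul hx.2.1 hx.2.2 hb.le (by positivity)
          · rw [Set.indicator_of_notMem hx]
            exact bot_le
    refine h1.trans ((mul_le_mul_right hW _).trans ?_)
    have hmax : 0 < max (‖b - a‖ - t) ε := lt_max_of_lt_right hε
    rcases hu.eq_or_lt with h0 | h0
    · rw [← h0, ENNReal.ofReal_zero, ENNReal.inv_zero, ENNReal.mul_top
        (by simp only [ne_eq, ENNReal.ofReal_eq_zero, not_le]; positivity)]
      exact le_top
    rw [← ENNReal.ofReal_inv_of_pos h0, ← ENNReal.ofReal_mul (by positivity),
      ← ENNReal.ofReal_mul (by positivity)]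
    refine ENNReal.ofReal_le_ofReal ?_
    have hu3 : u ≤ √‖b - a‖ * √(max (‖b - a‖ - t) ε) := by
      rw [← Real.sqrt_mul hR.le]
      refine Real.le_sqrt_of_sq_le (hu2.trans ?_)
      gcongr
      exact le_abs_self t
    have : ε / (√‖b - a‖ * √(max (‖b - a‖ - t) ε)) ≤ ε / u := by gcongr
    calc 2 * r * (112 / σ * (ε / (√‖b - a‖ * √(max (‖b - a‖ - t) ε))))
        ≤ 2 * r * (112 / σ * (ε / u)) := by gcongr
      _ = _ := by ring
  -- Split by the sign of the difference. The negative half is the positive half with the foci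
  -- exchanged and `t` negated, which doubles the constant `224 = 2 · 112`.
  calc _ ≤ perturbedPoint y σ ({x | (0 ≤ ‖x - a‖ - ‖x - b‖ ∧ |‖x - a‖ - ‖x - b‖ - t| ≤ ε) ∧
        ‖x - a‖ ≤ 2 * r ∧ ‖x - b‖ ≤ 2 * r} ∪
        {x | (0 ≤ ‖x - b‖ - ‖x - a‖ ∧ |‖x - b‖ - ‖x - a‖ - -t| ≤ ε) ∧
        ‖x - b‖ ≤ 2 * r ∧ ‖x - a‖ ≤ 2 * r}) := by
        refine measure_mono fun x hx => ?_
        obtain ⟨h1, h2, h3⟩ := hx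
        rcases le_total 0 (‖x - a‖ - ‖x - b‖) with h | h
        · exact Or.inl ⟨⟨h, h1⟩, h2, h3⟩
        · refine Or.inr ⟨⟨by linarith, ?_⟩, h3, h2⟩
          rw [← abs_neg]
          convert h1 using 2; ring
    _ ≤ _ := by
        refine (measure_union_le _ _).trans ((add_le_add (key a b t hab hu2)
          (key b a (-t) (Ne.symm hab) (by rw [abs_neg, norm_sub_rev]; exact hu2))).trans ?_)
        rw [← add_mul, ← ENNReal.ofReal_add (by positivity) (by positivity)]
        refine le_of_eq ?_
        congr 2; ring

/-! ### The integral that closes the case of flat triangles -/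

/-- The part of a dominating function for `lintegral_triangle_le` in which the coordinate along
the line is large. -/
noncomputable def alongWeight (ε : ℝ) (z : ℝ × ℝ) : ℝ≥0∞ :=
  if |z.2| ≤ √(ε * |z.1|) then ENNReal.ofReal (1 / (ε * √|z.1|))
  else ENNReal.ofReal (8 * √|z.1|) * ENNReal.ofReal |z.2| ^ (-2 : ℝ)

/-- The part of a dominating function for `lintegral_triangle_le` in which the coordinate along
the line is small. -/
noncomputable def acrossWeight (ε : ℝ) (s : ℝ) : ℝ≥0∞ :=
  if |s| ≤ ε then ENNReal.ofReal (1 / ε) * ENNReal.ofReal |s| ^ (-(1 / 2) : ℝ)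
  else ENNReal.ofReal 8 * ENNReal.ofReal |s| ^ (-(3 / 2) : ℝ)

theorem measurable_alongWeight (ε : ℝ) : Measurable (alongWeight ε) := by
  unfold alongWeight
  exact Measurable.ite (measurableSet_le (by fun_prop) (by fun_prop)) (by fun_prop) (by fun_prop)

theorem measurable_acrossWeight (ε : ℝ) : Measurable (acrossWeight ε) := by
  unfold acrossWeight
  exact Measurable.ite (measurableSet_le (by fun_prop) (by fun_prop)) (by fun_prop) (by fun_prop)

theorem lintegral_ite_le {μ : Measure ℝ} {c : ℝ≥0∞} (hμ : μ ≤ c • volume) (M : ℝ)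
    (f g : ℝ → ℝ≥0∞) :
    ∫⁻ s, (if |s| ≤ M then f s else g s) ∂μ ≤
      c * ((∫⁻ s in {s : ℝ | |s| ≤ M}, f s) + ∫⁻ s in {s : ℝ | M < |s|}, g s) := by
  have hms : MeasurableSet {s : ℝ | |s| ≤ M} := measurableSet_le (by fun_prop) (by fun_prop)
  rw [← lintegral_add_compl _ hms, mul_add]
  have hc : {s : ℝ | |s| ≤ M}ᶜ = {s : ℝ | M < |s|} := by ext; simp
  refine add_le_add ?_ ?_
  · refine le_trans (le_of_eq ?_) (setLIntegral_le_of_le_smul_volume hμ _ f)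
    exact setLIntegral_congr_fun hms fun s hs => if_pos hs
  · rw [← hc]
    refine le_trans (le_of_eq ?_) (setLIntegral_le_of_le_smul_volume hμ _ g)
    exact setLIntegral_congr_fun hms.compl fun s hs => if_neg hs

theorem lintegral_alongWeight_le {μ : Measure ℝ} {σ : ℝ} (hσ : 0 < σ)
    (hμ : μ ≤ ENNReal.ofReal (1 / σ) • volume) {ε : ℝ} (hε : 0 < ε) {g : ℝ} (hg : g ≠ 0) :
    ∫⁻ s, alongWeight ε (g, s) ∂μ ≤ ENNReal.ofReal (18 / (σ * √ε)) := by
  have hg' : 0 < |g| := abs_pos.2 hg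
  have hM : 0 < √(ε * |g|) := by positivity
  refine (lintegral_ite_le hμ (√(ε * |g|)) (fun _ => ENNReal.ofReal (1 / (ε * √|g|)))
    (fun s => ENNReal.ofReal (8 * √|g|) * ENNReal.ofReal |s| ^ (-2 : ℝ))).trans ?_
  have h1 : ∫⁻ s in {s : ℝ | |s| ≤ √(ε * |g|)}, ENNReal.ofReal (1 / (ε * √|g|)) ≤
      ENNReal.ofReal (1 / (ε * √|g|)) * ENNReal.ofReal (2 * √(ε * |g|)) := by
    rw [setLIntegral_const]
    gcongr
    have : {s : ℝ | |s| ≤ √(ε * |g|)} = Set.Icc (-√(ε * |g|)) (√(ε * |g|)) := by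
      ext; simp [abs_le]
    rw [this, Real.volume_Icc]
    exact ENNReal.ofReal_le_ofReal (by linarith)
  have h2 : ∫⁻ s in {s : ℝ | √(ε * |g|) < |s|},
      ENNReal.ofReal (8 * √|g|) * ENNReal.ofReal |s| ^ (-2 : ℝ) ≤
      ENNReal.ofReal (8 * √|g|) * ENNReal.ofReal (2 / √(ε * |g|)) := by
    rw [lintegral_const_mul' _ _ ENNReal.ofReal_ne_top]
    gcongr
    refine (setLIntegral_lt_abs_rpow hM (by norm_num)).trans (le_of_eq ?_)
    rw [show (1 - 2 : ℝ) = -1 by norm_num, Real.rpow_neg_one]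
    congr 1; norm_num [div_eq_mul_inv]
  refine (mul_le_mul_right (add_le_add h1 h2) _).trans ?_
  rw [← ENNReal.ofReal_mul (by positivity), ← ENNReal.ofReal_mul (by positivity),
    ← ENNReal.ofReal_add (by positivity) (by positivity), ← ENNReal.ofReal_mul (by positivity)]
  refine ENNReal.ofReal_le_ofReal (le_of_eq ?_)
  rw [Real.sqrt_mul hε.le]
  have hse : 0 < √ε := by positivity
  have hsg : 0 < √|g| := by positivity
  have h3 : ε = √ε * √ε := (Real.mul_self_sqrt hε.le).symm
  field_simp
  rw [Real.sq_sqrt hε.le]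
  ring

theorem lintegral_acrossWeight_le {μ : Measure ℝ} {σ : ℝ} (hσ : 0 < σ)
    (hμ : μ ≤ ENNReal.ofReal (1 / σ) • volume) {ε : ℝ} (hε : 0 < ε) :
    ∫⁻ s, acrossWeight ε s ∂μ ≤ ENNReal.ofReal (36 / (σ * √ε)) := by
  refine (lintegral_ite_le hμ _ _ _).trans ?_
  have hse : 0 < √ε := by positivity
  have h1 : ∫⁻ s in {s : ℝ | |s| ≤ ε}, ENNReal.ofReal (1 / ε) * ENNReal.ofReal |s| ^ (-(1 / 2) : ℝ)
    ≤
      ENNReal.ofReal (1 / ε) * ENNReal.ofReal (4 * √ε) := by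
    rw [lintegral_const_mul' _ _ ENNReal.ofReal_ne_top]
    gcongr
    refine (setLIntegral_abs_le_rpow hε (by norm_num)).trans (le_of_eq ?_)
    rw [Real.sqrt_eq_rpow]
    congr 1; norm_num
  have h2 : ∫⁻ s in {s : ℝ | ε < |s|}, ENNReal.ofReal 8 * ENNReal.ofReal |s| ^ (-(3 / 2) : ℝ) ≤
      ENNReal.ofReal 8 * ENNReal.ofReal (4 / √ε) := by
    rw [lintegral_const_mul' _ _ ENNReal.ofReal_ne_top]
    gcongr
    refine (setLIntegral_lt_abs_rpow hε (by norm_num)).trans (le_of_eq ?_)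
    rw [show (1 - 3 / 2 : ℝ) = -(1 / 2) by norm_num, Real.rpow_neg hε.le, ← Real.sqrt_eq_rpow]
    congr 1; norm_num [div_eq_mul_inv]
  refine (mul_le_mul_right (add_le_add h1 h2) _).trans ?_
  rw [← ENNReal.ofReal_mul (by positivity), ← ENNReal.ofReal_mul (by positivity),
    ← ENNReal.ofReal_add (by positivity) (by positivity), ← ENNReal.ofReal_mul (by positivity)]
  refine ENNReal.ofReal_le_ofReal (le_of_eq ?_)
  field_simp
  rw [Real.sq_sqrt hε.le]
  ring

/-- Either `|g|` or `h` dominates, and then `A` is at most twice it. The maximum is bounded below by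
`ε` or by `h ^ 2 / (4 * A)`, switching where they are comparable: at `|s| = √(ε * |g|)` in the first
case, at `|s| = ε` in the second. -/
theorem ofReal_triangle_le {ε A g h s : ℝ} (hε : 0 < ε) (hA : 0 ≤ A) (hgA : |g| ≤ A)
    (hsh : |s| ≤ h) (hhA : h ≤ A) (hA2 : A ^ 2 ≤ g ^ 2 + h ^ 2) :
    ENNReal.ofReal (1 / (√A * max (h ^ 2 / (4 * A)) ε)) ≤
      alongWeight ε (g, s) + acrossWeight ε s := by
  have hs0 := abs_nonneg s
  have hg0 := abs_nonneg g
  have hupper : 0 < A → 0 < h → 1 / (√A * max (h ^ 2 / (4 * A)) ε) ≤ 4 * √A / h ^ 2 := by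
    intro hA0 hh0
    have hsA : 0 < √A := by positivity
    calc 1 / (√A * max (h ^ 2 / (4 * A)) ε) ≤ 1 / (√A * (h ^ 2 / (4 * A))) := by
          gcongr
          exact le_max_left _ _
      _ = _ := by
          field_simp
          rw [Real.sq_sqrt hA0.le]
  have hlow : 0 < A → 1 / (√A * max (h ^ 2 / (4 * A)) ε) ≤ 1 / (√A * ε) := by
    intro hA0
    have hsA : 0 < √A := by positivity
    gcongr
    exact le_max_right _ _
  rcases hA.eq_or_lt with h0 | hA0
  · simp [← h0]
  rcases le_total h |g| with hc | hc
  · refine le_trans ?_ le_self_add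
    have hg1 : 0 < |g| := by
      rcases hg0.eq_or_lt with h1 | h1
      · have : g = 0 := abs_eq_zero.1 h1.symm
        rw [← h1] at hc
        rw [this] at hA2
        nlinarith
      · exact h1
    have hAg : A ≤ 2 * |g| := by
      refine abs_le_of_sq_le_sq' ?_ (by positivity) |>.2
      have := sq_abs g
      nlinarith
    unfold alongWeight
    split_ifs with hif
    · refine ENNReal.ofReal_le_ofReal ((hlow hA0).trans ?_)
      rw [mul_comm]
      gcongr
    · have hs1 : 0 < |s| := lt_of_le_of_lt (Real.sqrt_nonneg _) (not_le.1 hif)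
      rw [ENNReal.ofReal_rpow_of_pos hs1, ← ENNReal.ofReal_mul (by positivity)]
      refine ENNReal.ofReal_le_ofReal ((hupper hA0 (hs1.trans_le hsh)).trans ?_)
      rw [Real.rpow_neg hs0, Real.rpow_two, ← div_eq_mul_inv]
      have : √A ≤ 2 * √|g| := by
        refine Real.sqrt_le_iff.2 ⟨by positivity, ?_⟩
        rw [mul_pow, Real.sq_sqrt hg0]
        linarith
      calc 4 * √A / h ^ 2 ≤ 4 * (2 * √|g|) / |s| ^ 2 := by gcongr
        _ = _ := by ring
  · refine le_trans ?_ le_add_self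
    have hh0 : 0 ≤ h := hs0.trans hsh
    have hh1 : 0 < h := by
      rcases hh0.eq_or_lt with h1 | h1
      · rw [← h1] at hc hA2
        have : g = 0 := abs_eq_zero.1 (le_antisymm hc hg0)
        rw [this] at hA2
        nlinarith
      · exact h1
    have hAh : A ≤ 2 * h := by
      refine abs_le_of_sq_le_sq' ?_ (by positivity) |>.2
      have := sq_abs g
      nlinarith
    unfold acrossWeight
    split_ifs with hif
    · rcases hs0.eq_or_lt with hs1 | hs1
      · rw [← hs1, ENNReal.ofReal_zero, ENNReal.zero_rpow_of_neg (by norm_num), ENNReal.mul_top]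
        · exact le_top
        · simp only [ne_eq, ENNReal.ofReal_eq_zero, not_le]; positivity
      · rw [ENNReal.ofReal_rpow_of_pos hs1, ← ENNReal.ofReal_mul (by positivity)]
        refine ENNReal.ofReal_le_ofReal ((hlow hA0).trans ?_)
        rw [Real.rpow_neg hs0, ← Real.sqrt_eq_rpow, mul_comm, ← one_div, one_div_mul_one_div]
        gcongr
        exact hsh.trans hhA
    · have hs1 : 0 < |s| := hε.trans (not_le.1 hif)
      rw [ENNReal.ofReal_rpow_of_pos hs1, ← ENNReal.ofReal_mul (by positivity)]
      refine ENNReal.ofReal_le_ofReal ((hupper hA0 hh1).trans ?_)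
      have h32 : h ^ (-(3 / 2) : ℝ) ≤ |s| ^ (-(3 / 2) : ℝ) :=
        Real.rpow_le_rpow_of_nonpos hs1 hsh (by norm_num)
      have e : h ^ (-(3 / 2) : ℝ) = √h / h ^ 2 := by
        rw [show (-(3 / 2) : ℝ) = 1 / 2 - 2 by norm_num, Real.rpow_sub hh1, ← Real.sqrt_eq_rpow,
          Real.rpow_two]
      have : √A ≤ 2 * √h := by
        refine Real.sqrt_le_iff.2 ⟨by positivity, ?_⟩
        rw [mul_pow, Real.sq_sqrt hh0]
        linarith
      calc 4 * √A / h ^ 2 ≤ 4 * (2 * √h) / h ^ 2 := by gcongr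
        _ = 8 * h ^ (-(3 / 2) : ℝ) := by rw [e]; ring
        _ ≤ _ := by gcongr

/-- Both dominating weights integrate to multiples of `1 / √ε` over the transversal coordinate
alone, uniformly in the coordinate along the line. The constants add as `54 = 18 + 36`. -/
theorem lintegral_triangle_le {d : ℕ} (hd : 2 ≤ d) {σ : ℝ} (hσ : 0 < σ)
    (y a b : EuclideanSpace ℝ (Fin d)) {ε : ℝ} (hε : 0 < ε) :
    ∫⁻ v, ENNReal.ofReal (1 / (√‖v - a‖ * max (hgt a b v ^ 2 / (4 * ‖v - a‖)) ε))
      ∂(perturbedPoint y σ) ≤ ENNReal.ofReal (54 / (σ * √ε)) := by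
  obtain ⟨e, n, he, hn, hen, hv⟩ := exists_frame_hgt hd a b
  have hp := measurePreserving_inner_pair hd he hn hen y a σ
  have hm1 := measurable_alongWeight ε
  have hm2 := measurable_acrossWeight ε
  calc _ ≤ ∫⁻ v, (fun z : ℝ × ℝ => alongWeight ε z + acrossWeight ε z.2)
        (⟪e, v - a⟫, ⟪n, v - a⟫) ∂(perturbedPoint y σ) := by
        refine lintegral_mono fun v => ?_
        obtain ⟨h1, h2, h3, h4⟩ := hv v
        exact ofReal_triangle_le hε (norm_nonneg _) h1 h2 h3 h4
    _ = (∫⁻ g, ∫⁻ s, alongWeight ε (g, s) ∂(gaussianReal ⟪n, y - a⟫ (σ ^ 2).toNNReal)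
          ∂(gaussianReal ⟪e, y - a⟫ (σ ^ 2).toNNReal)) +
        ∫⁻ _, ∫⁻ s, acrossWeight ε s ∂(gaussianReal ⟪n, y - a⟫ (σ ^ 2).toNNReal)
          ∂(gaussianReal ⟪e, y - a⟫ (σ ^ 2).toNNReal) := by
        refine (hp.lintegral_comp (f := fun z : ℝ × ℝ => alongWeight ε z + acrossWeight ε z.2)
          (by fun_prop)).trans ?_
        rw [lintegral_add_left hm1,
          lintegral_prod _ hm1.aemeasurable, lintegral_prod _ (by fun_prop)]
    _ ≤ (∫⁻ _, ENNReal.ofReal (18 / (σ * √ε)) ∂(gaussianReal ⟪e, y - a⟫ (σ ^ 2).toNNReal)) +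
        ∫⁻ _, ENNReal.ofReal (36 / (σ * √ε)) ∂(gaussianReal ⟪e, y - a⟫ (σ ^ 2).toNNReal) := by
        refine add_le_add (lintegral_mono_ae ?_) (lintegral_mono fun _ => ?_)
        · have : ∀ᵐ g ∂(gaussianReal ⟪e, y - a⟫ (σ ^ 2).toNNReal), g ≠ 0 := by
            rw [ae_iff]
            have := gaussianReal_le hσ ⟪e, y - a⟫ {0}
            simpa using this
          filter_upwards [this] with g hg
          exact lintegral_alongWeight_le hσ (gaussianReal_le hσ _) hε hg
        · exact lintegral_acrossWeight_le hσ (gaussianReal_le hσ _) hε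
    _ = _ := by
        rw [lintegral_const, lintegral_const, measure_univ, mul_one, mul_one,
          ← ENNReal.ofReal_add (by positivity) (by positivity)]
        congr 1; ring

/-! ### Integrating out single points -/

section marginals
variable {n d : ℕ} {y : Fin n → EuclideanSpace ℝ (Fin d)} {σ : ℝ}

/-- Integrate out the `i`-th point. -/
noncomputable def avg (y : Fin n → EuclideanSpace ℝ (Fin d)) (σ : ℝ) (i : Fin n)
    (f : (Fin n → EuclideanSpace ℝ (Fin d)) → ℝ≥0∞) (x : Fin n → EuclideanSpace ℝ (Fin d)) : ℝ≥0∞ :=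
  ∫⁻ z, f (Function.update x i z) ∂(perturbedPoint (y i) σ)

theorem measurable_avg (i : Fin n) {f : (Fin n → EuclideanSpace ℝ (Fin d)) → ℝ≥0∞}
    (hf : Measurable f) : Measurable (avg y σ i f) := by
  have h := Measurable.lmarginal (fun j => perturbedPoint (y j) σ) (s := {i}) hf
  convert h using 1
  funext x
  rw [lmarginal_singleton]
  rfl

theorem lintegral_avg (i : Fin n) {f : (Fin n → EuclideanSpace ℝ (Fin d)) → ℝ≥0∞}
    (hf : Measurable f) :
    ∫⁻ x, avg y σ i f x ∂(smoothedInstance y σ) = ∫⁻ x, f x ∂(smoothedInstance y σ) := by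
  refine lintegral_eq_of_lmarginal_eq {i} (measurable_avg i hf) hf ?_
  rw [lmarginal_singleton, lmarginal_singleton]
  funext x
  simp [avg]

theorem avg_mul_right {i : Fin n} {f g : (Fin n → EuclideanSpace ℝ (Fin d)) → ℝ≥0∞}
    (hf : Measurable f) (hg : ∀ x z, g (Function.update x i z) = g x) (x) :
    avg y σ i (fun x => f x * g x) x = avg y σ i f x * g x := by
  simp only [avg, hg]
  exact lintegral_mul_const _ (hf.comp (measurable_update x))

theorem avg_update {i j : Fin n} (hij : i ≠ j) {f : (Fin n → EuclideanSpace ℝ (Fin d)) → ℝ≥0∞}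
    (hf : ∀ x z, f (Function.update x j z) = f x) (x z) :
    avg y σ i f (Function.update x j z) = avg y σ i f x := by
  simp only [avg]
  refine lintegral_congr fun w => ?_
  rw [Function.update_comm hij.symm, hf]

/-- Conditional independence: given all other points, `f` is a function of point `i` and `g` of
point `j`, so the conditional expectation of the product factors. -/
theorem lintegral_mul_eq_avg_mul_avg {i j : Fin n} (hij : i ≠ j)
    {f g : (Fin n → EuclideanSpace ℝ (Fin d)) → ℝ≥0∞} (hf : Measurable f) (hg : Measurable g)
    (hfj : ∀ x z, f (Function.update x j z) = f x) (hgi : ∀ x z, g (Function.update x i z) = g x) :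
    ∫⁻ x, f x * g x ∂(smoothedInstance y σ) =
      ∫⁻ x, avg y σ i f x * avg y σ j g x ∂(smoothedInstance y σ) := by
  rw [← lintegral_avg (f := fun x => f x * g x) i (hf.mul hg)]
  simp only [avg_mul_right hf hgi]
  have hm : Measurable fun x => avg y σ i f x * g x := (measurable_avg i hf).mul hg
  rw [← lintegral_avg j hm]
  refine lintegral_congr fun x => ?_
  have h := avg_mul_right (y := y) (σ := σ) (i := j) hg (g := avg y σ i f)
    (fun x z => avg_update hij hfj x z) x
  simp only [mul_comm (avg y σ i f _)]
  exact h

theorem lintegral_mul_le_of_avg_le {i : Fin n} {f g : (Fin n → EuclideanSpace ℝ (Fin d)) → ℝ≥0∞}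
    (hf : Measurable f) (hg : Measurable g) (hfi : ∀ x z, f (Function.update x i z) = f x)
    {h : (Fin n → EuclideanSpace ℝ (Fin d)) → ℝ≥0∞} (hc : ∀ x, avg y σ i g x ≤ h x) :
    ∫⁻ x, f x * g x ∂(smoothedInstance y σ) ≤ ∫⁻ x, f x * h x ∂(smoothedInstance y σ) := by
  simp only [mul_comm (f _)]
  rw [← lintegral_avg (f := fun x => g x * f x) i (hg.mul hf)]
  refine lintegral_mono fun x => ?_
  simp only [avg_mul_right hg hfi]
  gcongr
  exact hc x

theorem lintegral_le_of_avg_le {i : Fin n} {g : (Fin n → EuclideanSpace ℝ (Fin d)) → ℝ≥0∞}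
    (hg : Measurable g) {c : ℝ≥0∞} (hc : ∀ x, avg y σ i g x ≤ c) :
    ∫⁻ x, g x ∂(smoothedInstance y σ) ≤ c := by
  rw [← lintegral_avg i hg]
  calc _ ≤ ∫⁻ _, c ∂(smoothedInstance y σ) := lintegral_mono hc
    _ = c := by simp

theorem ae_injective (hd : 2 ≤ d) (hσ : 0 < σ) :
    ∀ᵐ x ∂(smoothedInstance y σ), ∀ i j, i ≠ j → x i ≠ x j := by
  rw [ae_all_iff]; intro i
  rw [ae_all_iff]; intro j
  by_cases hij : i = j
  · simp [hij]
  have hm : MeasurableSet {x : Fin n → EuclideanSpace ℝ (Fin d) | x i = x j} :=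
    measurableSet_eq_fun (by fun_prop) (by fun_prop)
  have h0 : smoothedInstance y σ {x | x i = x j} = 0 := by
    rw [← lintegral_indicator_one hm]
    refine le_antisymm (lintegral_le_of_avg_le (i := i) (measurable_one.indicator hm) fun x => ?_)
      bot_le
    have : ∀ z, {x : Fin n → EuclideanSpace ℝ (Fin d) | x i = x j}.indicator
        (1 : (Fin n → EuclideanSpace ℝ (Fin d)) → ℝ≥0∞) (Function.update x i z) =
          ({x j} : Set _).indicator 1 z := by
      intro z
      simp [Set.indicator, Function.update_of_ne (Ne.symm hij)]
    simp only [avg, this]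
    rw [lintegral_indicator_one (measurableSet_singleton _), perturbedPoint_singleton hd hσ]
  rw [ae_iff]
  refine measure_mono_null (fun x hx => ?_) h0
  simp only [ne_eq, not_forall, not_not, Set.mem_ofPred_eq] at hx
  exact hx.2

end marginals

/-! ### Small gaps as window events seen from one point -/

/-- The amount by which the exchange of the edges `pq`, `rs` of a tour for `qr`, `sp` improves
its length. -/
noncomputable def gap {d : ℕ} (p q r s : EuclideanSpace ℝ (Fin d)) : ℝ :=
  ‖p - q‖ - ‖q - r‖ + ‖r - s‖ - ‖s - p‖

section events
variable {n d : ℕ} {y : Fin n → EuclideanSpace ℝ (Fin d)} {σ : ℝ}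

/-- The event that, seen from the point `p`, the distances to `a` and `b` differ by about `t`. -/
def viewEvent (p a b : Fin n) (t : (Fin n → EuclideanSpace ℝ (Fin d)) → ℝ) (r ε : ℝ) :
    Set (Fin n → EuclideanSpace ℝ (Fin d)) :=
  {x | |‖x p - x a‖ - ‖x p - x b‖ - t x| ≤ ε ∧ ‖x p - x a‖ ≤ 2 * r ∧ ‖x p - x b‖ ≤ 2 * r}

theorem measurableSet_viewEvent (p a b : Fin n) {t : (Fin n → EuclideanSpace ℝ (Fin d)) → ℝ}
    (ht : Measurable t) (r ε : ℝ) : MeasurableSet (viewEvent p a b t r ε) := by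
  simp only [viewEvent, Set.ofPred_and]
  exact (measurableSet_le (by fun_prop) (by fun_prop)).inter
    ((measurableSet_le (by fun_prop) (by fun_prop)).inter
    (measurableSet_le (by fun_prop) (by fun_prop)))

theorem avg_indicator_le_one (i : Fin n) (S : Set (Fin n → EuclideanSpace ℝ (Fin d))) (x) :
    avg y σ i (S.indicator 1) x ≤ 1 := by
  calc avg y σ i (S.indicator 1) x ≤ ∫⁻ _, 1 ∂(perturbedPoint (y i) σ) :=
        lintegral_mono fun z => Set.indicator_le_self' (f := (1 :
          (Fin n → EuclideanSpace ℝ (Fin d)) → ℝ≥0∞)) (fun _ _ => bot_le) _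
    _ = 1 := by simp

theorem avg_viewEvent_le (hd : 2 ≤ d) (hσ : 0 < σ) {p a b : Fin n} (hpa : a ≠ p) (hpb : b ≠ p)
    {t : (Fin n → EuclideanSpace ℝ (Fin d)) → ℝ}
    (ht : ∀ x z, t (Function.update x p z) = t x) {r ε : ℝ} (hr : 0 < r) (hε : 0 < ε) (x) {u : ℝ}
    (hu : 0 ≤ u) (hu2 : u ^ 2 ≤ ‖x b - x a‖ * max (‖x b - x a‖ - |t x|) ε) :
    avg y σ p ((viewEvent p a b t r ε).indicator 1) x ≤
      ENNReal.ofReal (448 * (r * ε / σ)) * (ENNReal.ofReal u)⁻¹ := by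
  refine le_trans (le_of_eq ?_)
    (perturbedPoint_dist_sub_dist_le hd hσ (y p) (x a) (x b) (t x) hr hε hu hu2)
  rw [← lintegral_indicator_one]
  · refine lintegral_congr fun z => ?_
    simp only [Set.indicator, viewEvent, Set.mem_ofPred_eq, ht, Function.update_self,
      Function.update_of_ne hpa, Function.update_of_ne hpb, Pi.one_apply]
  · simp only [Set.ofPred_and]
    exact (measurableSet_le (by fun_prop) (by fun_prop)).inter
      ((measurableSet_le (by fun_prop) (by fun_prop)).inter
      (measurableSet_le (by fun_prop) (by fun_prop)))

/-- The product is bounded both by `1` and by a multiple of `1 / v`, hence by the power `θ` of the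
latter. This trades sharpness for a singularity `v ^ (-θ)` that is still integrable. -/
theorem mul_le_rpow {F F' : ℝ≥0∞} (hF : F ≤ 1) (hF' : F' ≤ 1) {K u u' v θ : ℝ} (hK : 0 < K)
    (hθ : 0 ≤ θ) (hθ1 : θ ≤ 1) (hu : 0 ≤ u) (hv : v ≤ 2 * (u * u'))
    (h : F ≤ ENNReal.ofReal K * (ENNReal.ofReal u)⁻¹)
    (h' : F' ≤ ENNReal.ofReal K * (ENNReal.ofReal u')⁻¹) :
    F * F' ≤ ENNReal.ofReal ((2 * K ^ 2) ^ θ) * ENNReal.ofReal v ^ (-θ) := by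
  have h1 : F * F' ≤ ENNReal.ofReal (2 * K ^ 2) * (ENNReal.ofReal v)⁻¹ := by
    have h2 : (ENNReal.ofReal (2 * (u * u')))⁻¹ ≤ (ENNReal.ofReal v)⁻¹ :=
      ENNReal.inv_le_inv.2 (ENNReal.ofReal_le_ofReal hv)
    refine le_trans ?_ (mul_le_mul_right h2 _)
    rw [ENNReal.ofReal_mul (p := 2) (by norm_num), ENNReal.ofReal_mul (p := 2) (by norm_num),
      ENNReal.mul_inv (Or.inl (by simp)) (Or.inl ENNReal.ofReal_ne_top),
      mul_mul_mul_comm, ENNReal.mul_inv_cancel (by simp) ENNReal.ofReal_ne_top, one_mul,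
      ENNReal.ofReal_mul hu, ENNReal.ofReal_pow hK.le]
    refine (mul_le_mul' h h').trans ?_
    rw [mul_mul_mul_comm, ← sq]
    rcases eq_or_ne (ENNReal.ofReal u) 0 with h0 | h0
    · rw [h0, zero_mul, ENNReal.inv_zero, ENNReal.mul_top]
      · exact le_top
      · simp only [ne_eq, pow_eq_zero_iff, OfNat.ofNat_ne_zero, not_false_eq_true,
          ENNReal.ofReal_eq_zero, not_le]
        exact hK
    · rw [ENNReal.mul_inv (Or.inl h0) (Or.inl ENNReal.ofReal_ne_top)]
  calc F * F' = (F * F') ^ (1 : ℝ) := (ENNReal.rpow_one _).symm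
    _ ≤ (F * F') ^ θ := ENNReal.rpow_le_rpow_of_exponent_ge (mul_le_one' hF hF') hθ1
    _ ≤ (ENNReal.ofReal (2 * K ^ 2) * (ENNReal.ofReal v)⁻¹) ^ θ := ENNReal.rpow_le_rpow h1 hθ
    _ = _ := by
        rw [ENNReal.mul_rpow_of_nonneg _ _ hθ, ENNReal.ofReal_rpow_of_pos (by positivity),
          ENNReal.inv_rpow, ENNReal.rpow_neg]

end events

/-! ### Two 4-cycles with exactly one common edge -/

section six
variable {n d : ℕ} {y : Fin n → EuclideanSpace ℝ (Fin d)} {σ : ℝ}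

/-- Factor `R² - t² = (R - |t|)(R + |t|)`; the second factor is at most `2R`. For `|t| ≥ R` the root
on the left is zero. -/
theorem sqrt_half_sq_le {R t ε : ℝ} (hR : 0 ≤ R) (hε : 0 ≤ ε) :
    √((R ^ 2 - t ^ 2) / 2) ^ 2 ≤ R * max (R - |t|) ε := by
  have ht := abs_nonneg t
  rcases le_or_gt R |t| with h | h
  · rw [Real.sqrt_eq_zero_of_nonpos (by nlinarith [sq_abs t])]
    have : 0 ≤ max (R - |t|) ε := le_max_of_le_right hε
    simpa using mul_nonneg hR this
  · rw [Real.sq_sqrt (by nlinarith [sq_abs t])]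
    refine le_trans ?_ (mul_le_mul_of_nonneg_left (le_max_left _ _) hR)
    nlinarith [sq_abs t]

/-- Two 4-cycles that share exactly one edge and both have a small gap. -/
def sixEvent (i : Fin 6 → Fin n) (ε : ℝ) : Set (Fin n → EuclideanSpace ℝ (Fin d)) :=
  {x | |gap (x (i 0)) (x (i 2)) (x (i 3)) (x (i 1))| ≤ ε ∧
    |gap (x (i 0)) (x (i 2)) (x (i 5)) (x (i 4))| ≤ ε}

theorem ofReal_mul_rpow {a b q : ℝ} (ha : 0 ≤ a) :
    ENNReal.ofReal (a * b) ^ q = ENNReal.ofReal a ^ q * ENNReal.ofReal b ^ q := by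
  rw [ENNReal.ofReal_mul ha,
    ENNReal.mul_rpow_of_ne_top ENNReal.ofReal_ne_top ENNReal.ofReal_ne_top]

/-- The side `B` stands on opposite sides of the two height estimates and cancels in their product;
`C ≤ A` absorbs the remaining quotient. -/
theorem hgt_prod_le {A B C h h' w w' : ℝ} (hA : 0 < A) (hB : 0 ≤ B) (h0 : B = 0 → h = 0)
    (h1 : A * h ^ 2 ≤ B * w) (h2 : B * h' ^ 2 ≤ C * w')
    (hCA : C ≤ A) (hw : 0 ≤ w) (hw' : 0 ≤ w') :
    h * h' ≤ 2 * (√(w / 2) * √(w' / 2)) := by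
  have e : 2 * (√(w / 2) * √(w' / 2)) = √(w * w') := by
    rw [← Real.sqrt_mul (by positivity), show w / 2 * (w' / 2) = w * w' / 2 ^ 2 by ring,
      Real.sqrt_div (by positivity), Real.sqrt_sq (by norm_num)]
    ring
  rw [e]
  refine Real.le_sqrt_of_sq_le ?_
  rcases hB.eq_or_lt with hB0 | hB0
  · rw [h0 hB0.symm]
    simpa using mul_nonneg hw hw'
  · refine le_of_mul_le_mul_left ?_ (mul_pos hA hB0)
    calc A * B * (h * h') ^ 2 = (A * h ^ 2) * (B * h' ^ 2) := by ring
      _ ≤ (B * w) * (C * w') := by gcongr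
      _ ≤ (B * w) * (A * w') := by gcongr
      _ = _ := by ring

theorem hgt_left {d : ℕ} (a b : EuclideanSpace ℝ (Fin d)) : hgt a b a = 0 := by simp [hgt]

theorem sq_sub_sq_nonneg {d : ℕ} (p a b : EuclideanSpace ℝ (Fin d)) :
    0 ≤ ‖a - b‖ ^ 2 - (‖p - a‖ - ‖p - b‖) ^ 2 := by
  have h := abs_norm_sub_norm_le (p - a) (p - b)
  rw [sub_sub_sub_cancel_left, norm_sub_rev b a] at h
  have h2 := sq_le_sq' (by have := abs_le.1 h; linarith) (abs_le.1 h).2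
  linarith

theorem measurable_hgt_apply (a b c : Fin n) :
    Measurable fun x : Fin n → EuclideanSpace ℝ (Fin d) => hgt (x a) (x b) (x c) :=
  measurable_hgt.comp (f := fun x : Fin n → EuclideanSpace ℝ (Fin d) => (x a, x b, x c))
    (by fun_prop)

/-- The first height does not involve the point `c'`, so the second one is integrated over that
point, and then the first over its own apex `c`. -/
theorem lintegral_hgt_mul_hgt_le (hd : 2 ≤ d) (hσ : 0 < σ) {a b c a' b' c' : Fin n}
    (hca : a ≠ c) (hcb : b ≠ c) (ha : a' ≠ c') (hb : b' ≠ c') (hac : a ≠ c') (hbc : b ≠ c')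
    (hcc : c ≠ c') {q : ℝ} (hq0 : 0 ≤ q) (hq : q < 1) :
    ∫⁻ x, ENNReal.ofReal (hgt (x a) (x b) (x c)) ^ (-q) *
      ENNReal.ofReal (hgt (x a') (x b') (x c')) ^ (-q) ∂(smoothedInstance y σ) ≤
      ENNReal.ofReal ((9 / (1 - q) * σ ^ (-q)) ^ 2) := by
  have hq' : 0 < 1 - q := by linarith
  have m1 := measurable_hgt_apply (d := d) a b c
  have m2 := measurable_hgt_apply (d := d) a' b' c'
  refine (lintegral_mul_le_of_avg_le (i := c') (by fun_prop) (by fun_prop) (fun x z => ?_)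
    (h := fun _ => ENNReal.ofReal (9 / (1 - q) * σ ^ (-q))) (fun x => ?_)).trans ?_
  · simp only [Function.update_of_ne hac, Function.update_of_ne hbc, Function.update_of_ne hcc]
  · simp only [avg, Function.update_of_ne ha, Function.update_of_ne hb, Function.update_self]
    exact lintegral_hgt_rpow_le hd hσ _ _ _ hq0 hq
  · rw [lintegral_mul_const _ (f := fun x : Fin n → EuclideanSpace ℝ (Fin d) =>
      ENNReal.ofReal (hgt (x a) (x b) (x c)) ^ (-q)) (by fun_prop), sq,
      ENNReal.ofReal_mul (p := 9 / (1 - q) * σ ^ (-q)) (by positivity)]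
    refine mul_le_mul_left (lintegral_le_of_avg_le (i := c) (g := fun x =>
      ENNReal.ofReal (hgt (x a) (x b) (x c)) ^ (-q)) (by fun_prop) fun x => ?_) _
    simp only [avg, Function.update_of_ne hca, Function.update_of_ne hcb, Function.update_self]
    exact lintegral_hgt_rpow_le hd hσ _ _ _ hq0 hq

/-- The points `i 3` and `i 4` each belong to one cycle only. Given the other four points the two
window events are independent, and their probabilities multiply to a negative power of a product of
two heights. -/
theorem measure_sixEvent_le (hd : 2 ≤ d) (hσ : 0 < σ) {i : Fin 6 → Fin n}
    (hi : Function.Injective i) {r ε : ℝ} (hr : 0 < r) (hε : 0 < ε) :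
    smoothedInstance y σ (sixEvent i ε ∩ {x | ∀ j k, ‖x j - x k‖ ≤ 2 * r}) ≤
      ENNReal.ofReal (10 ^ 10 * (r * ε / σ ^ 2) ^ (9 / 5 : ℝ)) := by
  set t₁ : (Fin n → EuclideanSpace ℝ (Fin d)) → ℝ :=
    fun x => ‖x (i 1) - x (i 0)‖ - ‖x (i 0) - x (i 2)‖ with ht₁
  set t₂ : (Fin n → EuclideanSpace ℝ (Fin d)) → ℝ :=
    fun x => ‖x (i 2) - x (i 5)‖ - ‖x (i 0) - x (i 2)‖ with ht₂
  have hm₁ : Measurable t₁ := by fun_prop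
  have hm₂ : Measurable t₂ := by fun_prop
  set S₁ := viewEvent (i 3) (i 1) (i 2) t₁ r ε with hS₁
  set S₂ := viewEvent (i 4) (i 5) (i 0) t₂ r ε with hS₂
  have hmS₁ : MeasurableSet S₁ := measurableSet_viewEvent _ _ _ hm₁ r ε
  have hmS₂ : MeasurableSet S₂ := measurableSet_viewEvent _ _ _ hm₂ r ε
  have hsub : sixEvent i ε ∩ {x | ∀ j k, ‖x j - x k‖ ≤ 2 * r} ⊆ S₁ ∩ S₂ := by
    rintro x ⟨⟨h1, h2⟩, h3⟩
    refine ⟨⟨?_, h3 _ _, h3 _ _⟩, ⟨?_, h3 _ _, h3 _ _⟩⟩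
    · convert h1 using 2
      simp only [ht₁, gap, norm_sub_rev (x (i 2)) (x (i 3))]
      ring
    · convert h2 using 2
      simp only [ht₂, gap, norm_sub_rev (x (i 5)) (x (i 4))]
      ring
  set K : ℝ := 448 * (r * ε / σ) with hK
  have hK0 : 0 < K := by positivity
  -- Integrability of the heights needs `θ < 1`; the final union bound over `n ^ 6` choices needs
  -- `10 / 3 * (2 * θ) ≥ 6`. The value `9 / 10` gives equality there.
  set θ : ℝ := 9 / 10 with hθ
  set H : (Fin n → EuclideanSpace ℝ (Fin d)) → ℝ≥0∞ := fun x =>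
    ENNReal.ofReal (hgt (x (i 0)) (x (i 1)) (x (i 2))) ^ (-θ) *
      ENNReal.ofReal (hgt (x (i 2)) (x (i 0)) (x (i 5))) ^ (-θ) +
    ENNReal.ofReal (hgt (x (i 2)) (x (i 5)) (x (i 0))) ^ (-θ) *
      ENNReal.ofReal (hgt (x (i 0)) (x (i 2)) (x (i 1))) ^ (-θ) with hH
  have hpt : ∀ x : Fin n → EuclideanSpace ℝ (Fin d), (∀ j k, j ≠ k → x j ≠ x k) →
      avg y σ (i 3) (S₁.indicator 1) x * avg y σ (i 4) (S₂.indicator 1) x ≤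
        ENNReal.ofReal ((2 * K ^ 2) ^ θ) * H x := by
    intro x hx
    set p₁ := x (i 0)
    set p₂ := x (i 1)
    set p₃ := x (i 2)
    set p₆ := x (i 5)
    have hF₁ := avg_viewEvent_le (y := y) hd hσ (p := i 3) (a := i 1) (b := i 2)
      (by simp [hi.eq_iff]) (by simp [hi.eq_iff]) (t := t₁) (by
        intro x z; simp [ht₁, hi.eq_iff]) hr hε x (Real.sqrt_nonneg _)
      (sqrt_half_sq_le (t := t₁ x) (norm_nonneg _) hε.le)
    have hF₂ := avg_viewEvent_le (y := y) hd hσ (p := i 4) (a := i 5) (b := i 0)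
      (by simp [hi.eq_iff]) (by simp [hi.eq_iff]) (t := t₂) (by
        intro x z; simp [ht₂, hi.eq_iff]) hr hε x (Real.sqrt_nonneg _)
      (sqrt_half_sq_le (t := t₂ x) (norm_nonneg _) hε.le)
    have hgen := fun v hv => mul_le_rpow (avg_indicator_le_one (y := y) (σ := σ) (i 3) S₁ x)
      (avg_indicator_le_one (y := y) (σ := σ) (i 4) S₂ x) (v := v) hK0
      (by norm_num : (0 : ℝ) ≤ 9 / 10) (by norm_num) (Real.sqrt_nonneg _) hv hF₁ hF₂
    have n12 : 0 < ‖p₁ - p₂‖ := norm_pos_iff.2 (sub_ne_zero.2 (hx _ _ (by simp [hi.eq_iff])))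
    have n36 : 0 < ‖p₃ - p₆‖ := norm_pos_iff.2 (sub_ne_zero.2 (hx _ _ (by simp [hi.eq_iff])))
    have e₁ : t₁ x = ‖p₁ - p₂‖ - ‖p₁ - p₃‖ := by
      simp only [ht₁]; rw [norm_sub_rev p₁ p₂]
    have e₂ : t₂ x = ‖p₃ - p₆‖ - ‖p₃ - p₁‖ := by
      simp only [ht₂]; rw [norm_sub_rev p₃ p₁]
    rw [hH, mul_add]
    -- The longer of the two outer sides must play the role of `A` in `hgt_prod_le`. This decides
    -- which heights appear, so `H` is the sum of both possibilities.
    rcases le_total ‖p₃ - p₆‖ ‖p₁ - p₂‖ with hc | hc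
    · refine le_trans ?_ le_self_add
      rw [← ofReal_mul_rpow (hgt_nonneg _ _ _)]
      refine hgen _ ?_
      refine hgt_prod_le (A := ‖p₁ - p₂‖) (B := ‖p₁ - p₃‖) (C := ‖p₃ - p₆‖) n12 (norm_nonneg _)
        ?_ ?_ ?_ hc ?_ ?_
      · intro h
        have : p₁ = p₃ := sub_eq_zero.1 (norm_eq_zero.1 h)
        change hgt p₁ p₂ p₃ = 0
        rw [← this, hgt_left]
      · rw [e₁, norm_sub_rev (x (i 2))]
        exact mul_hgt_sq_le p₁ p₂ p₃
      · rw [e₂, norm_sub_rev p₁ p₃, ← neg_sq (_ - _), neg_sub]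
        exact mul_hgt_sq_le p₃ p₁ p₆
      · rw [e₁, norm_sub_rev (x (i 2))]
        exact sq_sub_sq_nonneg p₁ p₂ p₃
      · rw [e₂, ← neg_sq (_ - ‖p₃ - p₁‖), neg_sub]
        exact sq_sub_sq_nonneg p₃ p₁ p₆
    · refine le_trans ?_ le_add_self
      rw [← ofReal_mul_rpow (hgt_nonneg _ _ _)]
      refine hgen _ ?_
      rw [mul_comm (√_)]
      refine hgt_prod_le (A := ‖p₃ - p₆‖) (B := ‖p₁ - p₃‖) (C := ‖p₁ - p₂‖) n36 (norm_nonneg _)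
        ?_ ?_ ?_ hc ?_ ?_
      · intro h
        have : p₁ = p₃ := sub_eq_zero.1 (norm_eq_zero.1 h)
        change hgt p₃ p₆ p₁ = 0
        rw [this, hgt_left]
      · rw [e₂, norm_sub_rev p₁ p₃, norm_sub_rev (x (i 0))]
        exact mul_hgt_sq_le p₃ p₆ p₁
      · rw [e₁, ← neg_sq (_ - _), neg_sub]
        exact mul_hgt_sq_le p₁ p₃ p₂
      · rw [e₂, norm_sub_rev (x (i 0))]
        exact sq_sub_sq_nonneg p₃ p₆ p₁
      · rw [e₁, ← neg_sq (_ - ‖p₁ - p₃‖), neg_sub]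
        exact sq_sub_sq_nonneg p₁ p₃ p₂
  have hmH : Measurable H := by
    have m1 := measurable_hgt_apply (d := d) (i 0) (i 1) (i 2)
    have m2 := measurable_hgt_apply (d := d) (i 2) (i 0) (i 5)
    have m3 := measurable_hgt_apply (d := d) (i 2) (i 5) (i 0)
    have m4 := measurable_hgt_apply (d := d) (i 0) (i 2) (i 1)
    fun_prop
  have hHint : ∫⁻ x, H x ∂(smoothedInstance y σ) ≤
      ENNReal.ofReal (2 * (9 / (1 - θ) * σ ^ (-θ)) ^ 2) := by
    have m1 := measurable_hgt_apply (d := d) (i 0) (i 1) (i 2)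
    have m2 := measurable_hgt_apply (d := d) (i 2) (i 0) (i 5)
    rw [hH, lintegral_add_left (by fun_prop), two_mul,
      ENNReal.ofReal_add (by positivity) (by positivity)]
    refine add_le_add (lintegral_hgt_mul_hgt_le hd hσ ?_ ?_ ?_ ?_ ?_ ?_ ?_ ?_ ?_)
      (lintegral_hgt_mul_hgt_le hd hσ ?_ ?_ ?_ ?_ ?_ ?_ ?_ ?_ ?_) <;>
      first | simp [hi.eq_iff] | norm_num [hθ]
  calc _ ≤ smoothedInstance y σ (S₁ ∩ S₂) := measure_mono hsub
    _ = ∫⁻ x, S₁.indicator 1 x * S₂.indicator 1 x ∂(smoothedInstance y σ) := by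
        rw [← lintegral_indicator_one (hmS₁.inter hmS₂), Set.inter_indicator_one]
        rfl
    _ = ∫⁻ x, avg y σ (i 3) (S₁.indicator 1) x * avg y σ (i 4) (S₂.indicator 1) x
          ∂(smoothedInstance y σ) := by
        refine lintegral_mul_eq_avg_mul_avg (by simp [hi.eq_iff])
          (measurable_one.indicator hmS₁) (measurable_one.indicator hmS₂) ?_ ?_
        · intro x z
          simp [hS₁, viewEvent, ht₁, Set.indicator, hi.eq_iff]
        · intro x z
          simp [hS₂, viewEvent, ht₂, Set.indicator, hi.eq_iff]
    _ ≤ ∫⁻ x, ENNReal.ofReal ((2 * K ^ 2) ^ θ) * H x ∂(smoothedInstance y σ) := by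
        refine lintegral_mono_ae ?_
        filter_upwards [ae_injective (y := y) hd hσ] with x hx using hpt x hx
    _ ≤ ENNReal.ofReal ((2 * K ^ 2) ^ θ) * ENNReal.ofReal (2 * (9 / (1 - θ) * σ ^ (-θ)) ^ 2) := by
        rw [lintegral_const_mul _ hmH]
        gcongr
    _ ≤ _ := by
        rw [← ENNReal.ofReal_mul (by positivity)]
        refine ENNReal.ofReal_le_ofReal ?_
        have h1 : (σ ^ (-θ)) ^ 2 = ((σ ^ 2)⁻¹) ^ θ := by
          rw [Real.inv_rpow (by positivity), ← Real.rpow_natCast, ← Real.rpow_natCast,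
            ← Real.rpow_mul hσ.le, ← Real.rpow_mul hσ.le, ← Real.rpow_neg hσ.le]
          congr 1; push_cast; ring
        have h2 : (r * ε / σ ^ 2) ^ (9 / 5 : ℝ) = ((r * ε / σ ^ 2) ^ 2) ^ θ := by
          rw [← Real.rpow_natCast (r * ε / σ ^ 2), ← Real.rpow_mul (by positivity)]
          congr 1; norm_num [hθ]
        have h3 : (2 * K ^ 2) = 401408 * ((r * ε / σ ^ 2) ^ 2 * σ ^ 2) := by
          rw [hK]; field_simp; norm_num
        rw [h3, mul_pow, h1, h2, Real.mul_rpow (by norm_num) (by positivity),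
          Real.mul_rpow (by positivity) (by positivity), Real.inv_rpow (by positivity)]
        have h4 : (401408 : ℝ) ^ θ ≤ 401408 := by
          calc (401408 : ℝ) ^ θ ≤ 401408 ^ (1 : ℝ) :=
                Real.rpow_le_rpow_of_exponent_le (by norm_num) (by norm_num [hθ])
            _ = _ := Real.rpow_one _
        have hs : 0 < (σ ^ 2) ^ θ := by positivity
        have hX : 0 ≤ ((r * ε / σ ^ 2) ^ 2) ^ θ := by positivity
        calc _ = 401408 ^ θ * (2 * (9 / (1 - θ)) ^ 2) * ((r * ε / σ ^ 2) ^ 2) ^ θ := by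
              field_simp
          _ ≤ 401408 * (2 * (9 / (1 - θ)) ^ 2) * ((r * ε / σ ^ 2) ^ 2) ^ θ := by gcongr
          _ ≤ _ := by
              refine mul_le_mul_of_nonneg_right ?_ hX
              norm_num [hθ]

end six

theorem hgt_comm {d : ℕ} (a b v : EuclideanSpace ℝ (Fin d)) : hgt a b v = hgt b a v := by
  by_cases h : ‖b - a‖ = 0
  · rw [sub_eq_zero.1 (norm_eq_zero.1 h)]
  unfold hgt
  have e : ⟪a - b, v - b⟫ / ‖a - b‖ ^ 2 = 1 - ⟪b - a, v - a⟫ / ‖b - a‖ ^ 2 := by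
    have h1 : ⟪a - b, v - b⟫ = ‖b - a‖ ^ 2 - ⟪b - a, v - a⟫ := by
      rw [← real_inner_self_eq_norm_sq, ← inner_sub_right, ← neg_sub b a, inner_neg_left,
        ← inner_neg_right]
      congr 1
      abel
    rw [h1, norm_sub_rev a b]
    field_simp
  rw [e]
  congr 1
  module

theorem ofReal_sqrt_rpow {A q : ℝ} (hA : 0 ≤ A) :
    ENNReal.ofReal (√A) ^ q = ENNReal.ofReal A ^ (q / 2) := by
  rw [Real.sqrt_eq_rpow, ← ENNReal.ofReal_rpow_of_nonneg hA (by norm_num), ← ENNReal.rpow_mul]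
  congr 1; ring

/-! ### Two 4-cycles with three common points and no common diagonal: triangles that are not flat -/

section five
variable {n d : ℕ} {y : Fin n → EuclideanSpace ℝ (Fin d)} {σ : ℝ}

/-- Two 4-cycles that share exactly three points, with different opposite points, and both have a
small gap. -/
def fiveEvent (i : Fin 5 → Fin n) (ε : ℝ) : Set (Fin n → EuclideanSpace ℝ (Fin d)) :=
  {x | |gap (x (i 0)) (x (i 1)) (x (i 3)) (x (i 2))| ≤ ε ∧
    |gap (x (i 2)) (x (i 0)) (x (i 4)) (x (i 1))| ≤ ε}

/-- The side `ac` of the triangle `abc` is strictly the longest one. -/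
def flatEvent (a b c : Fin n) : Set (Fin n → EuclideanSpace ℝ (Fin d)) :=
  {x | ‖x b - x c‖ < ‖x a - x c‖ ∧ ‖x a - x b‖ < ‖x a - x c‖}

theorem measurableSet_flatEvent (a b c : Fin n) :
    MeasurableSet (flatEvent a b c : Set (Fin n → EuclideanSpace ℝ (Fin d))) := by
  simp only [flatEvent, Set.ofPred_and]
  exact (measurableSet_lt (by fun_prop) (by fun_prop)).inter
    (measurableSet_lt (by fun_prop) (by fun_prop))

theorem lintegral_norm_mul_hgt_le (hd : 2 ≤ d) (hσ : 0 < σ) {a b c : Fin n}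
    (hac : a ≠ c) (hbc : b ≠ c) (hab : a ≠ b) {q q' q'' : ℝ} (hq0 : 0 ≤ q) (hq : q < 1)
    (hq0' : 0 ≤ q') (hq' : q' < 1) (hq0'' : 0 ≤ q'') (hq'' : q'' < 1) :
    ∫⁻ x, ENNReal.ofReal ‖x a - x b‖ ^ (-q'') * (ENNReal.ofReal ‖x c - x a‖ ^ (-q) *
      ENNReal.ofReal (hgt (x a) (x b) (x c)) ^ (-q')) ∂(smoothedInstance y σ) ≤
      ENNReal.ofReal (9 / (1 - q'') * (9 / ((1 - q) * (1 - q'))) * σ ^ (-(q + q' + q''))) := by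
  have h1q : 0 < 1 - q := by linarith
  have h1q' : 0 < 1 - q' := by linarith
  have h1q'' : 0 < 1 - q'' := by linarith
  have m1 := measurable_hgt_apply (d := d) a b c
  refine (lintegral_mul_le_of_avg_le (i := c) (by fun_prop) (by fun_prop) (fun x z => ?_)
    (h := fun _ => ENNReal.ofReal (9 / ((1 - q) * (1 - q')) * σ ^ (-(q + q'))))
      (fun x => ?_)).trans ?_
  · simp only [Function.update_of_ne hac, Function.update_of_ne hbc]
  · simp only [avg, Function.update_of_ne hac, Function.update_of_ne hbc, Function.update_self]
    exact lintegral_norm_hgt_rpow_le hd hσ _ _ _ hq0 hq hq0' hq'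
  · rw [lintegral_mul_const _ (f := fun x : Fin n → EuclideanSpace ℝ (Fin d) =>
      ENNReal.ofReal ‖x a - x b‖ ^ (-q'')) (by fun_prop)]
    refine (mul_le_mul_left (lintegral_le_of_avg_le (i := a)
      (c := ENNReal.ofReal (9 / (1 - q'') * σ ^ (-q''))) (g := fun x =>
      ENNReal.ofReal ‖x a - x b‖ ^ (-q'')) (by fun_prop) fun x => ?_) _).trans (le_of_eq ?_)
    · simp only [avg, Function.update_of_ne hab.symm, Function.update_self]
      exact lintegral_norm_rpow_le hd hσ _ _ hq0'' hq''
    · rw [← ENNReal.ofReal_mul (by positivity), show -(q + q' + q'') = -q'' + -(q + q') by ring,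
        Real.rpow_add hσ]
      congr 1; ring

/-- Unless `c` is strictly the longest side, the two minima are different factors of Heron's
formula. Their product is then the square of one side minus the square of the difference of the
other two, which bounds a squared height. If `c` is strictly longest, both minima are `a + b - c`
and the argument breaks down. -/
theorem min_mul_min_cases {a b c A B C : ℝ} (hs : 0 ≤ a + b - c) (hs' : 0 ≤ a + c - b)
    (hs'' : 0 ≤ b + c - a)
    (h : ¬(b < c ∧ a < c)) (hA : b * A ^ 2 ≤ a * (c ^ 2 - (b - a) ^ 2))
    (hB : c * B ^ 2 ≤ b * (a ^ 2 - (c - b) ^ 2)) (hC : c * C ^ 2 ≤ a * (b ^ 2 - (c - a) ^ 2)) :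
    (b * A) ^ 2 ≤ (b * min (a + b - c) (b + c - a)) * (a * min (a + b - c) (a + c - b)) ∨
    a * c * B ^ 2 ≤ (b * min (a + b - c) (b + c - a)) * (a * min (a + b - c) (a + c - b)) ∨
    b * c * C ^ 2 ≤ (b * min (a + b - c) (b + c - a)) * (a * min (a + b - c) (a + c - b)) := by
  by_cases h1 : c ≤ b
  · rw [min_eq_right (a := a + b - c) (b := a + c - b) (by linarith)]
    rcases le_total (a + b - c) (b + c - a) with h2 | h2
    · rw [min_eq_left h2]
      right; left
      nlinarith
    · rw [min_eq_right h2]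
      left
      nlinarith
  · have h2 : c ≤ a := by
      by_contra h3
      exact h ⟨not_le.1 h1, not_le.1 h3⟩
    rw [min_eq_left (a := a + b - c) (b := a + c - b) (by linarith), min_eq_right (by linarith)]
    right; right
    nlinarith

theorem abs_sub_le_min {R a b : ℝ} : min (R + a - b) (R + b - a) ≤ R - |b - a| := by
  rcases abs_cases (b - a) with ⟨h, -⟩ | ⟨h, -⟩ <;> rw [h]
  · exact (min_le_left _ _).trans (by linarith)
  · exact (min_le_right _ _).trans (by linarith)

theorem norm_triangle_nonneg {d : ℕ} (a b c : EuclideanSpace ℝ (Fin d)) :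
    0 ≤ ‖a - b‖ + ‖b - c‖ - ‖a - c‖ := by
  have := norm_sub_le_norm_sub_add_norm_sub a b c
  linarith

theorem viewEvent_of_fiveEvent {i : Fin 5 → Fin n} {r ε : ℝ}
    {x : Fin n → EuclideanSpace ℝ (Fin d)} (hx : x ∈ fiveEvent i ε)
    (hr : ∀ j k, ‖x j - x k‖ ≤ 2 * r) :
    x ∈ viewEvent (i 3) (i 2) (i 1)
      (fun x => ‖x (i 2) - x (i 0)‖ - ‖x (i 0) - x (i 1)‖) r ε ∩
    viewEvent (i 4) (i 1) (i 0) (fun x => ‖x (i 1) - x (i 2)‖ - ‖x (i 2) - x (i 0)‖) r ε := by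
  obtain ⟨h1, h2⟩ := hx
  refine ⟨⟨?_, hr _ _, hr _ _⟩, ⟨?_, hr _ _, hr _ _⟩⟩
  · convert h1 using 2
    simp only [gap, norm_sub_rev (x (i 1)) (x (i 3))]
    ring
  · convert h2 using 2
    simp only [gap, norm_sub_rev (x (i 0)) (x (i 4))]
    ring

/-- The private points `i 3` and `i 4` are integrated out independently, with bases `b` and `a` of
the common triangle. Exponent `3 / 4` on the product of the two bounds gives the rate `2 * (3 / 4)`
in `ε` and leaves one height to the power `-3 / 4`, which is integrable. -/
theorem measure_fiveEvent_diff_flatEvent_le (hd : 2 ≤ d) (hσ : 0 < σ) {i : Fin 5 → Fin n}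
    (hi : Function.Injective i) {r ε : ℝ} (hr : 0 < r) (hε : 0 < ε) :
    smoothedInstance y σ ((fiveEvent i ε ∩ {x | ∀ j k, ‖x j - x k‖ ≤ 2 * r}) \
      flatEvent (i 0) (i 1) (i 2)) ≤
      ENNReal.ofReal (5 * 10 ^ 9 * (r * ε / σ ^ 2) ^ (3 / 2 : ℝ)) := by
  set t₁ : (Fin n → EuclideanSpace ℝ (Fin d)) → ℝ :=
    fun x => ‖x (i 2) - x (i 0)‖ - ‖x (i 0) - x (i 1)‖ with ht₁
  set t₂ : (Fin n → EuclideanSpace ℝ (Fin d)) → ℝ :=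
    fun x => ‖x (i 1) - x (i 2)‖ - ‖x (i 2) - x (i 0)‖ with ht₂
  have hm₁ : Measurable t₁ := by fun_prop
  have hm₂ : Measurable t₂ := by fun_prop
  set V₁ := viewEvent (i 3) (i 2) (i 1) t₁ r ε with hV₁
  set S₁ := V₁ \ flatEvent (i 0) (i 1) (i 2) with hS₁
  set S₂ := viewEvent (i 4) (i 1) (i 0) t₂ r ε with hS₂
  have hmS₁ : MeasurableSet S₁ :=
    (measurableSet_viewEvent _ _ _ hm₁ r ε).diff (measurableSet_flatEvent _ _ _)
  have hmS₂ : MeasurableSet S₂ := measurableSet_viewEvent _ _ _ hm₂ r ε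
  have hsub : (fiveEvent i ε ∩ {x | ∀ j k, ‖x j - x k‖ ≤ 2 * r}) \ flatEvent (i 0) (i 1) (i 2) ⊆
      S₁ ∩ S₂ := fun x hx =>
    ⟨⟨(viewEvent_of_fiveEvent hx.1.1 hx.1.2).1, hx.2⟩, (viewEvent_of_fiveEvent hx.1.1 hx.1.2).2⟩
  set K : ℝ := 448 * (r * ε / σ) with hK
  have hK0 : 0 < K := by positivity
  set H₁ : (Fin n → EuclideanSpace ℝ (Fin d)) → ℝ≥0∞ := fun x =>
    ENNReal.ofReal ‖x (i 1) - x (i 2)‖ ^ (-(3 / 4) : ℝ) *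
      (ENNReal.ofReal ‖x (i 0) - x (i 1)‖ ^ (-0 : ℝ) *
      ENNReal.ofReal (hgt (x (i 1)) (x (i 2)) (x (i 0))) ^ (-(3 / 4) : ℝ)) with hH₁
  set H₂ : (Fin n → EuclideanSpace ℝ (Fin d)) → ℝ≥0∞ := fun x =>
    ENNReal.ofReal ‖x (i 0) - x (i 2)‖ ^ (-(3 / 8) : ℝ) *
      (ENNReal.ofReal ‖x (i 1) - x (i 0)‖ ^ (-(3 / 8) : ℝ) *
      ENNReal.ofReal (hgt (x (i 0)) (x (i 2)) (x (i 1))) ^ (-(3 / 4) : ℝ)) with hH₂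
  set H₃ : (Fin n → EuclideanSpace ℝ (Fin d)) → ℝ≥0∞ := fun x =>
    ENNReal.ofReal ‖x (i 2) - x (i 0)‖ ^ (-(3 / 8) : ℝ) *
      (ENNReal.ofReal ‖x (i 1) - x (i 2)‖ ^ (-(3 / 8) : ℝ) *
      ENNReal.ofReal (hgt (x (i 2)) (x (i 0)) (x (i 1))) ^ (-(3 / 4) : ℝ)) with hH₃
  have mh1 := measurable_hgt_apply (d := d) (i 1) (i 2) (i 0)
  have mh2 := measurable_hgt_apply (d := d) (i 0) (i 2) (i 1)
  have mh3 := measurable_hgt_apply (d := d) (i 2) (i 0) (i 1)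
  have hmH₁ : Measurable H₁ := by fun_prop
  have hmH₂ : Measurable H₂ := by fun_prop
  have hmH₃ : Measurable H₃ := by fun_prop
  have hpt : ∀ x : Fin n → EuclideanSpace ℝ (Fin d),
      avg y σ (i 3) (S₁.indicator 1) x * avg y σ (i 4) (S₂.indicator 1) x ≤
        ENNReal.ofReal ((2 * K ^ 2) ^ (3 / 4 : ℝ)) * (H₁ x + (H₂ x + H₃ x)) := by
    intro x
    by_cases hfl : x ∈ flatEvent (i 0) (i 1) (i 2)
    · have h0 : avg y σ (i 3) (S₁.indicator 1) x = 0 := by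
        simp only [avg]
        rw [lintegral_eq_zero_of_ae_eq_zero]
        refine Filter.Eventually.of_forall fun z => ?_
        refine Set.indicator_of_notMem (fun h => h.2 ?_) _
        simpa [flatEvent, Function.update_apply, hi.eq_iff] using hfl
      rw [h0, zero_mul]
      exact bot_le
    set p₁ := x (i 0)
    set p₂ := x (i 1)
    set p₃ := x (i 2)
    set a := ‖p₁ - p₂‖ with ha
    set b := ‖p₂ - p₃‖ with hb
    set c := ‖p₃ - p₁‖ with hc
    have hs : 0 ≤ a + b - c := by
      have := norm_triangle_nonneg p₁ p₂ p₃
      rwa [norm_sub_rev p₁ p₃] at this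
    have hs' : 0 ≤ a + c - b := by
      have := norm_triangle_nonneg p₂ p₁ p₃
      rwa [norm_sub_rev p₂ p₁, norm_sub_rev p₁ p₃] at this
    have hs'' : 0 ≤ b + c - a := by
      have := norm_triangle_nonneg p₁ p₃ p₂
      rw [norm_sub_rev p₁ p₃, norm_sub_rev p₃ p₂] at this
      linarith
    have ha0 : 0 ≤ a := norm_nonneg _
    have hb0 : 0 ≤ b := norm_nonneg _
    have hc0 : 0 ≤ c := norm_nonneg _
    have hu₁ : 0 ≤ b * min (a + b - c) (b + c - a) := mul_nonneg hb0 (le_min hs hs'')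
    have hu₂ : 0 ≤ a * min (a + b - c) (a + c - b) := mul_nonneg ha0 (le_min hs hs')
    have hF₁ := avg_viewEvent_le (y := y) hd hσ (p := i 3) (a := i 2) (b := i 1)
      (by simp [hi.eq_iff]) (by simp [hi.eq_iff]) (t := t₁) (by
        intro x z; simp [ht₁, hi.eq_iff]) hr hε x
      (Real.sqrt_nonneg (b * min (a + b - c) (b + c - a))) (by
        rw [Real.sq_sqrt hu₁]
        refine mul_le_mul_of_nonneg_left (le_trans ?_ (le_max_left _ _)) hb0
        rw [add_comm a b]
        exact abs_sub_le_min)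
    have hF₁' : avg y σ (i 3) (S₁.indicator 1) x ≤ _ := le_trans (lintegral_mono fun z =>
      Set.indicator_le_indicator_of_subset Set.sdiff_subset (fun _ => bot_le) _) hF₁
    have hF₂ := avg_viewEvent_le (y := y) hd hσ (p := i 4) (a := i 1) (b := i 0)
      (by simp [hi.eq_iff]) (by simp [hi.eq_iff]) (t := t₂) (by
        intro x z; simp [ht₂, hi.eq_iff]) hr hε x
      (Real.sqrt_nonneg (a * min (a + b - c) (a + c - b))) (by
        rw [Real.sq_sqrt hu₂, min_comm]
        exact mul_le_mul_of_nonneg_left (abs_sub_le_min.trans (le_max_left _ _)) ha0)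
    have hgen := fun v (hv : 0 ≤ v ∧ v ^ 2 ≤ (b * min (a + b - c) (b + c - a)) *
        (a * min (a + b - c) (a + c - b))) =>
      mul_le_rpow (avg_indicator_le_one (y := y) (σ := σ) (i 3) S₁ x)
      (avg_indicator_le_one (y := y) (σ := σ) (i 4) S₂ x) (v := v) hK0
      (by norm_num : (0 : ℝ) ≤ 3 / 4) (by norm_num) (Real.sqrt_nonneg _) (by
        have h1 := Real.le_sqrt_of_sq_le hv.2
        rw [Real.sqrt_mul hu₁] at h1
        linarith [hv.1]) hF₁' hF₂
    have hcases := min_mul_min_cases hs hs' hs'' (A := hgt p₂ p₃ p₁) (B := hgt p₃ p₁ p₂)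
      (C := hgt p₁ p₃ p₂) (by
        have := hfl
        simp only [flatEvent, Set.mem_ofPred_eq] at this
        rwa [norm_sub_rev (x (i 0)) (x (i 2))] at this) (by
        have := mul_hgt_sq_le p₂ p₃ p₁
        rwa [norm_sub_rev p₂ p₁] at this) (by
        have := mul_hgt_sq_le p₃ p₁ p₂
        rwa [norm_sub_rev p₃ p₂] at this) (by
        have := mul_hgt_sq_le p₁ p₃ p₂
        rwa [norm_sub_rev p₁ p₃, norm_sub_rev p₃ p₂] at this)
    rw [mul_add, mul_add]
    rcases hcases with h | h | h
    · refine le_trans (hgen (b * hgt p₂ p₃ p₁) ⟨mul_nonneg hb0 (hgt_nonneg _ _ _), h⟩)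
        (le_trans (mul_le_mul_right ?_ _) le_self_add)
      rw [ofReal_mul_rpow hb0, hH₁]
      simp only [neg_zero, ENNReal.rpow_zero, one_mul]
      exact le_rfl
    · refine le_trans (hgen (√(a * c) * hgt p₃ p₁ p₂)
        ⟨mul_nonneg (Real.sqrt_nonneg _) (hgt_nonneg _ _ _), by
          rw [mul_pow, Real.sq_sqrt (mul_nonneg ha0 hc0)]; exact h⟩)
        (le_trans (mul_le_mul_right ?_ _) (le_trans le_self_add le_add_self))
      rw [ofReal_mul_rpow (Real.sqrt_nonneg _), ofReal_sqrt_rpow (mul_nonneg ha0 hc0),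
        ofReal_mul_rpow ha0, hH₂, hgt_comm p₃ p₁, ha, norm_sub_rev p₁ p₂, hc, norm_sub_rev p₃ p₁]
      refine le_of_eq ?_
      rw [show (-(3 / 4) / 2 : ℝ) = -(3 / 8) by norm_num]
      ring
    · refine le_trans (hgen (√(b * c) * hgt p₁ p₃ p₂)
        ⟨mul_nonneg (Real.sqrt_nonneg _) (hgt_nonneg _ _ _), by
          rw [mul_pow, Real.sq_sqrt (mul_nonneg hb0 hc0)]; exact h⟩)
        (le_trans (mul_le_mul_right ?_ _) (le_trans le_add_self le_add_self))
      rw [ofReal_mul_rpow (Real.sqrt_nonneg _), ofReal_sqrt_rpow (mul_nonneg hb0 hc0),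
        ofReal_mul_rpow hb0, hH₃, hgt_comm p₁ p₃]
      refine le_of_eq ?_
      rw [show (-(3 / 4) / 2 : ℝ) = -(3 / 8) by norm_num]
      ring
  have hHint : ∫⁻ x, H₁ x + (H₂ x + H₃ x) ∂(smoothedInstance y σ) ≤
      ENNReal.ofReal (3000 * σ ^ (-(3 / 2) : ℝ)) := by
    have h1 := lintegral_norm_mul_hgt_le (y := y) hd hσ (a := i 1) (b := i 2) (c := i 0)
      (by simp [hi.eq_iff]) (by simp [hi.eq_iff]) (by simp [hi.eq_iff]) (q := 0) (q' := 3 / 4)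
      (q'' := 3 / 4) (by norm_num) (by norm_num) (by norm_num) (by norm_num) (by norm_num)
      (by norm_num)
    have h2 := lintegral_norm_mul_hgt_le (y := y) hd hσ (a := i 0) (b := i 2) (c := i 1)
      (by simp [hi.eq_iff]) (by simp [hi.eq_iff]) (by simp [hi.eq_iff]) (q := 3 / 8) (q' := 3 / 4)
      (q'' := 3 / 8) (by norm_num) (by norm_num) (by norm_num) (by norm_num) (by norm_num)
      (by norm_num)
    have h3 := lintegral_norm_mul_hgt_le (y := y) hd hσ (a := i 2) (b := i 0) (c := i 1)
      (by simp [hi.eq_iff]) (by simp [hi.eq_iff]) (by simp [hi.eq_iff]) (q := 3 / 8) (q' := 3 / 4)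
      (q'' := 3 / 8) (by norm_num) (by norm_num) (by norm_num) (by norm_num) (by norm_num)
      (by norm_num)
    rw [lintegral_add_left hmH₁, lintegral_add_left hmH₂]
    refine (add_le_add h1 (add_le_add h2 h3)).trans ?_
    rw [show (-(0 + 3 / 4 + 3 / 4) : ℝ) = -(3 / 2) by norm_num,
      show (-(3 / 8 + 3 / 4 + 3 / 8) : ℝ) = -(3 / 2) by norm_num]
    have hσp : 0 < σ ^ (-(3 / 2) : ℝ) := by positivity
    rw [← ENNReal.ofReal_add (mul_nonneg (by norm_num) hσp.le) (mul_nonneg (by norm_num) hσp.le),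
      ← ENNReal.ofReal_add (mul_nonneg (by norm_num) hσp.le)
        (add_nonneg (mul_nonneg (by norm_num) hσp.le) (mul_nonneg (by norm_num) hσp.le))]
    refine ENNReal.ofReal_le_ofReal ?_
    rw [← add_mul, ← add_mul]
    refine mul_le_mul_of_nonneg_right (by norm_num) hσp.le
  calc _ ≤ smoothedInstance y σ (S₁ ∩ S₂) := measure_mono hsub
    _ = ∫⁻ x, S₁.indicator 1 x * S₂.indicator 1 x ∂(smoothedInstance y σ) := by
        rw [← lintegral_indicator_one (hmS₁.inter hmS₂), Set.inter_indicator_one]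
        rfl
    _ = ∫⁻ x, avg y σ (i 3) (S₁.indicator 1) x * avg y σ (i 4) (S₂.indicator 1) x
          ∂(smoothedInstance y σ) := by
        refine lintegral_mul_eq_avg_mul_avg (by simp [hi.eq_iff])
          (measurable_one.indicator hmS₁) (measurable_one.indicator hmS₂) ?_ ?_
        · intro x z
          simp [hS₁, hV₁, viewEvent, flatEvent, ht₁, Set.indicator, hi.eq_iff]
        · intro x z
          simp [hS₂, viewEvent, ht₂, Set.indicator, hi.eq_iff]
    _ ≤ ∫⁻ x, ENNReal.ofReal ((2 * K ^ 2) ^ (3 / 4 : ℝ)) * (H₁ x + (H₂ x + H₃ x))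
          ∂(smoothedInstance y σ) := lintegral_mono hpt
    _ ≤ ENNReal.ofReal ((2 * K ^ 2) ^ (3 / 4 : ℝ)) * ENNReal.ofReal (3000 * σ ^ (-(3 / 2) : ℝ)) :=
      by
        rw [lintegral_const_mul _ (f := fun x => H₁ x + (H₂ x + H₃ x)) (by fun_prop)]
        gcongr
    _ ≤ _ := by
        rw [← ENNReal.ofReal_mul (by positivity)]
        refine ENNReal.ofReal_le_ofReal ?_
        have h1 : σ ^ (-(3 / 2) : ℝ) = ((σ ^ 2) ^ (3 / 4 : ℝ))⁻¹ := by
          rw [← Real.rpow_natCast, ← Real.rpow_mul hσ.le, ← Real.rpow_neg hσ.le]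
          congr 1; norm_num
        have h2 : (r * ε / σ ^ 2) ^ (3 / 2 : ℝ) = ((r * ε / σ ^ 2) ^ 2) ^ (3 / 4 : ℝ) := by
          rw [← Real.rpow_natCast (r * ε / σ ^ 2), ← Real.rpow_mul (by positivity)]
          congr 1; norm_num
        have h3 : (2 * K ^ 2) = 401408 * ((r * ε / σ ^ 2) ^ 2 * σ ^ 2) := by
          rw [hK]; field_simp; norm_num
        rw [h1, h2, h3, Real.mul_rpow (by norm_num) (by positivity),
          Real.mul_rpow (by positivity) (by positivity)]
        have h4 : (401408 : ℝ) ^ (3 / 4 : ℝ) ≤ 401408 := by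
          calc (401408 : ℝ) ^ (3 / 4 : ℝ) ≤ 401408 ^ (1 : ℝ) :=
                Real.rpow_le_rpow_of_exponent_le (by norm_num) (by norm_num)
            _ = _ := Real.rpow_one _
        have hs : 0 < (σ ^ 2) ^ (3 / 4 : ℝ) := by positivity
        have hX : 0 ≤ ((r * ε / σ ^ 2) ^ 2) ^ (3 / 4 : ℝ) := by positivity
        calc _ = 401408 ^ (3 / 4 : ℝ) * 3000 * ((r * ε / σ ^ 2) ^ 2) ^ (3 / 4 : ℝ) := by
              field_simp
          _ ≤ 401408 * 3000 * ((r * ε / σ ^ 2) ^ 2) ^ (3 / 4 : ℝ) := by gcongr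
          _ ≤ _ := mul_le_mul_of_nonneg_right (by norm_num) hX

end five

/-! ### Flat triangles of common points -/

section five
variable {n d : ℕ} {y : Fin n → EuclideanSpace ℝ (Fin d)} {σ : ℝ}

/-- A term that bounds the last expectation over a triangle `abv`. -/
noncomputable def triangleWeight (ε : ℝ) (a b v : EuclideanSpace ℝ (Fin d)) : ℝ≥0∞ :=
  ENNReal.ofReal (1 / (√‖v - a‖ * max (hgt a b v ^ 2 / (4 * ‖v - a‖)) ε))

theorem lintegral_triangleWeight_le (hd : 2 ≤ d) (hσ : 0 < σ) {a b c : Fin n} (hac : a ≠ c)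
    (hbc : b ≠ c) {ε : ℝ} (hε : 0 < ε) :
    ∫⁻ x, triangleWeight ε (x a) (x b) (x c) ∂(smoothedInstance y σ) ≤
      ENNReal.ofReal (54 / (σ * √ε)) := by
  have m1 := measurable_hgt_apply (d := d) a b c
  refine lintegral_le_of_avg_le (i := c) (by unfold triangleWeight; fun_prop) fun x => ?_
  simp only [avg, Function.update_of_ne hac, Function.update_of_ne hbc, Function.update_self]
  exact lintegral_triangle_le hd hσ _ _ _ hε

/-- Apply `hgt_sq_le_mul_add_sub` at the vertex `p₂`, with the apex at the end of the shorter of the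
two sides there. If that side is `p₂p₄`, replacing `‖p₂ - p₃‖` by it only enlarges the left-hand
side. -/
theorem inv_sqrt_mul_max_le {ε : ℝ} (hε : 0 < ε) {p₂ p₃ p₄ : EuclideanSpace ℝ (Fin d)}
    (h23 : p₃ ≠ p₂) (h24 : p₄ ≠ p₂) :
    ENNReal.ofReal (1 / (√‖p₂ - p₃‖ * max (‖p₂ - p₃‖ + ‖p₂ - p₄‖ - ‖p₃ - p₄‖) ε)) ≤
      triangleWeight ε p₂ p₄ p₃ + triangleWeight ε p₂ p₃ p₄ := by
  have h3 : 0 < ‖p₃ - p₂‖ := norm_pos_iff.2 (sub_ne_zero.2 h23)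
  have h4 : 0 < ‖p₄ - p₂‖ := norm_pos_iff.2 (sub_ne_zero.2 h24)
  rw [norm_sub_rev p₂ p₃, norm_sub_rev p₂ p₄]
  rcases le_total ‖p₃ - p₂‖ ‖p₄ - p₂‖ with h | h
  · refine le_trans (ENNReal.ofReal_le_ofReal ?_) le_self_add
    have h5 := hgt_sq_le_mul_add_sub p₂ p₄ p₃ h
    rw [norm_sub_rev p₄ p₃] at h5
    have h6 : 0 < max (hgt p₂ p₄ p₃ ^ 2 / (4 * ‖p₃ - p₂‖)) ε := lt_max_of_lt_right hε
    have h7 : hgt p₂ p₄ p₃ ^ 2 / (4 * ‖p₃ - p₂‖) ≤ ‖p₃ - p₂‖ + ‖p₄ - p₂‖ - ‖p₃ - p₄‖ := by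
      rw [div_le_iff₀ (by positivity)]
      linarith
    gcongr
  · refine le_trans (ENNReal.ofReal_le_ofReal ?_) le_add_self
    have h5 := hgt_sq_le_mul_add_sub p₂ p₃ p₄ h
    have h6 : 0 < max (hgt p₂ p₃ p₄ ^ 2 / (4 * ‖p₄ - p₂‖)) ε := lt_max_of_lt_right hε
    have h7 : hgt p₂ p₃ p₄ ^ 2 / (4 * ‖p₄ - p₂‖) ≤ ‖p₃ - p₂‖ + ‖p₄ - p₂‖ - ‖p₃ - p₄‖ := by
      rw [div_le_iff₀ (by positivity)]
      linarith
    gcongr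

/-- The event that `ac` is not shorter than `ab`, and the difference of these lengths is about the
difference of the lengths of `ce` and `be`. -/
def kiteEvent (a b c e : Fin n) (ε : ℝ) : Set (Fin n → EuclideanSpace ℝ (Fin d)) :=
  {x | x c ≠ x b ∧ 0 ≤ ‖x a - x c‖ - ‖x a - x b‖ ∧
    |‖x a - x c‖ - ‖x a - x b‖ - (‖x c - x e‖ - ‖x b - x e‖)| ≤ ε}

theorem measurableSet_kiteEvent (a b c e : Fin n) (ε : ℝ) :
    MeasurableSet (kiteEvent a b c e ε : Set (Fin n → EuclideanSpace ℝ (Fin d))) := by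
  simp only [kiteEvent, Set.ofPred_and]
  refine (measurableSet_eq_fun (by fun_prop) (by fun_prop)).compl.inter ?_
  exact (measurableSet_le (by fun_prop) (by fun_prop)).inter
    (measurableSet_le (by fun_prop) (by fun_prop))

/-- Integrating out the point `a` uses `setLIntegral_dist_sub_dist_le` with exactly its own weight
and produces another factor `1 / √m`, where `m` is the maximum in the statement. The two factors
combine to `1 / m`, and a single triangle integral over `b`, `c`, `e` remains. The constant is
`12096 = 112 · 2 · 54`. -/
theorem lintegral_kiteEvent_le (hd : 2 ≤ d) (hσ : 0 < σ) {a b c e : Fin n} (hba : b ≠ a)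
    (hca : c ≠ a) (hea : e ≠ a) (hbc : b ≠ c) (hbe : b ≠ e) (hce : c ≠ e) {ε K : ℝ} (hε : 0 < ε)
    (hK : 0 < K) :
    ∫⁻ x, ENNReal.ofReal (K / √(max (‖x b - x c‖ + ‖x b - x e‖ - ‖x c - x e‖) ε)) *
      (kiteEvent a b c e ε).indicator
        (fun x => ENNReal.ofReal (1 / √(‖x a - x c‖ * ‖x a - x b‖))) x ∂(smoothedInstance y σ) ≤
      ENNReal.ofReal (12096 * K * √ε / σ ^ 2) := by
  have hme := measurableSet_kiteEvent (d := d) a b c e ε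
  refine (lintegral_mul_le_of_avg_le (i := a) (by fun_prop)
    (Measurable.indicator (by fun_prop) hme) (fun x z => ?_)
    (h := fun x => ENNReal.ofReal (112 / σ * (ε / (√‖x b - x c‖ *
      √(max (‖x b - x c‖ - (‖x c - x e‖ - ‖x b - x e‖)) ε))))) (fun x => ?_)).trans ?_
  · simp only [Function.update_of_ne hba, Function.update_of_ne hca, Function.update_of_ne hea]
  · by_cases hcb : x c = x b
    · have : avg y σ a ((kiteEvent a b c e ε).indicator
        (fun x => ENNReal.ofReal (1 / √(‖x a - x c‖ * ‖x a - x b‖)))) x = 0 := by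
        simp only [avg]
        rw [lintegral_eq_zero_of_ae_eq_zero]
        refine Filter.Eventually.of_forall fun z => Set.indicator_of_notMem (fun h => ?_) _
        have := h.1
        rw [Function.update_of_ne hba, Function.update_of_ne hca] at this
        exact this hcb
      rw [this]
      exact bot_le
    · refine le_trans (le_of_eq ?_) (setLIntegral_dist_sub_dist_le hd hσ (y a) (x c) (x b) hcb
        (‖x c - x e‖ - ‖x b - x e‖) hε)
      rw [← lintegral_indicator (measurableSet_dist_sub_dist _ _ _ _)]
      refine lintegral_congr fun z => ?_
      simp only [Set.indicator, kiteEvent, Set.mem_ofPred_eq, Function.update_of_ne hba,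
        Function.update_of_ne hca, Function.update_of_ne hea, Function.update_self, ne_eq, hcb,
        not_false_eq_true, true_and]
  · have hpt : ∀ᵐ x ∂(smoothedInstance y σ),
        ENNReal.ofReal (K / √(max (‖x b - x c‖ + ‖x b - x e‖ - ‖x c - x e‖) ε)) *
        ENNReal.ofReal (112 / σ * (ε / (√‖x b - x c‖ *
          √(max (‖x b - x c‖ - (‖x c - x e‖ - ‖x b - x e‖)) ε)))) ≤
        ENNReal.ofReal (112 * K * ε / σ) *
          (triangleWeight ε (x b) (x e) (x c) + triangleWeight ε (x b) (x c) (x e)) := by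
      filter_upwards [ae_injective (y := y) hd hσ] with x hx
      refine le_trans ?_ (mul_le_mul_right
        (inv_sqrt_mul_max_le hε (hx c b hbc.symm) (hx e b hbe.symm)) _)
      rw [← ENNReal.ofReal_mul (by positivity), ← ENNReal.ofReal_mul (by positivity)]
      refine ENNReal.ofReal_le_ofReal (le_of_eq ?_)
      rw [show ‖x b - x c‖ - (‖x c - x e‖ - ‖x b - x e‖) =
        ‖x b - x c‖ + ‖x b - x e‖ - ‖x c - x e‖ by ring]
      have hm : 0 < max (‖x b - x c‖ + ‖x b - x e‖ - ‖x c - x e‖) ε := lt_max_of_lt_right hε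
      have hsm := Real.sqrt_pos.2 hm
      have hs := Real.mul_self_sqrt hm.le
      set m := max (‖x b - x c‖ + ‖x b - x e‖ - ‖x c - x e‖) ε
      have hbc0 : 0 < √‖x b - x c‖ := Real.sqrt_pos.2 (norm_pos_iff.2 (sub_ne_zero.2 (hx b c hbc)))
      calc K / √m * (112 / σ * (ε / (√‖x b - x c‖ * √m))) =
          112 * K * ε / σ * (1 / (√‖x b - x c‖ * (√m * √m))) := by field_simp
        _ = _ := by rw [hs]
    refine (lintegral_mono_ae hpt).trans ?_
    have mh1 := measurable_hgt_apply (d := d) b e c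
    have hmt : Measurable fun x : Fin n → EuclideanSpace ℝ (Fin d) =>
        triangleWeight ε (x b) (x e) (x c) := by unfold triangleWeight; fun_prop
    rw [lintegral_const_mul' _ _ ENNReal.ofReal_ne_top, lintegral_add_left hmt]
    refine (mul_le_mul_right (add_le_add (lintegral_triangleWeight_le hd hσ hbc hce.symm hε)
      (lintegral_triangleWeight_le hd hσ hbe hce hε)) _).trans ?_
    have hsε : 0 < √ε := Real.sqrt_pos.2 hε
    rw [← ENNReal.ofReal_add (by positivity) (by positivity),
      ← ENNReal.ofReal_mul (by positivity)]
    refine ENNReal.ofReal_le_ofReal (le_of_eq ?_)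
    have hs := Real.mul_self_sqrt hε.le
    field_simp
    rw [sq, hs]
    ring

/-- Integrating out both private points would leave a factor quadratic in the height, whose power
`-3 / 4` is not integrable in the plane. Instead `i 4` is integrated out first, then `i 0`, and the
triangle of `i 1`, `i 2`, `i 3` comes last. The first window event transfers the excess of the
triangle `i 0`, `i 1`, `i 2` to that triangle. The weight `1 / √a` left by the first integration is
the reason for keeping the weight in the density estimate. -/
theorem measure_fiveEvent_inter_flatEvent_le (hd : 2 ≤ d) (hσ : 0 < σ) {i : Fin 5 → Fin n}
    (hi : Function.Injective i) {r ε : ℝ} (hr : 0 < r) (hε : 0 < ε) :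
    smoothedInstance y σ ((fiveEvent i ε ∩ {x | ∀ j k, ‖x j - x k‖ ≤ 2 * r}) ∩
      flatEvent (i 0) (i 1) (i 2)) ≤
      ENNReal.ofReal (5 * 10 ^ 9 * (r * ε / σ ^ 2) ^ (3 / 2 : ℝ)) := by
  set t₁ : (Fin n → EuclideanSpace ℝ (Fin d)) → ℝ :=
    fun x => ‖x (i 2) - x (i 0)‖ - ‖x (i 0) - x (i 1)‖ with ht₁
  set t₂ : (Fin n → EuclideanSpace ℝ (Fin d)) → ℝ :=
    fun x => ‖x (i 1) - x (i 2)‖ - ‖x (i 2) - x (i 0)‖ with ht₂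
  have hm₁ : Measurable t₁ := by fun_prop
  have hm₂ : Measurable t₂ := by fun_prop
  set V₁ := viewEvent (i 3) (i 2) (i 1) t₁ r ε with hV₁
  set B : Set (Fin n → EuclideanSpace ℝ (Fin d)) := {x | ‖x (i 0) - x (i 2)‖ ≤ 2 * r} with hB
  set S₁ := V₁ ∩ (flatEvent (i 0) (i 1) (i 2) ∩ B) with hS₁
  set S₂ := viewEvent (i 4) (i 1) (i 0) t₂ r ε with hS₂
  have hmS₁ : MeasurableSet S₁ := (measurableSet_viewEvent _ _ _ hm₁ r ε).inter
    ((measurableSet_flatEvent _ _ _).inter (measurableSet_le (by fun_prop) (by fun_prop)))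
  have hmS₂ : MeasurableSet S₂ := measurableSet_viewEvent _ _ _ hm₂ r ε
  have hsub : (fiveEvent i ε ∩ {x | ∀ j k, ‖x j - x k‖ ≤ 2 * r}) ∩ flatEvent (i 0) (i 1) (i 2) ⊆
      S₁ ∩ S₂ := fun x hx =>
    ⟨⟨(viewEvent_of_fiveEvent hx.1.1 hx.1.2).1, hx.2, hx.1.2 _ _⟩,
      (viewEvent_of_fiveEvent hx.1.1 hx.1.2).2⟩
  set K : ℝ := 896 * (r * ε / σ) * √r with hK
  have hK0 : 0 < K := by positivity
  have hpt : ∀ᵐ x ∂(smoothedInstance y σ),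
      S₁.indicator 1 x * avg y σ (i 4) (S₂.indicator 1) x ≤
      ENNReal.ofReal (K / √(max (‖x (i 1) - x (i 2)‖ + ‖x (i 1) - x (i 3)‖ -
        ‖x (i 2) - x (i 3)‖) ε)) *
      (kiteEvent (i 0) (i 1) (i 2) (i 3) ε).indicator
        (fun x => ENNReal.ofReal (1 / √(‖x (i 0) - x (i 2)‖ * ‖x (i 0) - x (i 1)‖))) x := by
    filter_upwards [ae_injective (y := y) hd hσ] with x hx
    by_cases hxS : x ∈ S₁
    swap
    · rw [Set.indicator_of_notMem hxS, zero_mul]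
      exact bot_le
    rw [Set.indicator_of_mem hxS, Pi.one_apply, one_mul]
    obtain ⟨⟨hv, -, -⟩, ⟨hf1, hf2⟩, hxB⟩ := hxS
    have hxB' : ‖x (i 0) - x (i 2)‖ ≤ 2 * r := hxB
    have ha0 : 0 < ‖x (i 0) - x (i 1)‖ :=
      norm_pos_iff.2 (sub_ne_zero.2 (hx _ _ (by simp [hi.eq_iff])))
    have hc0 : 0 < ‖x (i 0) - x (i 2)‖ :=
      norm_pos_iff.2 (sub_ne_zero.2 (hx _ _ (by simp [hi.eq_iff])))
    have hv' : |‖x (i 0) - x (i 2)‖ - ‖x (i 0) - x (i 1)‖ -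
        (‖x (i 2) - x (i 3)‖ - ‖x (i 1) - x (i 3)‖)| ≤ ε := by
      rw [← abs_neg]
      convert hv using 2
      simp only [ht₁]
      rw [norm_sub_rev (x (i 3)) (x (i 2)), norm_sub_rev (x (i 3)) (x (i 1)),
        norm_sub_rev (x (i 2)) (x (i 0))]
      ring
    have hxk : x ∈ kiteEvent (i 0) (i 1) (i 2) (i 3) ε :=
      ⟨hx _ _ (by simp [hi.eq_iff]), by linarith, hv'⟩
    rw [Set.indicator_of_mem hxk]
    set a := ‖x (i 0) - x (i 1)‖ with ha
    set b := ‖x (i 1) - x (i 2)‖ with hb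
    set c := ‖x (i 0) - x (i 2)‖ with hc
    set m := max (b + ‖x (i 1) - x (i 3)‖ - ‖x (i 2) - x (i 3)‖) ε with hm
    have hm0 : 0 < m := lt_max_of_lt_right hε
    have hF₂ := avg_viewEvent_le (y := y) hd hσ (p := i 4) (a := i 1) (b := i 0)
      (by simp [hi.eq_iff]) (by simp [hi.eq_iff]) (t := t₂) (by
        intro x z; simp [ht₂, hi.eq_iff]) hr hε x (Real.sqrt_nonneg (a * (m / 2))) (by
        rw [Real.sq_sqrt (by positivity)]
        refine mul_le_mul_of_nonneg_left ?_ ha0.le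
        have ht : |t₂ x| = c - b := by
          simp only [ht₂, norm_sub_rev (x (i 2)) (x (i 0))]
          rw [abs_of_neg (by linarith)]
          ring
        rw [ht]
        -- The window event says that `a + b - c` is at least the excess of the triangle `i 1`, `i
        -- 2`, `i 3` minus `ε`. If that excess is at least `2 * ε`, half of it survives; otherwise
        -- `ε` itself is large enough.
        have h1 := (abs_le.1 hv').2
        rcases le_total (b + ‖x (i 1) - x (i 3)‖ - ‖x (i 2) - x (i 3)‖) (2 * ε) with h | h
        · refine le_trans ?_ (le_max_right _ _)
          have : m ≤ 2 * ε := max_le h (by linarith)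
          linarith
        · refine le_trans ?_ (le_max_left _ _)
          have : m = b + ‖x (i 1) - x (i 3)‖ - ‖x (i 2) - x (i 3)‖ := max_eq_left (by linarith)
          rw [this]
          change _ ≤ a - (c - b)
          linarith)
    refine hF₂.trans ?_
    rw [← ENNReal.ofReal_inv_of_pos (Real.sqrt_pos.2 (by positivity)),
      ← ENNReal.ofReal_mul (by positivity), ← ENNReal.ofReal_mul (by positivity)]
    refine ENNReal.ofReal_le_ofReal ?_
    have hsm : 0 < √m := Real.sqrt_pos.2 hm0
    have hsa : 0 < √a := Real.sqrt_pos.2 ha0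
    have hsc : 0 < √c := Real.sqrt_pos.2 hc0
    have hsr : 0 < √r := Real.sqrt_pos.2 hr
    have hs2 : 0 < √(2 : ℝ) := by positivity
    have h22 : √(2 : ℝ) * √2 = 2 := Real.mul_self_sqrt (by norm_num)
    have hcr : √c ≤ √2 * √r := by
      rw [← Real.sqrt_mul (by norm_num)]
      exact Real.sqrt_le_sqrt hxB'
    rw [Real.sqrt_mul ha0.le, Real.sqrt_div hm0.le, Real.sqrt_mul hc0.le]
    calc 448 * (r * ε / σ) * (√a * (√m / √2))⁻¹ = 448 * (r * ε / σ) / (√m * √a) * √2 := by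
          field_simp
      _ = 448 * (r * ε / σ) / (√m * √a) * (√2 * √c) / √c := by field_simp
      _ ≤ 448 * (r * ε / σ) / (√m * √a) * (√2 * (√2 * √r)) / √c := by gcongr
      _ = 448 * (r * ε / σ) / (√m * √a) * ((√2 * √2) * √r) / √c := by ring
      _ = K / √m * (1 / (√c * √a)) := by rw [h22, hK]; field_simp; norm_num
  calc _ ≤ smoothedInstance y σ (S₁ ∩ S₂) := measure_mono hsub
    _ = ∫⁻ x, S₁.indicator 1 x * S₂.indicator 1 x ∂(smoothedInstance y σ) := by
        rw [← lintegral_indicator_one (hmS₁.inter hmS₂), Set.inter_indicator_one]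
        rfl
    _ ≤ ∫⁻ x, S₁.indicator 1 x * avg y σ (i 4) (S₂.indicator 1) x ∂(smoothedInstance y σ) := by
        refine lintegral_mul_le_of_avg_le (i := i 4)
          (measurable_one.indicator hmS₁) (measurable_one.indicator hmS₂) ?_ fun _ => le_rfl
        intro x z
        simp [hS₁, hV₁, hB, viewEvent, flatEvent, ht₁, Set.indicator, hi.eq_iff]
    _ ≤ _ := (lintegral_mono_ae hpt).trans (lintegral_kiteEvent_le hd hσ (by simp [hi.eq_iff])
        (by simp [hi.eq_iff]) (by simp [hi.eq_iff]) (by simp [hi.eq_iff]) (by simp [hi.eq_iff])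
        (by simp [hi.eq_iff]) hε hK0)
    _ ≤ _ := by
        refine ENNReal.ofReal_le_ofReal ?_
        have hX : 0 < r * ε / σ ^ 2 := by positivity
        have e : (r * ε / σ ^ 2) ^ (3 / 2 : ℝ) = (r * ε / σ ^ 2) * (√r * √ε / σ) := by
          rw [show (3 / 2 : ℝ) = 1 + 1 / 2 by norm_num, Real.rpow_add hX, Real.rpow_one,
            ← Real.sqrt_eq_rpow, Real.sqrt_div (by positivity), Real.sqrt_sq hσ.le,
            Real.sqrt_mul hr.le]
        rw [e, hK]
        have hsr : 0 < √r := Real.sqrt_pos.2 hr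
        have hsε : 0 < √ε := Real.sqrt_pos.2 hε
        calc 12096 * (896 * (r * ε / σ) * √r) * √ε / σ ^ 2 =
            (12096 * 896) * (r * ε / σ ^ 2 * (√r * √ε / σ)) := by field_simp
          _ ≤ _ := mul_le_mul_of_nonneg_right (by norm_num) (by positivity)

theorem measure_fiveEvent_le (hd : 2 ≤ d) (hσ : 0 < σ) {i : Fin 5 → Fin n}
    (hi : Function.Injective i) {r ε : ℝ} (hr : 0 < r) (hε : 0 < ε) :
    smoothedInstance y σ (fiveEvent i ε ∩ {x | ∀ j k, ‖x j - x k‖ ≤ 2 * r}) ≤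
      ENNReal.ofReal (10 ^ 10 * (r * ε / σ ^ 2) ^ (3 / 2 : ℝ)) := by
  refine (measure_le_inter_add_sdiff _ _ (flatEvent (i 0) (i 1) (i 2))).trans ?_
  refine (add_le_add (measure_fiveEvent_inter_flatEvent_le hd hσ hi hr hε)
    (measure_fiveEvent_diff_flatEvent_le hd hσ hi hr hε)).trans ?_
  rw [← ENNReal.ofReal_add (by positivity) (by positivity)]
  refine ENNReal.ofReal_le_ofReal (le_of_eq ?_)
  ring

end five

/-! ### Exchanges as 4-cycles -/

/-- An exchange of two edges: the 4-cycle `u v w z`, of which `uv` and `wz` are added and `vw` and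
`zu` are removed. -/
structure Exchange (V : Type) where
  (u v w z : V)

namespace Exchange
variable {V : Type}

/-- `u v w z` is a presentation of the exchange `c`. -/
def Is (c : Exchange V) (u v w z : V) : Prop :=
  c = ⟨u, v, w, z⟩ ∨ c = ⟨v, u, z, w⟩ ∨ c = ⟨w, z, u, v⟩ ∨ c = ⟨z, w, v, u⟩

theorem is_self (c : Exchange V) : c.Is c.u c.v c.w c.z := Or.inl rfl

theorem Is.rotate {c : Exchange V} {u v w z : V} (h : c.Is u v w z) : c.Is w z u v := by
  unfold Is at *; tauto

/-- The four points of the exchange are distinct. -/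
def Proper (c : Exchange V) : Prop :=
  c.u ≠ c.v ∧ c.u ≠ c.w ∧ c.u ≠ c.z ∧ c.v ≠ c.w ∧ c.v ≠ c.z ∧ c.w ≠ c.z

theorem Proper.ne {c : Exchange V} (hc : c.Proper) {u v w z : V} (h : c.Is u v w z) :
    u ≠ v ∧ u ≠ w ∧ u ≠ z ∧ v ≠ w ∧ v ≠ z ∧ w ≠ z := by
  unfold Proper at hc
  rcases h with rfl | rfl | rfl | rfl <;> grind

/-- The edges that are added. -/
def Adds (c : Exchange V) (e : Sym2 V) : Prop := e = s(c.u, c.v) ∨ e = s(c.w, c.z)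

/-- The edges that are removed. -/
def Removes (c : Exchange V) (e : Sym2 V) : Prop := e = s(c.v, c.w) ∨ e = s(c.z, c.u)

/-- The diagonals of the 4-cycle. -/
def Diag (c : Exchange V) (e : Sym2 V) : Prop := e = s(c.u, c.w) ∨ e = s(c.v, c.z)

theorem Is.adds_iff {c : Exchange V} {u v w z : V} (h : c.Is u v w z) {e : Sym2 V} :
    c.Adds e ↔ e = s(u, v) ∨ e = s(w, z) := by
  rcases h with rfl | rfl | rfl | rfl <;> simp only [Adds, Sym2.eq_swap (a := v) (b := u),
    Sym2.eq_swap (a := z) (b := w)] <;> tauto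

theorem Is.removes_iff {c : Exchange V} {u v w z : V} (h : c.Is u v w z) {e : Sym2 V} :
    c.Removes e ↔ e = s(v, w) ∨ e = s(z, u) := by
  rcases h with rfl | rfl | rfl | rfl <;> simp only [Removes, Sym2.eq_swap (a := w) (b := v),
    Sym2.eq_swap (a := u) (b := z)] <;> tauto

theorem Is.diag_iff {c : Exchange V} {u v w z : V} (h : c.Is u v w z) {e : Sym2 V} :
    c.Diag e ↔ e = s(u, w) ∨ e = s(v, z) := by
  rcases h with rfl | rfl | rfl | rfl <;> simp only [Diag, Sym2.eq_swap (a := w) (b := u),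
    Sym2.eq_swap (a := z) (b := v)] <;> tauto

theorem Adds.exists_is {c : Exchange V} {u v : V} (h : c.Adds s(u, v)) : ∃ w z, c.Is u v w z := by
  obtain ⟨a, b, e, f⟩ := c
  simp only [Adds, Sym2.eq_iff] at h
  unfold Is
  rcases h with (⟨rfl, rfl⟩ | ⟨rfl, rfl⟩) | (⟨rfl, rfl⟩ | ⟨rfl, rfl⟩)
  · exact ⟨e, f, by simp⟩
  · exact ⟨f, e, by simp⟩
  · exact ⟨a, b, by simp⟩
  · exact ⟨b, a, by simp⟩

theorem Removes.exists_is {c : Exchange V} {u v : V} (h : c.Removes s(u, v)) :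
    ∃ w z, c.Is z u v w := by
  obtain ⟨a, b, e, f⟩ := c
  simp only [Removes, Sym2.eq_iff] at h
  unfold Is
  rcases h with (⟨rfl, rfl⟩ | ⟨rfl, rfl⟩) | (⟨rfl, rfl⟩ | ⟨rfl, rfl⟩)
  · exact ⟨f, a, by simp⟩
  · exact ⟨a, f, by simp⟩
  · exact ⟨b, e, by simp⟩
  · exact ⟨e, b, by simp⟩

theorem Diag.exists_is {c : Exchange V} {a b : V} (h : c.Diag s(a, b)) :
    ∃ y x, c.Is a y b x := by
  obtain ⟨u, v, w, z⟩ := c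
  simp only [Diag, Sym2.eq_iff] at h
  unfold Is
  rcases h with (⟨rfl, rfl⟩ | ⟨rfl, rfl⟩) | (⟨rfl, rfl⟩ | ⟨rfl, rfl⟩)
  · exact ⟨v, z, by simp⟩
  · exact ⟨z, v, by simp⟩
  · exact ⟨u, w, by simp⟩
  · exact ⟨w, u, by simp⟩

/-- The improvement made by the exchange. -/
def gain (f : V → V → ℝ) (c : Exchange V) : ℝ := f c.v c.w + f c.z c.u - f c.u c.v - f c.w c.z

theorem Is.gain_eq {f : V → V → ℝ} (hf : ∀ a b, f a b = f b a) {c : Exchange V} {u v w z : V}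
    (h : c.Is u v w z) : c.gain f = f v w + f z u - f u v - f w z := by
  rcases h with rfl | rfl | rfl | rfl <;> simp only [gain]
  · rw [hf v u, hf z w, hf u z, hf w v]; ring
  · ring
  · rw [hf z w, hf v u, hf w v, hf u z]; ring

end Exchange

/-! ### Pairs of linked exchanges with small gain -/

section smallCycles
variable {V : Type}

/-- The 4-cycle with diagonals `ad` and `bc` has alternating sum of side lengths at most `ε`. -/
def SmallCycle (f : V → V → ℝ) (ε : ℝ) (a d b c : V) : Prop :=
  (a ≠ b ∧ a ≠ c ∧ a ≠ d ∧ b ≠ c ∧ b ≠ d ∧ c ≠ d) ∧ |f a b - f b d + f d c - f c a| ≤ ε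

variable {f : V → V → ℝ} {ε : ℝ}

theorem SmallCycle.swap_left (hf : ∀ a b, f a b = f b a) {a d b c : V}
    (h : SmallCycle f ε a d b c) : SmallCycle f ε d a b c := by
  refine ⟨by have := h.1; grind, ?_⟩
  have := h.2
  rw [← abs_neg]
  convert this using 2
  rw [hf d b, hf b a, hf a c, hf c d]; ring

theorem SmallCycle.swap_right (hf : ∀ a b, f a b = f b a) {a d b c : V}
    (h : SmallCycle f ε a d b c) :
    SmallCycle f ε a d c b := by
  refine ⟨by have := h.1; grind, ?_⟩
  have := h.2
  rw [← abs_neg]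
  convert this using 2
  rw [hf a c, hf c d, hf d b, hf b a]; ring

theorem SmallCycle.swap (hf : ∀ a b, f a b = f b a) {a d b c : V}
    (h : SmallCycle f ε a d b c) : SmallCycle f ε b c a d := by
  refine ⟨by have := h.1; grind, ?_⟩
  have := h.2
  convert this using 2
  rw [hf b a, hf a c, hf c d, hf d b]; ring

/-- No two small 4-cycles share exactly one edge and its end points. -/
def NoSix (f : V → V → ℝ) (ε : ℝ) : Prop :=
  ∀ a b c d e g : V, SmallCycle f ε a c b d → SmallCycle f ε a e b g →
    c ≠ e → c ≠ g → d ≠ e → d ≠ g → False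

/-- No two small 4-cycles share exactly three points and no diagonal. -/
def NoFive (f : V → V → ℝ) (ε : ℝ) : Prop :=
  ∀ a b c d e : V, SmallCycle f ε a d b c → SmallCycle f ε c e a b → d ≠ e → False

theorem Exchange.Is.smallCycle {f : V → V → ℝ} (hf : ∀ a b, f a b = f b a) {c : Exchange V}
    (hc : c.Proper) {ε : ℝ} (h0 : 0 < c.gain f) (hε : c.gain f ≤ ε) {u v w z : V}
    (h : c.Is u v w z) : SmallCycle f ε u w v z := by
  refine ⟨by have := hc.ne h; grind, ?_⟩
  have hg := h.gain_eq hf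
  rw [← abs_neg, abs_of_nonneg]
  · rw [hg] at hε; rw [hf w z] at hε ⊢; linarith
  · rw [hg] at h0; linarith

/-- Two exchanges, the second of which removes an edge that the first one adds. -/
theorem link_cases (hf : ∀ a b, f a b = f b a) (h6 : NoSix f ε) (h5 : NoFive f ε)
    {c c' : Exchange V} (hc : c.Proper) (hc' : c'.Proper) (h0 : 0 < c.gain f) (hε : c.gain f ≤ ε)
    (h0' : 0 < c'.gain f) (hε' : c'.gain f ≤ ε) {u v w z w' z' : V} (h : c.Is u v w z)
    (h' : c'.Is z' u v w') :
    (w' = w ∧ z' ≠ z) ∨ (z' = z ∧ w' ≠ w) ∨ (w' = z ∧ z' = w) := by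
  have s := h.smallCycle hf hc h0 hε
  have s' := ((h'.smallCycle hf hc' h0' hε').swap hf).swap_right hf
  have hg := h.gain_eq hf
  have hg' := h'.gain_eq hf
  have hne := hc.ne h
  have hne' := hc'.ne h'
  by_cases h1 : w' = w
  · left
    refine ⟨h1, ?_⟩
    -- The second exchange would undo the first, so the two gains would be opposite and not both
    -- positive.
    rintro rfl
    subst h1
    rw [hg] at h0
    rw [hg', hf w' z'] at h0'
    linarith [hf z' w']
  by_cases h2 : z' = z
  · exact Or.inr (Or.inl ⟨h2, h1⟩)
  by_cases h3 : w' = z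
  · by_cases h4 : z' = w
    · exact Or.inr (Or.inr ⟨h3, h4⟩)
    · subst h3
      exact (h5 u w' v w z' (s.swap_right hf) (s'.swap hf)
        (Ne.symm h4)).elim
  by_cases h4 : z' = w
  · subst h4
    exact (h5 v z' u z w' ((s.swap hf).swap_right hf) s'
      (Ne.symm h3)).elim
  exact (h6 u v w z w' z' s s' (Ne.symm h1) (Ne.symm h4)
    (Ne.symm h3) (Ne.symm h2)).elim

/-- The exchange is proper and makes a small improvement. -/
structure Exchange.Tiny (f : V → V → ℝ) (ε : ℝ) (c : Exchange V) : Prop where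
  proper : c.Proper
  pos : 0 < c.gain f
  le : c.gain f ≤ ε

/-- If the second exchange is followed by a third one, the first two share a diagonal. -/
theorem link_shares_diagonal (hf : ∀ a b, f a b = f b a) (h6 : NoSix f ε) (h5 : NoFive f ε)
    {c c' : Exchange V} (t : c.Tiny f ε) (t' : c'.Tiny f ε)
    (hnext : ∀ e, c'.Adds e → ∃ c'' : Exchange V, c''.Tiny f ε ∧ c''.Removes e) {u v w z w' z' : V}
    (h : c.Is u v w z) (h' : c'.Is z' u v w') : (w' = w ∧ z' ≠ z) ∨ (z' = z ∧ w' ≠ w) := by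
  rcases link_cases hf h6 h5 t.proper t'.proper t.pos t.le t'.pos t'.le h h' with hh | hh | ⟨h1, h2⟩
  · exact Or.inl hh
  · exact Or.inr hh
  exfalso
  subst h1 h2
  -- Both exchanges now use the same four points. If the third one brings in a new point, its cycle
  -- shares three points and no diagonal with the first. If not, the three exchanges run through the
  -- three perfect matchings of the four points and back, and their gains sum to zero.
  obtain ⟨c'', t'', hr⟩ := hnext s(z', u) (h'.adds_iff.2 (Or.inl rfl))
  obtain ⟨s, p, h''⟩ := hr.exists_is
  have sc := h.smallCycle hf t.proper t.pos t.le
  have sc'' := h''.smallCycle hf t''.proper t''.pos t''.le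
  rcases link_cases hf h6 h5 t'.proper t''.proper t'.pos t'.le t''.pos t''.le h' h'' with
    ⟨e1, e2⟩ | ⟨e1, e2⟩ | ⟨e1, e2⟩
  · subst e1
    exact h5 s z' u w' p (sc.swap hf |>.swap_right hf)
      (sc''.swap_left hf |>.swap_right hf) (Ne.symm e2)
  · subst e1
    exact h5 p u z' v s (sc.swap hf |>.swap_left hf) (sc''.swap hf) (Ne.symm e2)
  · subst e1 e2
    have g1 := h.gain_eq hf
    have g2 := h'.gain_eq hf
    have g3 := h''.gain_eq hf
    have := t.pos
    have := t'.pos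
    have := t''.pos
    have e1 := hf p z'
    have e2 := hf z' s
    have e3 := hf s z'
    have e4 := hf s u
    have e5 := hf z' u
    have e6 := hf p s
    have e7 := hf u p
    linarith

/-- The exchange `c'` shares with `c` the diagonal `uw` and exactly one of the points `v`, `z`. -/
def SharesOne (f : V → V → ℝ) (ε : ℝ) (c' : Exchange V) (u v w z : V) : Prop :=
  ∃ t y, (t = v ∨ t = z) ∧ y ≠ u ∧ y ≠ v ∧ y ≠ w ∧ y ≠ z ∧ SmallCycle f ε u w t y ∧
    ∀ e, c'.Diag e ↔ e = s(u, w) ∨ e = s(t, y)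

theorem SharesOne.reflect (hf : ∀ a b, f a b = f b a) {c : Exchange V} {u v w z : V}
    (h : SharesOne f ε c u v w z) : SharesOne f ε c w v u z := by
  obtain ⟨t, y, ht, h1, h2, h3, h4, h5, h6⟩ := h
  refine ⟨t, y, ht, h3, h2, h1, h4, h5.swap_left hf, fun e => ?_⟩
  rw [h6, Sym2.eq_swap (a := w)]

theorem SharesOne.reflect' {c : Exchange V} {u v w z : V}
    (h : SharesOne f ε c u v w z) : SharesOne f ε c u z w v := by
  obtain ⟨t, y, ht, h1, h2, h3, h4, h5, h6⟩ := h
  exact ⟨t, y, ht.symm, h1, h4, h3, h2, h5, h6⟩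

/-- Two neighbours of an exchange do not share different diagonals with it. -/
theorem sharesOne_false (hf : ∀ a b, f a b = f b a) (h6 : NoSix f ε) (h5 : NoFive f ε)
    {c₁ c₂ : Exchange V} {u v w z : V}
    (hne : u ≠ v ∧ u ≠ w ∧ u ≠ z ∧ v ≠ w ∧ v ≠ z ∧ w ≠ z) (h₁ : SharesOne f ε c₁ u v w z)
    (h₂ : SharesOne f ε c₂ v u z w) : False := by
  obtain ⟨t, y, ht, y1, y2, y3, y4, s, -⟩ := h₁
  obtain ⟨t', y', ht', y1', y2', y3', y4', s', -⟩ := h₂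
  -- The two neighbouring cycles meet along an edge that joins one end of each diagonal. If their
  -- new points coincide, they share three points and no diagonal; otherwise they share exactly that
  -- edge.
  have key : ∀ u v w z : V, SmallCycle f ε u w v y → SmallCycle f ε v z u y' → y ≠ z → y' ≠ w →
      w ≠ z → False := by
    intro u v w z s s' h1 h2 h3
    by_cases h : y = y'
    · subst h
      exact h5 u y v w z (s.swap_right hf) s' h3
    · exact h6 u v w y y' z (s) (s'.swap hf) (Ne.symm h2) h3 h h1
  have n1 := s.1
  have n2 := s'.1
  rcases ht with rfl | rfl <;> rcases ht' with rfl | rfl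
  · exact key _ _ _ _ s s' (by grind) (by grind) (by grind)
  · exact key _ _ _ _ (s.swap_left hf) s' (by grind) (by grind) (by grind)
  · exact key _ _ _ _ s (s'.swap_left hf) (by grind) (by grind) (by grind)
  · exact key _ _ _ _ (s.swap_left hf) (s'.swap_left hf) (by grind) (by grind) (by grind)

theorem sharesOne_of_out (hf : ∀ a b, f a b = f b a) (h6 : NoSix f ε) (h5 : NoFive f ε)
    {c c' : Exchange V} (t : c.Tiny f ε) (t' : c'.Tiny f ε)
    (hnext : ∀ e, c'.Adds e → ∃ c'' : Exchange V, c''.Tiny f ε ∧ c''.Removes e) {u v w z w' z' : V}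
    (h : c.Is u v w z) (h' : c'.Is z' u v w') :
    SharesOne f ε c' u v w z ∨ SharesOne f ε c' v u z w := by
  have s' := h'.smallCycle hf t'.proper t'.pos t'.le
  have n := t.proper.ne h
  have n' := t'.proper.ne h'
  rcases link_shares_diagonal hf h6 h5 t t' hnext h h' with ⟨rfl, hz⟩ | ⟨rfl, hw⟩
  · refine Or.inl ⟨v, z', Or.inl rfl, by grind, by grind, by grind, hz, s'.swap hf |>.swap_right hf,
      fun e => ?_⟩
    rw [h'.diag_iff, Sym2.eq_swap (a := z')]; tauto
  · refine Or.inr ⟨u, w', Or.inl rfl, by grind, by grind, by grind, hw, s'.swap_left hf,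
      fun e => ?_⟩
    rw [h'.diag_iff, Sym2.eq_swap (a := z')]

theorem sharesOne_of_in (hf : ∀ a b, f a b = f b a) (h6 : NoSix f ε) (h5 : NoFive f ε)
    {c c' : Exchange V} (t : c.Tiny f ε) (t' : c'.Tiny f ε)
    (hnext : ∀ e, c'.Adds e → ∃ c'' : Exchange V, c''.Tiny f ε ∧ c''.Removes e) {u v w z w' z' : V}
    (h : c.Is u v w z) (h' : c'.Is z' u v w') :
    SharesOne f ε c z' u v w' ∨ SharesOne f ε c u z' w' v := by
  have s := h.smallCycle hf t.proper t.pos t.le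
  have n := t.proper.ne h
  have n' := t'.proper.ne h'
  rcases link_shares_diagonal hf h6 h5 t t' hnext h h' with ⟨rfl, hz⟩ | ⟨rfl, hw⟩
  · refine Or.inr ⟨v, z, Or.inr rfl, by grind, by grind, by grind, by grind, s, fun e => h.diag_iff⟩
  · refine Or.inl ⟨u, w, Or.inl rfl, by grind, by grind, by grind, by grind,
      s.swap hf |>.swap_left hf, fun e => ?_⟩
    rw [h.diag_iff, Sym2.eq_swap (a := v)]; tauto

theorem sharesOne_of_is (hf : ∀ a b, f a b = f b a) {c c' : Exchange V} {u v w z u' v' w' z' : V}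
    (h : c.Is u v w z) (h' : c.Is u' v' w' z')
    (hs : SharesOne f ε c' u v w z ∨ SharesOne f ε c' v u z w) :
    SharesOne f ε c' u' v' w' z' ∨ SharesOne f ε c' v' u' z' w' := by
  rcases h with rfl | rfl | rfl | rfl <;> rcases h' with h' | h' | h' | h' <;>
    simp only [Exchange.mk.injEq] at h' <;> obtain ⟨rfl, rfl, rfl, rfl⟩ := h'
  all_goals
    rcases hs with hs | hs
    all_goals first
      | exact Or.inl hs
      | exact Or.inr hs
      | exact Or.inl (hs.reflect hf).reflect'
      | exact Or.inr (hs.reflect hf).reflect'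

/-- If an exchange shares exactly one diagonal with each of its neighbours, it shares the same one
with all of them. -/
theorem exists_common_diag (hf : ∀ a b, f a b = f b a) (h6 : NoSix f ε) (h5 : NoFive f ε)
    {c : Exchange V} (hc : c.Proper) {N : Exchange V → Prop}
    (hN : ∀ c', N c' → SharesOne f ε c' c.u c.v c.w c.z ∨ SharesOne f ε c' c.v c.u c.z c.w) :
    ∃ δ, c.Diag δ ∧ ∀ c', N c' → c'.Diag δ := by
  by_cases h : ∃ c', N c' ∧ SharesOne f ε c' c.v c.u c.z c.w
  · obtain ⟨c₀, -, hs₀⟩ := h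
    refine ⟨s(c.v, c.z), Or.inr rfl, fun c' hc' => ?_⟩
    rcases hN c' hc' with hs | ⟨t, y, -, -, -, -, -, -, hd⟩
    · exact (sharesOne_false hf h6 h5 hc hs hs₀).elim
    · exact (hd _).2 (Or.inl rfl)
  · refine ⟨s(c.u, c.w), Or.inl rfl, fun c' hc' => ?_⟩
    rcases hN c' hc' with ⟨t, y, -, -, -, -, -, -, hd⟩ | hs
    · exact (hd _).2 (Or.inl rfl)
    · exact (h ⟨c', hc', hs⟩).elim

/-- Cycles with only three common points have at most one common diagonal. This makes the diagonals
chosen at two linked times agree. -/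
theorem diag_unique {c c' : Exchange V} (hc : c.Proper)
    (hs : SharesOne f ε c' c.u c.v c.w c.z ∨ SharesOne f ε c' c.v c.u c.z c.w) {δ δ' : Sym2 V}
    (h : c.Diag δ) (h' : c'.Diag δ) (k : c.Diag δ') (k' : c'.Diag δ') : δ = δ' := by
  have hne := hc
  unfold Exchange.Proper at hne
  rcases hs with ⟨t, y, -, y1, y2, y3, y4, -, hd⟩ | ⟨t, y, -, y1, y2, y3, y4, -, hd⟩
  all_goals
    rw [hd] at h' k'
    rcases h with rfl | rfl <;> rcases k with rfl | rfl <;>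
      simp only [Sym2.eq_iff] at * <;> grind

end smallCycles

/-! ### Links between exchanges and the count of bad times -/

/-- A sequence of `k` improving exchanges, applied to edge sets of maximal degree two. -/
structure MoveSeq (V : Type) [Fintype V] [DecidableEq V] (f : V → V → ℝ) (k : ℕ) where
  E : ℕ → Finset (Sym2 V)
  c : ℕ → Exchange V
  proper : ∀ i < k, (c i).Proper
  pos : ∀ i < k, 0 < (c i).gain f
  removes_mem : ∀ i < k, ∀ e, (c i).Removes e → e ∈ E i
  adds_notMem : ∀ i < k, ∀ e, (c i).Adds e → e ∉ E i
  mem_succ : ∀ i < k, ∀ e, e ∈ E (i + 1) ↔ (e ∈ E i ∧ ¬ (c i).Removes e) ∨ (c i).Adds e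
  degree : ∀ i < k, ∀ a, (Finset.univ.filter fun y => s(y, a) ∈ E i).card ≤ 2

namespace MoveSeq
variable {V : Type} [Fintype V] [DecidableEq V] {f : V → V → ℝ} {k : ℕ} (M : MoveSeq V f k)

/-- The edge `e` is added at time `i` and next removed at time `j`. -/
def Link (e : Sym2 V) (i j : ℕ) : Prop :=
  i < j ∧ j < k ∧ (M.c i).Adds e ∧ (M.c j).Removes e ∧ ∀ t, i < t → t ≤ j → e ∈ M.E t

theorem notMem_succ_of_removes {i : ℕ} (hi : i < k) {e : Sym2 V} (h : (M.c i).Removes e) :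
    e ∉ M.E (i + 1) := by
  rw [M.mem_succ i hi]
  rintro (⟨-, h'⟩ | h')
  · exact h' h
  · exact M.adds_notMem i hi e h' (M.removes_mem i hi e h)

variable {M}

theorem Link.right_unique {e : Sym2 V} {i j j' : ℕ} (h : M.Link e i j) (h' : M.Link e i j') :
    j = j' := by
  have key : ∀ j j', M.Link e i j → M.Link e i j' → ¬ j < j' := fun j j' h h' hlt =>
    M.notMem_succ_of_removes h.2.1 h.2.2.2.1 (h'.2.2.2.2 (j + 1) (by have := h.1; omega) hlt)
  have := key _ _ h h'
  have := key _ _ h' h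
  omega

theorem Link.left_unique {e : Sym2 V} {i i' j : ℕ} (h : M.Link e i j) (h' : M.Link e i' j) :
    i = i' := by
  have key : ∀ i i', M.Link e i j → M.Link e i' j → ¬ i < i' := fun i i' h h' hlt =>
    M.adds_notMem i' (h'.1.trans h'.2.1) e h'.2.2.1 (h.2.2.2.2 i' hlt h'.1.le)
  have := key _ _ h h'
  have := key _ _ h' h
  omega

/-- The first later removal of `e` would create a link. -/
theorem exists_link_right {i : ℕ} {e : Sym2 V} (he : (M.c i).Adds e)
    (h : ¬ ∃ j, M.Link e i j) {t : ℕ} (hit : i < t) (htk : t ≤ k) : e ∈ M.E t := by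
  induction t using Nat.strong_induction_on with
  | _ t ih =>
    obtain ⟨j, rfl⟩ : ∃ j, t = j + 1 := ⟨t - 1, by omega⟩
    rw [M.mem_succ j (by omega)]
    rcases eq_or_lt_of_le (Nat.lt_succ_iff.1 hit) with rfl | hij
    · exact Or.inr he
    · refine Or.inl ⟨ih j (by omega) hij (by omega), fun hr => h ⟨j, hij, by omega, he, hr, ?_⟩⟩
      intro t h1 h2
      exact ih t (by omega) h1 (by omega)

theorem exists_link_left {j : ℕ} (hj : j < k) {e : Sym2 V} (he : (M.c j).Removes e)
    (h : ¬ ∃ i, M.Link e i j) {t : ℕ} (htj : t ≤ j) : e ∈ M.E t := by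
  obtain ⟨m, rfl⟩ : ∃ m, t = j - m := ⟨j - t, by omega⟩
  induction m using Nat.strong_induction_on with
  | _ m ih =>
    rcases Nat.eq_zero_or_pos m with rfl | hm
    · exact M.removes_mem j hj e he
    by_cases hjm : j - m = j - (m - 1)
    · rw [hjm]; exact ih (m - 1) (by omega) (by omega)
    have h1 := ih (m - 1) (by omega) (by omega)
    rw [show j - (m - 1) = (j - m) + 1 by omega, M.mem_succ _ (by omega)] at h1
    rcases h1 with h1 | h1
    · exact h1.1
    · refine (h ⟨j - m, by omega, hj, h1, he, fun t ht1 ht2 => ?_⟩).elim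
      have := ih (j - t) (by omega) (by omega)
      rwa [show j - (j - t) = t by omega] at this

/-- Two times are neighbours if there is a link between them. -/
def Nbr (M : MoveSeq V f k) (i j : ℕ) : Prop := ∃ e, M.Link e i j ∨ M.Link e j i

theorem Nbr.symm {i j : ℕ} (h : M.Nbr i j) : M.Nbr j i := by
  obtain ⟨e, h⟩ := h
  exact ⟨e, h.symm⟩

theorem Nbr.lt {i j : ℕ} (h : M.Nbr i j) : i < k := by
  obtain ⟨e, h | h⟩ := h
  · exact h.1.trans h.2.1
  · exact h.2.1

open Classical in
/-- The times that have a neighbour in `X`. -/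
noncomputable def nbrs (M : MoveSeq V f k) (X : Finset ℕ) : Finset ℕ :=
  (Finset.range k).filter fun i => ∃ j ∈ X, M.Nbr i j

theorem mem_nbrs {X : Finset ℕ} {i : ℕ} : i ∈ M.nbrs X ↔ ∃ j ∈ X, M.Nbr i j := by
  classical
  simp only [nbrs, Finset.mem_filter, Finset.mem_range, and_iff_right_iff_imp]
  rintro ⟨j, -, h⟩
  exact h.lt

/-- Each of the two added edges has at most one link forward and each of the two removed ones at
most one link backward. -/
theorem card_nbrs_le (X : Finset ℕ) : (M.nbrs X).card ≤ 4 * X.card := by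
  classical
  let R : Sym2 V → ℕ → Finset ℕ := fun e j => (Finset.range k).filter fun i => M.Link e j i
  let L : Sym2 V → ℕ → Finset ℕ := fun e j => (Finset.range k).filter fun i => M.Link e i j
  have hR : ∀ e j, (R e j).card ≤ 1 := fun e j => Finset.card_le_one.2 fun a ha b hb =>
    (Finset.mem_filter.1 ha).2.right_unique (Finset.mem_filter.1 hb).2
  have hL : ∀ e j, (L e j).card ≤ 1 := fun e j => Finset.card_le_one.2 fun a ha b hb =>
    (Finset.mem_filter.1 ha).2.left_unique (Finset.mem_filter.1 hb).2
  have hsub : M.nbrs X ⊆ X.biUnion fun j =>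
      (R s((M.c j).u, (M.c j).v) j ∪ R s((M.c j).w, (M.c j).z) j) ∪
      (L s((M.c j).v, (M.c j).w) j ∪ L s((M.c j).z, (M.c j).u) j) := by
    intro i hi
    obtain ⟨j, hj, h⟩ := mem_nbrs.1 hi
    have hik := Finset.mem_range.2 h.lt
    refine Finset.mem_biUnion.2 ⟨j, hj, ?_⟩
    obtain ⟨e, h | h⟩ := h
    · refine Finset.mem_union_right _ ?_
      rcases h.2.2.2.1 with rfl | rfl
      · exact Finset.mem_union_left _ (Finset.mem_filter.2 ⟨hik, h⟩)
      · exact Finset.mem_union_right _ (Finset.mem_filter.2 ⟨hik, h⟩)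
    · refine Finset.mem_union_left _ ?_
      rcases h.2.2.1 with rfl | rfl
      · exact Finset.mem_union_left _ (Finset.mem_filter.2 ⟨hik, h⟩)
      · exact Finset.mem_union_right _ (Finset.mem_filter.2 ⟨hik, h⟩)
  refine (Finset.card_le_card hsub).trans ?_
  rw [mul_comm]
  refine Finset.card_biUnion_le_card_mul _ _ _ fun j _ => ?_
  refine (Finset.card_union_le _ _).trans ?_
  have h1 := Finset.card_union_le (R s((M.c j).u, (M.c j).v) j) (R s((M.c j).w, (M.c j).z) j)
  have h2 := Finset.card_union_le (L s((M.c j).v, (M.c j).w) j) (L s((M.c j).z, (M.c j).u) j)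
  have := hR s((M.c j).u, (M.c j).v) j
  have := hR s((M.c j).w, (M.c j).z) j
  have := hL s((M.c j).v, (M.c j).w) j
  have := hL s((M.c j).z, (M.c j).u) j
  omega

/-- The exchange at time `i` makes a small improvement, and its edges are all linked. -/
def Linked (M : MoveSeq V f k) (ε : ℝ) (i : ℕ) : Prop :=
  (M.c i).gain f ≤ ε ∧ (∀ e, (M.c i).Adds e → ∃ j, M.Link e i j) ∧
    ∀ e, (M.c i).Removes e → ∃ j, M.Link e j i

open Classical in
/-- The times that are not linked. -/
noncomputable def bad (M : MoveSeq V f k) (ε : ℝ) : Finset ℕ :=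
  (Finset.range k).filter fun i => ¬ M.Linked ε i

theorem mem_bad {ε : ℝ} {i : ℕ} : i ∈ M.bad ε ↔ i < k ∧ ¬ M.Linked ε i := by
  classical
  unfold bad
  rw [Finset.mem_filter, Finset.mem_range]

/-- Large gains are paid for by the total `L`. A time with an unlinked added edge is charged to that
edge, which survives to the end; different times are charged different edges, because an edge that
is present cannot be added. Unlinked removed edges are charged in the same way to the initial edge
set. -/
theorem card_bad_le {ε L : ℝ} (hε : 0 < ε) (hL : ∑ i ∈ Finset.range k, (M.c i).gain f ≤ L) :
    ((M.bad ε).card : ℝ) ≤ L / ε + (M.E 0).card + (M.E k).card := by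
  classical
  set A := (Finset.range k).filter fun i => ε < (M.c i).gain f
  set B := (Finset.range k).filter fun i => ∃ e, (M.c i).Adds e ∧ ¬ ∃ j, M.Link e i j
  set C := (Finset.range k).filter fun i => ∃ e, (M.c i).Removes e ∧ ¬ ∃ j, M.Link e j i
  have hsub : M.bad ε ⊆ A ∪ (C ∪ B) := by
    intro i hi
    obtain ⟨hik, hi⟩ := mem_bad.1 hi
    simp only [A, B, C, Finset.mem_union, Finset.mem_filter, Finset.mem_range, hik, true_and]
    by_cases h1 : ε < (M.c i).gain f
    · exact Or.inl h1
    right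
    by_contra h
    push Not at h
    exact hi ⟨not_lt.1 h1, h.2, h.1⟩
  have hA : (A.card : ℝ) ≤ L / ε := by
    rw [le_div_iff₀ hε]
    refine le_trans ?_ hL
    calc (A.card : ℝ) * ε = ∑ _i ∈ A, ε := by simp
      _ ≤ ∑ i ∈ A, (M.c i).gain f := Finset.sum_le_sum fun i hi => (Finset.mem_filter.1 hi).2.le
      _ ≤ _ := Finset.sum_le_sum_of_subset_of_nonneg (Finset.filter_subset _ _) fun i hi _ =>
        (M.pos i (Finset.mem_range.1 hi)).le
  have hB : B.card ≤ (M.E k).card := by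
    have hex : ∀ i : ℕ, ∃ e, i ∈ B → (M.c i).Adds e ∧ ¬ ∃ j, M.Link e i j := by
      intro i
      by_cases hi : i ∈ B
      · obtain ⟨e, he⟩ := (Finset.mem_filter.1 hi).2
        exact ⟨e, fun _ => he⟩
      · exact ⟨s((M.c 0).u, (M.c 0).u), fun h => (hi h).elim⟩
    choose g hg using hex
    have hlt : ∀ i ∈ B, i < k := fun i hi => Finset.mem_range.1 (Finset.mem_filter.1 hi).1
    refine Finset.card_le_card_of_injOn g (fun i hi => ?_) fun i hi j hj hij => ?_
    · exact exists_link_right (hg i hi).1 (hg i hi).2 (hlt i hi) le_rfl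
    · have key : ∀ i ∈ B, ∀ j ∈ B, g i = g j → ¬ i < j := fun i hi j hj hij h =>
        M.adds_notMem j (hlt j hj) _ (hg j hj).1
          (hij ▸ exists_link_right (hg i hi).1 (hg i hi).2 h (hlt j hj).le)
      have := key i hi j hj hij
      have := key j hj i hi hij.symm
      omega
  have hC : C.card ≤ (M.E 0).card := by
    have hex : ∀ i : ℕ, ∃ e, i ∈ C → (M.c i).Removes e ∧ ¬ ∃ j, M.Link e j i := by
      intro i
      by_cases hi : i ∈ C
      · obtain ⟨e, he⟩ := (Finset.mem_filter.1 hi).2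
        exact ⟨e, fun _ => he⟩
      · exact ⟨s((M.c 0).u, (M.c 0).u), fun h => (hi h).elim⟩
    choose g hg using hex
    have hlt : ∀ i ∈ C, i < k := fun i hi => Finset.mem_range.1 (Finset.mem_filter.1 hi).1
    refine Finset.card_le_card_of_injOn g (fun i hi => ?_) fun i hi j hj hij => ?_
    · exact exists_link_left (hlt i hi) (hg i hi).1 (hg i hi).2 (Nat.zero_le _)
    · have key : ∀ i ∈ C, ∀ j ∈ C, g i = g j → ¬ i < j := fun i hi j hj hij h =>
        M.notMem_succ_of_removes (hlt i hi) (hg i hi).1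
          (hij ▸ exists_link_left (hlt j hj) (hg j hj).1 (hg j hj).2 h)
      have := key i hi j hj hij
      have := key j hj i hi hij.symm
      omega
  have h1 := (Finset.card_le_card hsub).trans ((Finset.card_union_le _ _).trans
    (Nat.add_le_add_left (Finset.card_union_le _ _) _))
  have h2 : ((M.bad ε).card : ℝ) ≤ A.card + (C.card + B.card) := by exact_mod_cast h1
  have hB' : (B.card : ℝ) ≤ (M.E k).card := by exact_mod_cast hB
  have hC' : (C.card : ℝ) ≤ (M.E 0).card := by exact_mod_cast hC
  linarith

end MoveSeq

/-! ### A potential function: inversions between two sets -/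

section inversions
variable {V : Type}

/-- The number of pairs in the wrong order. -/
noncomputable def inversions (η : V → ℝ) (A B : Finset V) : ℕ :=
  ((A ×ˢ B).filter fun p => η p.2 < η p.1).card

/-- Putting `x` back for `y` in the first entry and `y` back for `x` in the second maps inversions
of the new pair of sets injectively to inversions of the old one. It only widens the inversion, and
it misses `(x, y)` itself. -/
theorem inversions_lt [DecidableEq V] {η : V → ℝ} {A B : Finset V} {x y : V} (hx : x ∈ A)
    (hy : y ∈ B)
    (h : η y < η x) :
    inversions η (insert y (A.erase x)) (insert x (B.erase y)) < inversions η A B := by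
  have hxy : (x, y) ∈ (A ×ˢ B).filter fun p => η p.2 < η p.1 := by simp [hx, hy, h]
  have hne : x ≠ y := by rintro rfl; exact lt_irrefl _ h
  unfold inversions
  rw [← Finset.card_erase_add_one hxy, Nat.lt_succ_iff]
  refine Finset.card_le_card_of_injOn
    (fun p => (if p.1 = y then x else p.1, if p.2 = x then y else p.2)) ?_ ?_
  · rintro ⟨u, v⟩ hp
    simp only [Finset.coe_filter, Finset.mem_product, Finset.mem_insert, Finset.mem_erase,
      Set.mem_ofPred_eq] at hp
    simp only [Finset.coe_erase, Finset.coe_filter, Finset.mem_product, Set.mem_sdiff,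
      Set.mem_ofPred_eq, Set.mem_singleton_iff, Prod.mk.injEq]
    obtain ⟨⟨h1, h2⟩, h3⟩ := hp
    by_cases hu : u = y <;> by_cases hv : v = x
    · subst hu hv; exact (lt_asymm h3 h).elim
    · subst hu
      simp only [if_true, hv, if_false] at *
      refine ⟨⟨⟨hx, ?_⟩, h3.trans h⟩, ?_⟩ <;> tauto
    · subst hv
      simp only [if_true, hu, if_false] at *
      refine ⟨⟨⟨?_, hy⟩, h.trans h3⟩, ?_⟩ <;> tauto
    · simp only [hu, hv, if_false, false_or] at *
      exact ⟨⟨⟨h1.2, h2.2⟩, h3⟩, fun h' => h1.1 h'.1⟩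
  · rintro ⟨u, v⟩ hp ⟨u', v'⟩ hp' heq
    simp only [Finset.coe_filter, Finset.mem_product, Finset.mem_insert, Finset.mem_erase,
      Set.mem_ofPred_eq] at hp hp'
    simp only [Prod.mk.injEq] at heq ⊢
    obtain ⟨e1, e2⟩ := heq
    constructor
    · split_ifs at e1 <;> grind
    · split_ifs at e2 <;> grind

theorem inversions_le_mul (η : V → ℝ) (A B : Finset V) :
    inversions η A B ≤ A.card * B.card :=
  (Finset.card_filter_le _ _).trans (Finset.card_product _ _).le

end inversions

/-! ### Exchanges with a common diagonal and the length of a sequence -/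

namespace MoveSeq
variable {V : Type} [Fintype V] [DecidableEq V] {f : V → V → ℝ} {k : ℕ} {M : MoveSeq V f k}

/-- The set `A` after `X t` has been replaced by `Y t` for all `t ∈ G ∩ [s, s + m)`. -/
def slide (G : Finset ℕ) (s : ℕ) (X Y : ℕ → V) (A : Finset V) : ℕ → Finset V
  | 0 => A
  | m + 1 => if s + m ∈ G then insert (Y (s + m)) ((slide G s X Y A m).erase (X (s + m)))
      else slide G s X Y A m

/-- The simulated set ignores exchanges outside `G`, so it need not be the true neighbourhood of
`a`. It nevertheless contains what `G` removes: such an edge was either present at time `s` or added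
by a member of `G`, and it is not removed in between. -/
theorem mem_slide {a b : V} {G : Finset ℕ} {s : ℕ} {X Y : ℕ → V} (hs : ∀ t ∈ G, s ≤ t)
    (hk : ∀ t ∈ G, t < k) (hXY : ∀ t ∈ G, (M.c t).Is a (Y t) b (X t)) {t i : ℕ} (ht : t ∈ G)
    (hl : M.Link s(X t, a) i t) (hi : i < s ∨ i ∈ G) {m : ℕ} (hm : s + m ≤ t) (him : i < s + m) :
    X t ∈ slide G s X Y (Finset.univ.filter fun y => s(y, a) ∈ M.E s) m := by
  induction m with
  | zero =>
    exact Finset.mem_filter.2 ⟨Finset.mem_univ _, hl.2.2.2.2 s (by omega) (hs t ht)⟩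
  | succ m ih =>
    by_cases hG : s + m ∈ G
    · have hr := M.notMem_succ_of_removes (hk _ hG) ((hXY _ hG).removes_iff.2 (Or.inr rfl))
      rw [slide, if_pos hG]
      by_cases h : i = s + m
      · subst h
        have := (M.proper _ (hk _ hG)).ne (hXY _ hG)
        have := (hXY _ hG).adds_iff.1 hl.2.2.1
        simp only [Sym2.eq_iff] at this
        rw [Finset.mem_insert]
        grind
      · refine Finset.mem_insert_of_mem (Finset.mem_erase.2 ⟨fun e => ?_, ih (by omega) (by omega)⟩)
        rw [← e] at hr
        exact hr (hl.2.2.2.2 _ (by omega) (by omega))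
    · rw [slide, if_neg hG]
      refine ih (by omega) ?_
      rcases hi with hi | hi
      · omega
      · have : i ≠ s + m := fun h => hG (h ▸ hi)
        omega

/-- An exchange with diagonal `ab` trades a neighbour of `a` against a neighbour of `b`, and its
gain is the drop of `v ↦ f v a - f v b` from the one to the other. Each exchange in `G` therefore
removes an inversion between the simulated sets, and initially there are at most `2 * 2`, both
degrees being at most two. -/
theorem card_window_le (hf : ∀ a b, f a b = f b a) {a b : V} {G : Finset ℕ} {s : ℕ}
    (hs : ∀ t ∈ G, s ≤ t) (hk : ∀ t ∈ G, t < k) (hd : ∀ t ∈ G, (M.c t).Diag s(a, b))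
    (hin : ∀ t ∈ G, ∀ e, (M.c t).Removes e → ∃ i, M.Link e i t ∧ (i < s ∨ i ∈ G)) :
    G.card ≤ 4 := by
  rcases G.eq_empty_or_nonempty with rfl | ⟨t₀, ht₀⟩
  · simp
  have hex : ∀ t, ∃ p : V × V, t ∈ G → (M.c t).Is a p.1 b p.2 := by
    intro t
    by_cases ht : t ∈ G
    · obtain ⟨y, x, h⟩ := (hd t ht).exists_is
      exact ⟨(y, x), fun _ => h⟩
    · exact ⟨(a, a), fun h => (ht h).elim⟩
  choose p hp using hex
  set Y : ℕ → V := fun t => (p t).1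
  set X : ℕ → V := fun t => (p t).2
  set A := slide G s X Y (Finset.univ.filter fun y => s(y, a) ∈ M.E s) with hA
  set B := slide G s Y X (Finset.univ.filter fun y => s(y, b) ∈ M.E s) with hB
  have hXA : ∀ m, s + m ∈ G → X (s + m) ∈ A m := by
    intro m hm
    obtain ⟨i, hl, hi⟩ := hin _ hm s(X (s + m), a) ((hp _ hm).removes_iff.2 (Or.inr rfl))
    exact mem_slide hs hk hp hm hl hi le_rfl hl.1
  have hYB : ∀ m, s + m ∈ G → Y (s + m) ∈ B m := by
    intro m hm
    obtain ⟨i, hl, hi⟩ := hin _ hm s(Y (s + m), b) ((hp _ hm).removes_iff.2 (Or.inl rfl))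
    exact mem_slide hs hk (fun t ht => (hp t ht).rotate) hm hl hi le_rfl hl.1
  have key : ∀ m, (G.filter fun t => t < s + m).card +
      inversions (fun v => f v a - f v b) (A m) (B m) ≤
      inversions (fun v => f v a - f v b) (A 0) (B 0) := by
    intro m
    induction m with
    | zero =>
      rw [Finset.filter_false_of_mem fun t ht => by have := hs t ht; omega]
      simp
    | succ m ih =>
      by_cases hm : s + m ∈ G
      · have hlt := inversions_lt (η := fun v => f v a - f v b) (hXA m hm) (hYB m hm) (by
          have := (hp _ hm).gain_eq hf
          have := M.pos _ (hk _ hm)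
          have := hf a (p (s + m)).1
          have := hf b (p (s + m)).2
          simp only [X, Y]
          linarith)
        have eA : A (m + 1) = insert (Y (s + m)) ((A m).erase (X (s + m))) := by
          rw [hA, slide, if_pos hm]
        have eB : B (m + 1) = insert (X (s + m)) ((B m).erase (Y (s + m))) := by
          rw [hB, slide, if_pos hm]
        have hc : (G.filter fun t => t < s + (m + 1)).card ≤
            (G.filter fun t => t < s + m).card + 1 := by
          refine (Finset.card_le_card fun t ht => ?_).trans (Finset.card_insert_le (s + m) _)
          rw [Finset.mem_insert, Finset.mem_filter]
          obtain ⟨h1, h2⟩ := Finset.mem_filter.1 ht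
          by_cases h : t = s + m
          · exact Or.inl h
          · exact Or.inr ⟨h1, by omega⟩
        rw [eA, eB]
        omega
      · have eA : A (m + 1) = A m := by rw [hA, slide, if_neg hm]
        have eB : B (m + 1) = B m := by rw [hB, slide, if_neg hm]
        have hc : (G.filter fun t => t < s + (m + 1)) = G.filter fun t => t < s + m := by
          refine Finset.filter_congr fun t ht => ?_
          have : t ≠ s + m := fun h => hm (h ▸ ht)
          omega
        rw [eA, eB, hc]
        exact ih
  have hG : (G.filter fun t => t < s + k) = G :=
    Finset.filter_true_of_mem fun t ht => (hk t ht).trans_le (Nat.le_add_left _ _)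
  have hsk : s < k := (hs t₀ ht₀).trans_lt (hk t₀ ht₀)
  have h1 := key k
  rw [hG] at h1
  have h2 := inversions_le_mul (fun v => f v a - f v b) (A 0) (B 0)
  have h3 := Nat.mul_le_mul (M.degree s hsk a) (M.degree s hsk b)
  have : (A 0).card * (B 0).card ≤ 2 * 2 := h3
  omega

/-- The bad times, their neighbours and the neighbours of these. -/
noncomputable def near (M : MoveSeq V f k) (ε : ℝ) : Finset ℕ :=
  (M.bad ε ∪ M.nbrs (M.bad ε)) ∪ M.nbrs (M.bad ε ∪ M.nbrs (M.bad ε))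

theorem card_near_le {ε : ℝ} : (M.near ε).card ≤ 25 * (M.bad ε).card := by
  have h1 := Finset.card_union_le (M.bad ε) (M.nbrs (M.bad ε))
  have h2 := M.card_nbrs_le (M.bad ε)
  have h3 := Finset.card_union_le (M.bad ε ∪ M.nbrs (M.bad ε))
    (M.nbrs (M.bad ε ∪ M.nbrs (M.bad ε)))
  have h4 := M.card_nbrs_le (M.bad ε ∪ M.nbrs (M.bad ε))
  unfold near
  omega

theorem linked_of_notMem {ε : ℝ} {i : ℕ} (hi : i < k) (h : i ∉ M.bad ε) : M.Linked ε i := by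
  by_contra h'
  exact h (mem_bad.2 ⟨hi, h'⟩)

theorem tiny_of_notMem {ε : ℝ} {i : ℕ} (hi : i < k) (h : i ∉ M.bad ε) : (M.c i).Tiny f ε :=
  ⟨M.proper i hi, M.pos i hi, (linked_of_notMem hi h).1⟩

theorem exists_next {ε : ℝ} {i : ℕ} (hi : i < k) (h : i ∉ M.bad ε ∪ M.nbrs (M.bad ε))
    {e : Sym2 V} (he : (M.c i).Adds e) : ∃ c' : Exchange V, c'.Tiny f ε ∧ c'.Removes e := by
  rw [Finset.mem_union, not_or] at h
  obtain ⟨j, hj⟩ := (linked_of_notMem hi h.1).2.1 e he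
  exact ⟨M.c j, tiny_of_notMem hj.2.1 fun hb => h.2 (mem_nbrs.2 ⟨j, hb, e, Or.inl hj⟩),
    hj.2.2.2.1⟩

/-- Distance more than two from the bad times is needed here: `j` is then neither bad nor next to a
bad time, so the edges it adds are removed by exchanges of small gain, as `link_shares_diagonal`
requires. -/
theorem sharesOne_of_nbr {ε : ℝ} (hf : ∀ a b, f a b = f b a) (h6 : NoSix f ε) (h5 : NoFive f ε)
    {i j : ℕ} (h : i ∉ M.near ε) (hij : M.Nbr i j) :
    SharesOne f ε (M.c j) (M.c i).u (M.c i).v (M.c i).w (M.c i).z ∨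
      SharesOne f ε (M.c j) (M.c i).v (M.c i).u (M.c i).z (M.c i).w := by
  rw [near, Finset.mem_union, not_or] at h
  have hj : j ∉ M.bad ε ∪ M.nbrs (M.bad ε) := fun hj => h.2 (mem_nbrs.2 ⟨j, hj, hij⟩)
  have ti := tiny_of_notMem hij.lt fun hb => h.1 (Finset.mem_union_left _ hb)
  have tj := tiny_of_notMem hij.symm.lt fun hb => hj (Finset.mem_union_left _ hb)
  have ni := fun e => exists_next (e := e) hij.lt h.1
  have nj := fun e => exists_next (e := e) hij.symm.lt hj
  obtain ⟨e, hl | hl⟩ := hij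
  · induction e with
    | _ u v =>
      obtain ⟨w, z, hi⟩ := hl.2.2.1.exists_is
      obtain ⟨w', z', hj⟩ := hl.2.2.2.1.exists_is
      exact sharesOne_of_is hf hi (M.c i).is_self (sharesOne_of_out hf h6 h5 ti tj nj hi hj)
  · induction e with
    | _ u v =>
      obtain ⟨w, z, hj⟩ := hl.2.2.1.exists_is
      obtain ⟨w', z', hi⟩ := hl.2.2.2.1.exists_is
      exact sharesOne_of_is hf hi (M.c i).is_self (sharesOne_of_in hf h6 h5 tj ti ni hj hi)

/-- Far from the bad times, every exchange has a diagonal that it shares with its neighbours. -/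
theorem exists_diag {ε : ℝ} (hf : ∀ a b, f a b = f b a) (h6 : NoSix f ε) (h5 : NoFive f ε) :
    ∃ δ : ℕ → Sym2 V, (∀ i < k, i ∉ M.near ε → (M.c i).Diag (δ i)) ∧
      ∀ i j, i ∉ M.near ε → j ∉ M.near ε → M.Nbr i j → δ i = δ j := by
  have hex : ∀ i, ∃ δ, i < k → i ∉ M.near ε →
      (M.c i).Diag δ ∧ ∀ j, M.Nbr i j → (M.c j).Diag δ := by
    intro i
    by_cases hi : i < k ∧ i ∉ M.near ε
    · obtain ⟨δ, h1, h2⟩ := exists_common_diag hf h6 h5 (M.proper i hi.1)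
        (N := fun c' => ∃ j, M.Nbr i j ∧ c' = M.c j)
        (by rintro _ ⟨j, hj, rfl⟩; exact sharesOne_of_nbr hf h6 h5 hi.2 hj)
      exact ⟨δ, fun _ _ => ⟨h1, fun j hj => h2 _ ⟨j, hj, rfl⟩⟩⟩
    · exact ⟨s((M.c 0).u, (M.c 0).u), fun h1 h2 => (hi ⟨h1, h2⟩).elim⟩
  choose δ hδ using hex
  refine ⟨δ, fun i hi h => (hδ i hi h).1, fun i j hi hj hij => ?_⟩
  exact diag_unique (M.proper i hij.lt) (sharesOne_of_nbr hf h6 h5 hi hij)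
    (hδ i hij.lt hi).1 ((hδ i hij.lt hi).2 j hij) ((hδ j hij.symm.lt hj).2 i hij.symm)
    (hδ j hij.symm.lt hj).1

/-- The times in `N`, whose removed edges may stem from outside `G`, cut the time axis into at most
`N.card + 1` pieces. A piece contains at most one time of `N`, and its other members form a window
for `card_window_le`. -/
theorem card_fiber_le (hf : ∀ a b, f a b = f b a) {δ : Sym2 V} {G N : Finset ℕ}
    (hk : ∀ t ∈ G, t < k) (hd : ∀ t ∈ G, (M.c t).Diag δ)
    (hin : ∀ t ∈ G, t ∉ N → ∀ e, (M.c t).Removes e → ∃ i ∈ G, M.Link e i t) :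
    G.card ≤ 5 * (N.card + 1) := by
  classical
  set φ : ℕ → ℕ := fun i => (N.filter fun m => m < i).card with hφ
  have hmono : Monotone φ := fun i j hij => Finset.card_le_card fun m hm => by
    rw [Finset.mem_filter] at hm ⊢
    exact ⟨hm.1, hm.2.trans_le hij⟩
  have hstrict : ∀ i ∈ N, ∀ j, i < j → φ i < φ j := by
    intro i hi j hij
    refine Finset.card_lt_card (Finset.ssubset_iff_of_subset (fun m hm => ?_) |>.2 ⟨i, ?_, ?_⟩)
    · rw [Finset.mem_filter] at hm ⊢
      exact ⟨hm.1, hm.2.trans hij⟩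
    · exact Finset.mem_filter.2 ⟨hi, hij⟩
    · simp
  have hmaps : ∀ i ∈ G, φ i ∈ Finset.range (N.card + 1) := fun i _ =>
    Finset.mem_range.2 (Nat.lt_succ_iff.2 (Finset.card_filter_le _ _))
  have := Finset.card_le_mul_card_image_of_maps_to hmaps 5 fun j _ => ?_
  · simpa using this
  set F := G.filter fun i => φ i = j with hF
  have h1 : (F.filter fun i => i ∈ N).card ≤ 1 := by
    refine Finset.card_le_one.2 fun a ha b hb => ?_
    simp only [hF, Finset.mem_filter] at ha hb
    rcases lt_trichotomy a b with h | h | h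
    · have := hstrict a ha.2 b h; omega
    · exact h
    · have := hstrict b hb.2 a h; omega
  have h2 : (F.filter fun i => ¬ i ∈ N).card ≤ 4 := by
    set U := F.filter fun i => ¬ i ∈ N with hU
    have hmem : ∀ t, t ∈ U ↔ (t ∈ G ∧ φ t = j) ∧ t ∉ N := by simp [hU, hF]
    rcases U.eq_empty_or_nonempty with h | h
    · simp [h]
    have hmin := (hmem _).1 (U.min'_mem h)
    induction δ with
    | _ a b =>
      refine card_window_le hf (s := U.min' h) (fun t ht => U.min'_le t ht)
        (fun t ht => hk t ((hmem t).1 ht).1.1) (fun t ht => hd t ((hmem t).1 ht).1.1) ?_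
      intro t ht e he
      have ht' := (hmem t).1 ht
      obtain ⟨i, hi, hl⟩ := hin t ht'.1.1 ht'.2 e he
      refine ⟨i, hl, ?_⟩
      -- A link that starts inside the window starts at a member of it: `φ` is constant there, and
      -- it would have jumped had `i` been in `N`.
      rcases lt_or_ge i (U.min' h) with hlt | hge
      · exact Or.inl hlt
      · right
        have e1 := hmono hge
        have e2 := hmono hl.1.le
        refine (hmem i).2 ⟨⟨hi, by omega⟩, fun hiN => ?_⟩
        have := hstrict i hiN t hl.1
        omega
  have := Finset.card_filter_add_card_filter_not (s := F) (fun i => i ∈ N)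
  omega

/-- Apply `card_fiber_le` to each diagonal, with `N` the times next to `M.near ε`. The constants are
`525 = 25 + 5 · 4 · 25`. -/
theorem length_le_bad {ε : ℝ} (hf : ∀ a b, f a b = f b a) (h6 : NoSix f ε) (h5 : NoFive f ε) :
    k ≤ 525 * (M.bad ε).card + 5 * Fintype.card (Sym2 V) := by
  classical
  obtain ⟨δ, hδ, hδ'⟩ := exists_diag (M := M) hf h6 h5
  set R := Finset.range k \ M.near ε with hR
  have hmem : ∀ t, t ∈ R ↔ t < k ∧ t ∉ M.near ε := by simp [hR]
  set N := R ∩ M.nbrs (M.near ε) with hNdef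
  have hfib : ∀ e : Sym2 V, (R.filter fun t => δ t = e).card ≤
      5 * ((N.filter fun t => δ t = e).card + 1) := by
    intro e
    refine card_fiber_le hf (fun t ht => ?_) (fun t ht => ?_) ?_ (M := M) (δ := e)
    · exact ((hmem t).1 (Finset.mem_filter.1 ht).1).1
    · obtain ⟨h1, h2⟩ := Finset.mem_filter.1 ht
      obtain ⟨h1, h3⟩ := (hmem t).1 h1
      exact h2 ▸ hδ t h1 h3
    · intro t ht htN e' he'
      obtain ⟨h1, h2⟩ := Finset.mem_filter.1 ht
      obtain ⟨h3, h4⟩ := (hmem t).1 h1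
      have hb : t ∉ M.bad ε := fun hb =>
        h4 (Finset.mem_union_left _ (Finset.mem_union_left _ hb))
      obtain ⟨i, hl⟩ := (linked_of_notMem h3 hb).2.2 e' he'
      have hi : i ∉ M.near ε := fun hi => htN (Finset.mem_filter.2
        ⟨Finset.mem_inter.2 ⟨h1, mem_nbrs.2 ⟨i, hi, e', Or.inr hl⟩⟩, h2⟩)
      refine ⟨i, Finset.mem_filter.2 ⟨(hmem i).2 ⟨hl.1.trans h3, hi⟩, ?_⟩, hl⟩
      rw [← h2]
      exact hδ' i t hi h4 ⟨e', Or.inl hl⟩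
  have hsum : R.card ≤ 5 * N.card + 5 * Fintype.card (Sym2 V) := by
    rw [Finset.card_eq_sum_card_fiberwise (s := R) (t := Finset.univ) (f := δ)
      (fun _ _ => Finset.mem_coe.2 (Finset.mem_univ _)),
      Finset.card_eq_sum_card_fiberwise (s := N) (t := Finset.univ) (f := δ)
      (fun _ _ => Finset.mem_coe.2 (Finset.mem_univ _))]
    refine (Finset.sum_le_sum fun e _ => hfib e).trans (le_of_eq ?_)
    rw [← Finset.mul_sum, Finset.sum_add_distrib]
    simp [mul_add]
  have h1 : N.card ≤ 4 * (M.near ε).card :=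
    (Finset.card_le_card Finset.inter_subset_right).trans (M.card_nbrs_le _)
  have h2 : (Finset.range k).card - (M.near ε).card ≤ R.card := Finset.le_card_sdiff _ _
  rw [Finset.card_range] at h2
  have h3 := M.card_near_le (ε := ε)
  omega

end MoveSeq

/-! ### From 2-opt runs to sequences of exchanges -/

section tours
variable {n d : ℕ}

theorem finRotate_ne (hn : 3 ≤ n) (i : Fin n) : finRotate n i ≠ i := by
  obtain ⟨m, rfl⟩ : ∃ m, n = m + 3 := ⟨n - 3, by omega⟩
  rw [finRotate_apply]
  intro h
  have := congrArg Fin.val (add_eq_left.1 h)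
  simp at this

theorem finRotate_finRotate_ne (hn : 3 ≤ n) (i : Fin n) : finRotate n (finRotate n i) ≠ i := by
  obtain ⟨m, rfl⟩ : ∃ m, n = m + 3 := ⟨n - 3, by omega⟩
  rw [finRotate_apply, finRotate_apply, add_assoc]
  intro h
  have := congrArg Fin.val (add_eq_left.1 h)
  have h2 : 2 % (m + 3) = 0 := by simpa [Fin.val_add] using this
  rw [Nat.mod_eq_of_lt (by omega)] at h2
  omega

theorem mem_tourEdges {π : Equiv.Perm (Fin n)} {a y : Fin n} :
    s(y, a) ∈ tourEdges π ↔
      y = π (finRotate n (π.symm a)) ∨ y = π ((finRotate n).symm (π.symm a)) := by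
  simp only [tourEdges, Finset.mem_image, Finset.mem_univ, true_and, Sym2.eq_iff]
  constructor
  · rintro ⟨i, ⟨rfl, rfl⟩ | ⟨rfl, rfl⟩⟩
    · right; rw [π.symm_apply_apply, Equiv.symm_apply_apply]
    · left; rw [π.symm_apply_apply]
  · rintro (rfl | rfl)
    · exact ⟨π.symm a, Or.inr (by simp)⟩
    · exact ⟨(finRotate n).symm (π.symm a), Or.inl
        ⟨rfl, by rw [Equiv.apply_symm_apply, π.apply_symm_apply]⟩⟩

/-- The neighbours of the city `a`. -/
def adjSet (E : Finset (Sym2 (Fin n))) (a : Fin n) : Finset (Fin n) :=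
  Finset.univ.filter fun y => s(y, a) ∈ E

theorem card_adjSet (hn : 3 ≤ n) (π : Equiv.Perm (Fin n)) (a : Fin n) :
    (adjSet (tourEdges π) a).card = 2 := by
  have : adjSet (tourEdges π) a =
      {π (finRotate n (π.symm a)), π ((finRotate n).symm (π.symm a))} := by
    ext y
    simp only [adjSet, Finset.mem_filter, Finset.mem_univ, true_and, mem_tourEdges,
      Finset.mem_insert, Finset.mem_singleton]
  rw [this, Finset.card_pair]
  intro h
  have h1 := (finRotate n).eq_symm_apply.1 (π.injective h)
  exact finRotate_finRotate_ne hn _ h1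

theorem notMem_tourEdges_self (hn : 3 ≤ n) (π : Equiv.Perm (Fin n)) (a : Fin n) :
    s(a, a) ∉ tourEdges π := by
  rw [mem_tourEdges]
  rintro (h | h)
  · exact finRotate_ne hn _ ((π.symm_apply_eq.2 h).symm)
  · have := (finRotate n).eq_symm_apply.1 (π.symm_apply_eq.2 h)
    exact finRotate_ne hn _ this

theorem tourLength_eq_sum (hn : 3 ≤ n) (x : Fin n → EuclideanSpace ℝ (Fin d))
    (π : Equiv.Perm (Fin n)) (F : Sym2 (Fin n) → ℝ) (hF : ∀ a b, F s(a, b) = ‖x a - x b‖) :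
    tourLength x π = ∑ e ∈ tourEdges π, F e := by
  unfold tourLength tourEdges
  rw [Finset.sum_image]
  · simp only [hF]
  · intro i _ j _ hij
    simp only [Sym2.eq_iff] at hij
    rcases hij with ⟨h, -⟩ | ⟨h1, h2⟩
    · exact π.injective h
    · have h1 := π.injective h1
      have h2 := π.injective h2
      rw [h1] at h2
      exact (finRotate_finRotate_ne hn _ h2).elim

/-- A 2-change exchanges two opposite sides of a 4-cycle for the two others. -/
theorem exists_exchange (hn : 3 ≤ n) {π π' : Equiv.Perm (Fin n)} (h : IsTwoChange π π') :
    ∃ c : Exchange (Fin n), c.Proper ∧ (∀ e, c.Removes e → e ∈ tourEdges π) ∧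
      (∀ e, c.Adds e → e ∉ tourEdges π) ∧
      ∀ e, e ∈ tourEdges π' ↔ (e ∈ tourEdges π ∧ ¬ c.Removes e) ∨ c.Adds e := by
  obtain ⟨e₁, e₂, f₁, f₂, -, -, he, hf, hE⟩ := h
  have hmem : ∀ e, e ∈ tourEdges π' ↔
      (e ∈ tourEdges π ∧ ¬ (e = e₁ ∨ e = e₂)) ∨ e = f₁ ∨ e = f₂ := by
    intro e
    simp only [hE, Finset.mem_union, Finset.mem_sdiff, Finset.mem_insert, Finset.mem_singleton]
  set E := tourEdges π with hE₀
  set E' := tourEdges π' with hE₀'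
  have hcard : ∀ a, (adjSet E a \ adjSet E' a).card = (adjSet E' a \ adjSet E a).card := fun a =>
    Finset.card_sdiff_comm ((card_adjSet hn π a).trans (card_adjSet hn π' a).symm)
  have hadj : ∀ (E E' : Finset (Sym2 (Fin n))) a y,
      y ∈ adjSet E a \ adjSet E' a ↔ s(y, a) ∈ E ∧ s(y, a) ∉ E' := by
    intro E E' a y; simp [adjSet]
  have hrem : ∀ a y, s(y, a) ∉ E → s(y, a) ∈ E' → ∃ w, s(w, a) ∈ E ∧ s(w, a) ∉ E' := by
    intro a y h1 h2
    have : 0 < (adjSet E a \ adjSet E' a).card := by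
      rw [hcard]; exact Finset.card_pos.2 ⟨y, (hadj _ _ _ _).2 ⟨h2, h1⟩⟩
    obtain ⟨w, hw⟩ := Finset.card_pos.1 this
    exact ⟨w, (hadj _ _ _ _).1 hw⟩
  have hadd : ∀ a y, s(y, a) ∈ E → s(y, a) ∉ E' → ∃ w, s(w, a) ∈ E' ∧ s(w, a) ∉ E := by
    intro a y h1 h2
    have : 0 < (adjSet E' a \ adjSet E a).card := by
      rw [← hcard]; exact Finset.card_pos.2 ⟨y, (hadj _ _ _ _).2 ⟨h1, h2⟩⟩
    obtain ⟨w, hw⟩ := Finset.card_pos.1 this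
    exact ⟨w, (hadj _ _ _ _).1 hw⟩
  have hout : ∀ e, e ∈ E → e ∉ E' → e = e₁ ∨ e = e₂ := by
    intro e h1 h2
    by_contra h
    exact h2 ((hmem e).2 (Or.inl ⟨h1, h⟩))
  have hinn : ∀ e, e ∈ E' → e ∉ E → e = f₁ ∨ e = f₂ := by
    intro e h1 h2
    rcases (hmem e).1 h1 with h | h
    · exact (h2 h.1).elim
    · exact h
  have hl := notMem_tourEdges_self hn π
  have hl' := notMem_tourEdges_self hn π'
  -- One of the two inserted edges may already belong to the tour as far as the definition goes; `f`
  -- names one that does not.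
  have hfE : ∃ f f' : Sym2 (Fin n), f ∉ E ∧ f ∈ E' ∧ ∀ e, (e = f₁ ∨ e = f₂) ↔ (e = f ∨ e = f') := by
    by_cases h1 : f₁ ∈ E
    · refine ⟨f₂, f₁, fun h2 => hf ?_, (hmem _).2 (Or.inr (Or.inr rfl)), fun e => or_comm⟩
      intro e he
      rcases Finset.mem_insert.1 he with rfl | he
      · exact h1
      · rw [Finset.mem_singleton.1 he]; exact h2
    · exact ⟨f₁, f₂, h1, (hmem _).2 (Or.inr (Or.inl rfl)), fun e => Iff.rfl⟩
  obtain ⟨f, f', hf1, hf2, hff⟩ := hfE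
  simp only [hff] at hinn hmem
  clear hff hf hE
  induction f with
  | _ u v =>
  obtain ⟨w, hw, hw'⟩ := hrem v u hf1 hf2
  have hf1' : s(v, u) ∉ E := by rwa [Sym2.eq_swap]
  have hf2' : s(v, u) ∈ E' := by rwa [Sym2.eq_swap]
  obtain ⟨z, hz, hz'⟩ := hrem u v hf1' hf2'
  have huv : u ≠ v := by rintro rfl; exact hl' _ hf2
  have hwv : w ≠ v := by rintro rfl; exact hl _ hw
  have hzu : z ≠ u := by rintro rfl; exact hl _ hz
  have hwu : w ≠ u := by rintro rfl; exact hf1 hw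
  have hzv : z ≠ v := by rintro rfl; exact hf1' hz
  have hother : ∀ a y, a ≠ u → a ≠ v → s(y, a) ∈ E' → s(y, a) ∉ E → s(y, a) = f' := by
    intro a y h1 h2 h3 h4
    rcases hinn _ h3 h4 with h | h
    · rw [Sym2.eq_iff] at h; grind
    · exact h
  -- If both lost edges ended in the same city, this city would have to gain two new edges, but only
  -- `f'` is available to it.
  have hwz : w ≠ z := by
    rintro rfl
    have h2 : 1 < (adjSet E w \ adjSet E' w).card := by
      refine Finset.one_lt_card.2 ⟨u, (hadj _ _ _ _).2 ?_, v, (hadj _ _ _ _).2 ?_, huv⟩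
      · rw [Sym2.eq_swap]; exact ⟨hz, hz'⟩
      · rw [Sym2.eq_swap]; exact ⟨hw, hw'⟩
    rw [hcard] at h2
    obtain ⟨p, hp, q, hq, hpq⟩ := Finset.one_lt_card.1 h2
    rw [hadj] at hp hq
    have e := (hother w p hwu hwv hp.1 hp.2).trans (hother w q hwu hwv hq.1 hq.2).symm
    rw [Sym2.eq_iff] at e
    grind
  have hf' : f' = s(w, z) := by
    obtain ⟨p, hp, hp'⟩ := hadd w v (by rwa [Sym2.eq_swap]) (by rwa [Sym2.eq_swap])
    obtain ⟨q, hq, hq'⟩ := hadd z u (by rwa [Sym2.eq_swap]) (by rwa [Sym2.eq_swap])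
    have e1 := hother w p hwu hwv hp hp'
    have e2 := hother z q hzu hzv hq hq'
    rw [← e2] at e1
    rw [Sym2.eq_iff] at e1
    rcases e1 with ⟨-, e⟩ | ⟨-, rfl⟩
    · exact (hwz e).elim
    · exact e2.symm
  have hfE : f' ∉ E := by
    obtain ⟨p, hp, hp'⟩ := hadd w v (by rwa [Sym2.eq_swap]) (by rwa [Sym2.eq_swap])
    rwa [← hother w p hwu hwv hp hp']
  have hee : ∀ e, (e = e₁ ∨ e = e₂) ↔ (e = s(v, w) ∨ e = s(z, u)) := by
    have h1 := hout _ hw hw'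
    have h2 := hout _ hz hz'
    rw [Sym2.eq_swap] at h1
    have h3 : s(v, w) ≠ s(z, u) := by rw [Ne, Sym2.eq_iff]; grind
    intro e
    grind
  refine ⟨⟨u, v, w, z⟩, ⟨huv, hwu.symm, hzu.symm, hwv.symm, hzv.symm, hwz⟩, ?_, ?_, ?_⟩
  · rintro e (rfl | rfl)
    · rw [Sym2.eq_swap]; exact hw
    · exact hz
  · rintro e (rfl | rfl)
    · exact hf1
    · exact hf' ▸ hfE
  · intro e
    rw [hmem, hee, hf']
    rfl

theorem gain_eq_tourLength_sub (hn : 3 ≤ n) (x : Fin n → EuclideanSpace ℝ (Fin d))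
    {π π' : Equiv.Perm (Fin n)} {c : Exchange (Fin n)} (hc : c.Proper)
    (hr : ∀ e, c.Removes e → e ∈ tourEdges π) (ha : ∀ e, c.Adds e → e ∉ tourEdges π)
    (h : ∀ e, e ∈ tourEdges π' ↔ (e ∈ tourEdges π ∧ ¬ c.Removes e) ∨ c.Adds e) :
    c.gain (fun a b => ‖x a - x b‖) = tourLength x π - tourLength x π' := by
  set F : Sym2 (Fin n) → ℝ := Sym2.lift ⟨fun a b => ‖x a - x b‖, fun a b => norm_sub_rev _ _⟩
  have hF : ∀ a b, F s(a, b) = ‖x a - x b‖ := fun a b => rfl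
  have hE : tourEdges π' = insert s(c.u, c.v) (insert s(c.w, c.z)
      (((tourEdges π).erase s(c.v, c.w)).erase s(c.z, c.u))) := by
    ext e
    rw [h]
    simp only [Finset.mem_insert, Finset.mem_erase, Exchange.Removes, Exchange.Adds]
    tauto
  unfold Exchange.Proper at hc
  rw [tourLength_eq_sum hn x π F hF, tourLength_eq_sum hn x π' F hF, hE, Finset.sum_insert,
    Finset.sum_insert]
  · have h1 := Finset.add_sum_erase (tourEdges π) F (hr _ (Or.inl rfl))
    have h2 := Finset.add_sum_erase ((tourEdges π).erase s(c.v, c.w)) F (a := s(c.z, c.u))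
      (Finset.mem_erase.2 ⟨by rw [Ne, Sym2.eq_iff]; grind, hr _ (Or.inr rfl)⟩)
    simp only [Exchange.gain, hF] at *
    linarith
  · intro hm
    exact ha _ (Or.inr rfl) (Finset.mem_of_mem_erase (Finset.mem_of_mem_erase hm))
  · intro hm
    rcases Finset.mem_insert.1 hm with hm | hm
    · rw [Sym2.eq_iff] at hm; grind
    · exact ha _ (Or.inl rfl) (Finset.mem_of_mem_erase (Finset.mem_of_mem_erase hm))

theorem exists_moveSeq (hn : 3 ≤ n) {x : Fin n → EuclideanSpace ℝ (Fin d)} {k : ℕ}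
    {T : Fin (k + 1) → Equiv.Perm (Fin n)} (hT : IsRun x k T) :
    ∃ M : MoveSeq (Fin n) (fun a b => ‖x a - x b‖) k,
      ∑ i ∈ Finset.range k, (M.c i).gain (fun a b => ‖x a - x b‖) ≤ tourLength x (T 0) ∧
      (M.E 0).card ≤ n ∧ (M.E k).card ≤ n := by
  -- The run is extended to all times by reduction modulo `k + 1`; only times up to `k` matter.
  set S : ℕ → Equiv.Perm (Fin n) := fun i => T (Fin.ofNat (k + 1) i) with hS
  have hit : ∀ i < k, IsIteration x (S i) (S (i + 1)) := by
    intro i hi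
    have h1 : Fin.ofNat (k + 1) i = (⟨i, hi⟩ : Fin k).castSucc :=
      Fin.ext (by simp only [Fin.val_ofNat, Fin.val_castSucc]; exact Nat.mod_eq_of_lt (by omega))
    have h2 : Fin.ofNat (k + 1) (i + 1) = (⟨i, hi⟩ : Fin k).succ :=
      Fin.ext (by simp only [Fin.val_ofNat, Fin.val_succ]; exact Nat.mod_eq_of_lt (by omega))
    simp only [hS, h1, h2]
    exact hT ⟨i, hi⟩
  have hex : ∀ i, ∃ c : Exchange (Fin n), i < k → c.Proper ∧
      (∀ e, c.Removes e → e ∈ tourEdges (S i)) ∧ (∀ e, c.Adds e → e ∉ tourEdges (S i)) ∧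
      ∀ e, e ∈ tourEdges (S (i + 1)) ↔ (e ∈ tourEdges (S i) ∧ ¬ c.Removes e) ∨ c.Adds e := by
    intro i
    by_cases hi : i < k
    · obtain ⟨c, hc⟩ := exists_exchange hn (hit i hi).1
      exact ⟨c, fun _ => hc⟩
    · have a : Fin n := ⟨0, by omega⟩
      exact ⟨⟨a, a, a, a⟩, fun h => (hi h).elim⟩
  choose c hc using hex
  have hgain : ∀ i < k, (c i).gain (fun a b => ‖x a - x b‖) =
      tourLength x (S i) - tourLength x (S (i + 1)) := fun i hi =>
    gain_eq_tourLength_sub hn x (hc i hi).1 (hc i hi).2.1 (hc i hi).2.2.1 (hc i hi).2.2.2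
  have hcard : ∀ π : Equiv.Perm (Fin n), (tourEdges π).card ≤ n := fun π =>
    Finset.card_image_le.trans (by simp)
  refine ⟨⟨fun i => tourEdges (S i), c, fun i hi => (hc i hi).1, fun i hi => ?_,
    fun i hi => (hc i hi).2.1, fun i hi => (hc i hi).2.2.1, fun i hi => (hc i hi).2.2.2,
    fun i _ a => (card_adjSet hn (S i) a).le⟩, ?_, hcard _, hcard _⟩
  · rw [hgain i hi]
    exact sub_pos.2 (hit i hi).2
  · rw [Finset.sum_congr rfl fun i hi => hgain i (Finset.mem_range.1 hi), Finset.sum_range_sub']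
    have h0 : S 0 = T 0 := rfl
    have : 0 ≤ tourLength x (S k) := Finset.sum_nonneg fun i _ => norm_nonneg _
    rw [h0]
    linarith

theorem noSix_of_notMem {x : Fin n → EuclideanSpace ℝ (Fin d)} {ε : ℝ}
    (h : ∀ i : Fin 6 → Fin n, Function.Injective i → x ∉ sixEvent i ε) :
    NoSix (fun a b => ‖x a - x b‖) ε := by
  intro a b c d' e g h1 h2 n1 n2 n3 n4
  -- In this order the two gaps are literally the alternating sums of `h1` and `h2`.
  refine h ![a, d', b, c, g, e] ?_ ⟨h1.2, h2.2⟩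
  have := h1.1
  have := h2.1
  intro i j hij
  fin_cases i <;> fin_cases j <;> first | rfl | (exfalso; simp at hij; grind)

theorem noFive_of_notMem {x : Fin n → EuclideanSpace ℝ (Fin d)} {ε : ℝ}
    (h : ∀ i : Fin 5 → Fin n, Function.Injective i → x ∉ fiveEvent i ε) :
    NoFive (fun a b => ‖x a - x b‖) ε := by
  intro a b c d' e h1 h2 n1
  refine h ![a, b, c, d', e] ?_ ⟨h1.2, h2.2⟩
  have := h1.1
  have := h2.1
  intro i j hij
  fin_cases i <;> fin_cases j <;> first | rfl | (exfalso; simp at hij; grind)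

/-- The length of a run on an instance without pairs of small 4-cycles. -/
theorem run_length_le (hn : 3 ≤ n) {x : Fin n → EuclideanSpace ℝ (Fin d)} {ε L : ℝ} (hε : 0 < ε)
    (h6 : ∀ i : Fin 6 → Fin n, Function.Injective i → x ∉ sixEvent i ε)
    (h5 : ∀ i : Fin 5 → Fin n, Function.Injective i → x ∉ fiveEvent i ε) {k : ℕ}
    {T : Fin (k + 1) → Equiv.Perm (Fin n)} (hT : IsRun x k T) (hL : tourLength x (T 0) ≤ L) :
    (k : ℝ) ≤ 525 * (L / ε) + 355 * (n : ℝ) ^ 2 := by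
  obtain ⟨M, h1, h2, h3⟩ := exists_moveSeq hn hT
  have h4 := M.card_bad_le hε (h1.trans hL)
  have h5 : (k : ℝ) ≤ 525 * (M.bad ε).card + 5 * Fintype.card (Sym2 (Fin n)) := by
    exact_mod_cast M.length_le_bad (fun a b => norm_sub_rev _ _) (noSix_of_notMem h6)
      (noFive_of_notMem h5)
  have h6 : (Fintype.card (Sym2 (Fin n)) : ℝ) ≤ n ^ 2 := by
    have : Fintype.card (Sym2 (Fin n)) ≤ n ^ 2 := by
      have := Fintype.card_le_of_surjective _
        (Sym2.mk_surjective (α := Fin n))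
      simpa [sq] using this
    exact_mod_cast this
  have h2' : ((M.E 0).card : ℝ) ≤ n := by exact_mod_cast h2
  have h3' : ((M.E k).card : ℝ) ≤ n := by exact_mod_cast h3
  have hn' : (3 : ℝ) ≤ n := by exact_mod_cast hn
  -- The linear term `525 * (2 * n)` is at most `350 * n ^ 2` because `3 ≤ n`.
  nlinarith

end tours

/-! ### Tail bounds for the size of the instance -/

section tails

theorem gaussianReal_le_abs_le {a : ℝ} (ha : 0 ≤ a) :
    gaussianReal 0 1 {t : ℝ | a ≤ |t|} ≤ ENNReal.ofReal (2 * Real.exp (-(a ^ 2 / 2))) := by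
  have hint := fun t : ℝ => integrable_exp_mul_gaussianReal (μ := 0) (v := 1) t
  have h1 := measure_ge_le_exp_mul_mgf (μ := gaussianReal 0 1) (X := id) a ha (hint a)
  have h2 := measure_le_le_exp_mul_mgf (μ := gaussianReal 0 1) (X := id) (-a)
    (neg_nonpos.2 ha) (hint (-a))
  rw [mgf_id_gaussianReal] at h1 h2
  simp only [← Real.exp_add] at h1 h2
  have hsub : {t : ℝ | a ≤ |t|} ⊆ {t | a ≤ id t} ∪ {t | id t ≤ -a} := by
    intro t ht
    rcases le_abs.1 (show a ≤ |t| from ht) with h | h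
    · exact Or.inl h
    · exact Or.inr (by simp only [Set.mem_ofPred_eq, id]; linarith)
  rw [ENNReal.le_ofReal_iff_toReal_le (measure_ne_top _ _) (by positivity)]
  refine (measureReal_mono hsub).trans ((measureReal_union_le _ _).trans ?_)
  have e1 : -a * a + (0 * a + ((1 : NNReal) : ℝ) * a ^ 2 / 2) = -(a ^ 2 / 2) := by
    push_cast; ring
  have e2 : - -a * -a + (0 * -a + ((1 : NNReal) : ℝ) * (-a) ^ 2 / 2) = -(a ^ 2 / 2) := by
    push_cast; ring
  rw [e1] at h1
  rw [e2] at h2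
  linarith

/-- A union bound over the coordinates: if all of them are below `a` in absolute value, the norm is
below `√d * a`. -/
theorem stdGaussian_le_norm_le {d : ℕ} (hd : 0 < d) {a : ℝ} (ha : 0 ≤ a) :
    stdGaussian (EuclideanSpace ℝ (Fin d)) {v | √d * a ≤ ‖v‖} ≤
      d * ENNReal.ofReal (2 * Real.exp (-(a ^ 2 / 2))) := by
  have hsub : {v : EuclideanSpace ℝ (Fin d) | √d * a ≤ ‖v‖} ⊆ ⋃ i, {v | a ≤ |v i|} := by
    intro v hv
    by_contra h
    simp only [Set.mem_iUnion, Set.mem_ofPred_eq, not_exists, not_le] at h hv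
    have h1 : ‖v‖ ^ 2 < (√d * a) ^ 2 := by
      rw [EuclideanSpace.real_norm_sq_eq, mul_pow, Real.sq_sqrt (Nat.cast_nonneg d)]
      calc ∑ i, v i ^ 2 < ∑ _i : Fin d, a ^ 2 := by
            refine Finset.sum_lt_sum_of_nonempty ⟨⟨0, hd⟩, Finset.mem_univ _⟩ fun i _ => ?_
            rw [← sq_abs]
            exact pow_lt_pow_left₀ (h i) (abs_nonneg _) two_ne_zero
        _ = d * a ^ 2 := by simp
    exact absurd h1 (not_lt.2 (pow_le_pow_left₀ (by positivity) hv 2))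
  refine (measure_mono hsub).trans ((measure_iUnion_fintype_le _ _).trans ?_)
  have hi : ∀ i, stdGaussian (EuclideanSpace ℝ (Fin d)) {v | a ≤ |v i|} ≤
      ENNReal.ofReal (2 * Real.exp (-(a ^ 2 / 2))) := by
    intro i
    rw [← map_pi_eq_stdGaussian, Measure.map_apply (by fun_prop)
      (measurableSet_le measurable_const (by fun_prop))]
    refine le_trans (le_of_eq ?_) (gaussianReal_le_abs_le ha)
    rw [← (measurePreserving_eval (fun _ : Fin d => gaussianReal 0 1) i).measure_preimage
      (measurableSet_le measurable_const (by fun_prop)).nullMeasurableSet]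
    rfl
  refine (Finset.sum_le_sum fun i _ => hi i).trans ?_
  simp

theorem perturbedPoint_le_norm_le {d : ℕ} (hd : 0 < d) {σ : ℝ} (hσ : 0 < σ)
    {y : EuclideanSpace ℝ (Fin d)} (hy : ‖y‖ ≤ √d) {a : ℝ} (ha : 0 ≤ a) :
    perturbedPoint y σ {v | √d * (1 + σ * a) ≤ ‖v‖} ≤
      d * ENNReal.ofReal (2 * Real.exp (-(a ^ 2 / 2))) := by
  rw [perturbedPoint, Measure.map_apply (by fun_prop)
    (measurableSet_le measurable_const measurable_norm)]
  refine (measure_mono fun v hv => ?_).trans (stdGaussian_le_norm_le hd ha)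
  have h1 : √d * (1 + σ * a) ≤ ‖y + σ • v‖ := hv
  have h2 := norm_add_le y (σ • v)
  rw [norm_smul, Real.norm_of_nonneg hσ.le] at h2
  have h3 : σ * (√d * a) ≤ σ * ‖v‖ := by nlinarith
  exact le_of_mul_le_mul_left h3 hσ

theorem norm_le_sqrt_of_mem_cube {d : ℕ} {y : EuclideanSpace ℝ (Fin d)}
    (hy : ∀ j, y j ∈ Set.Icc (-1 : ℝ) 1) : ‖y‖ ≤ √d := by
  refine Real.le_sqrt_of_sq_le ?_
  rw [EuclideanSpace.real_norm_sq_eq]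
  calc ∑ i, y i ^ 2 ≤ ∑ _i : Fin d, (1 : ℝ) := Finset.sum_le_sum fun i _ => by
        nlinarith [(hy i).1, (hy i).2]
    _ = d := by simp

theorem smoothedInstance_large_le {n d : ℕ} (hd : 0 < d) {σ : ℝ} (hσ : 0 < σ)
    {y : Fin n → EuclideanSpace ℝ (Fin d)} (hy : ∀ i j, y i j ∈ Set.Icc (-1 : ℝ) 1) {a : ℝ}
    (ha : 0 ≤ a) {r : ℝ} (hr : √d * (1 + σ * a) ≤ r) :
    smoothedInstance y σ {x | ∀ j k, ‖x j - x k‖ ≤ 2 * r}ᶜ ≤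
      n * (d * ENNReal.ofReal (2 * Real.exp (-(a ^ 2 / 2)))) := by
  have hsub : {x : Fin n → EuclideanSpace ℝ (Fin d) | ∀ j k, ‖x j - x k‖ ≤ 2 * r}ᶜ ⊆
      ⋃ i, {x | √d * (1 + σ * a) ≤ ‖x i‖} := by
    intro x hx
    by_contra h
    simp only [Set.mem_iUnion, Set.mem_ofPred_eq, not_exists, not_le] at h
    exact hx fun j k => (norm_sub_le _ _).trans (by linarith [h j, h k])
  refine (measure_mono hsub).trans ((measure_iUnion_fintype_le _ _).trans ?_)
  refine (Finset.sum_le_sum fun i _ => ?_).trans (le_of_eq (by simp :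
    ∑ _i : Fin n, (d * ENNReal.ofReal (2 * Real.exp (-(a ^ 2 / 2)))) = _))
  refine le_trans (le_of_eq ?_)
    (perturbedPoint_le_norm_le hd hσ (norm_le_sqrt_of_mem_cube (hy i)) ha)
  rw [← (measurePreserving_eval (fun i => perturbedPoint (y i) σ) i).measure_preimage
    (measurableSet_le measurable_const measurable_norm).nullMeasurableSet]
  rfl

end tails

/-! ### The expected number of iterations -/

section expectation
variable {n d : ℕ}

/-- The length decreases strictly along a run, so no permutation occurs twice. -/
theorem numIterations_le_factorial (x : Fin n → EuclideanSpace ℝ (Fin d)) :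
    numIterations x ≤ (n.factorial : ℝ≥0∞) := by
  refine iSup_le fun k => iSup_le fun T => iSup_le fun hT => ?_
  have h : StrictAnti (tourLength x ∘ T) := Fin.strictAnti_iff_succ_lt.2 fun i => (hT i).2
  have := Fintype.card_le_of_injective T h.injective.of_comp
  rw [Fintype.card_fin, Fintype.card_perm, Fintype.card_fin] at this
  exact_mod_cast (Nat.le_succ k).trans this

/-- Some two 4-cycles that share three points or exactly one edge have a small gap. -/
def pairEvent (n d : ℕ) (ε : ℝ) : Set (Fin n → EuclideanSpace ℝ (Fin d)) :=
  (⋃ i : {i : Fin 6 → Fin n // Function.Injective i}, sixEvent i.1 ε) ∪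
    ⋃ i : {i : Fin 5 → Fin n // Function.Injective i}, fiveEvent i.1 ε

theorem measurableSet_pairEvent (ε : ℝ) : MeasurableSet (pairEvent n d ε) := by
  unfold pairEvent sixEvent fiveEvent gap
  refine MeasurableSet.union (MeasurableSet.iUnion fun i => ?_) (MeasurableSet.iUnion fun i => ?_)
  all_goals
    rw [Set.ofPred_and]
    refine MeasurableSet.inter (measurableSet_le ?_ measurable_const)
      (measurableSet_le ?_ measurable_const) <;> fun_prop

theorem measurableSet_bounded (r : ℝ) :
    MeasurableSet {x : Fin n → EuclideanSpace ℝ (Fin d) | ∀ j k, ‖x j - x k‖ ≤ 2 * r} := by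
  simp only [Set.ofPred_forall]
  exact MeasurableSet.iInter fun j => MeasurableSet.iInter fun k =>
    measurableSet_le (by fun_prop) measurable_const

theorem measure_pairEvent_le (hd : 2 ≤ d) {σ : ℝ} (hσ : 0 < σ)
    {y : Fin n → EuclideanSpace ℝ (Fin d)} {r ε : ℝ} (hr : 0 < r) (hε : 0 < ε) :
    smoothedInstance y σ (pairEvent n d ε ∩ {x | ∀ j k, ‖x j - x k‖ ≤ 2 * r}) ≤
      ENNReal.ofReal (10 ^ 10 * (n ^ 6 * (r * ε / σ ^ 2) ^ (9 / 5 : ℝ) +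
        n ^ 5 * (r * ε / σ ^ 2) ^ (3 / 2 : ℝ))) := by
  have hcard : ∀ m : ℕ, (Fintype.card {i : Fin m → Fin n // Function.Injective i} : ℝ≥0∞) ≤
      ENNReal.ofReal (n ^ m) := by
    intro m
    have h := Fintype.card_subtype_le fun i : Fin m → Fin n => Function.Injective i
    rw [Fintype.card_fun, Fintype.card_fin, Fintype.card_fin] at h
    rw [ENNReal.ofReal_pow (Nat.cast_nonneg n), ENNReal.ofReal_natCast]
    exact_mod_cast h
  rw [pairEvent, Set.union_inter_distrib_right, Set.iUnion_inter, Set.iUnion_inter]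
  refine (measure_union_le _ _).trans ?_
  rw [mul_add, ENNReal.ofReal_add (by positivity) (by positivity)]
  refine add_le_add ?_ ?_
  · refine (measure_iUnion_fintype_le _ _).trans
      ((Finset.sum_le_sum fun i _ => measure_sixEvent_le hd hσ i.2 hr hε).trans ?_)
    rw [Finset.sum_const, nsmul_eq_mul, Finset.card_univ, mul_left_comm,
      ENNReal.ofReal_mul (p := (n : ℝ) ^ 6) (by positivity)]
    exact mul_le_mul' (hcard 6) le_rfl
  · refine (measure_iUnion_fintype_le _ _).trans
      ((Finset.sum_le_sum fun i _ => measure_fiveEvent_le hd hσ i.2 hr hε).trans ?_)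
    rw [Finset.sum_const, nsmul_eq_mul, Finset.card_univ, mul_left_comm,
      ENNReal.ofReal_mul (p := (n : ℝ) ^ 5) (by positivity)]
    exact mul_le_mul' (hcard 5) le_rfl

/-- Let `j` be the first scale `ε / 2 ^ j` at which no bad pair of 4-cycles occurs. Then
`run_length_le` applies at this scale, and the event at the scale before it pays for the factor `2 ^
j`. -/
theorem numIterations_le (hn : 3 ≤ n) {r ε : ℝ} (hr : 0 < r) (hε : 0 < ε)
    {x : Fin n → EuclideanSpace ℝ (Fin d)} (hx : ∀ j k, ‖x j - x k‖ ≤ 2 * r) :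
    numIterations x ≤ ENNReal.ofReal (1050 * (r * n / ε) + 355 * n ^ 2) +
      ∑' j : ℕ, (pairEvent n d (ε * (1 / 2) ^ j) ∩ {x | ∀ j k, ‖x j - x k‖ ≤ 2 * r}).indicator
        (fun _ => ENNReal.ofReal (2100 * (r * n / ε) * 2 ^ j)) x := by
  have hn' : (3 : ℝ) ≤ n := by exact_mod_cast hn
  have hq : 0 < r * n / ε := by positivity
  refine iSup_le fun k => iSup_le fun T => iSup_le fun hT => ?_
  have hL : tourLength x (T 0) ≤ 2 * r * n := by
    calc tourLength x (T 0) ≤ ∑ _i : Fin n, 2 * r := Finset.sum_le_sum fun i _ => hx _ _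
      _ = 2 * r * n := by simp; ring
  have hrun : ∀ j : ℕ, x ∉ pairEvent n d (ε * (1 / 2) ^ j) →
      (k : ℝ) ≤ 1050 * (r * n / ε) * 2 ^ j + 355 * n ^ 2 := by
    intro j hj
    simp only [pairEvent, Set.mem_union, Set.mem_iUnion, not_or, not_exists] at hj
    have := run_length_le hn (ε := ε * (1 / 2) ^ j) (by positivity) (fun i hi => hj.1 ⟨i, hi⟩)
      (fun i hi => hj.2 ⟨i, hi⟩) hT hL
    refine this.trans (le_of_eq ?_)
    rw [one_div, inv_pow]
    field_simp
    ring
  have hterm : ∀ j : ℕ, x ∈ pairEvent n d (ε * (1 / 2) ^ j) →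
      (k : ℝ) ≤ 1050 * (r * n / ε) * 2 ^ (j + 1) + 355 * n ^ 2 →
      (k : ℝ≥0∞) ≤ ENNReal.ofReal (1050 * (r * n / ε) + 355 * n ^ 2) +
      ∑' j : ℕ, (pairEvent n d (ε * (1 / 2) ^ j) ∩ {x | ∀ j k, ‖x j - x k‖ ≤ 2 * r}).indicator
        (fun _ => ENNReal.ofReal (2100 * (r * n / ε) * 2 ^ j)) x := by
    intro j hj hk
    refine le_trans ?_ (add_le_add le_rfl (ENNReal.le_tsum j))
    rw [Set.indicator_of_mem (Set.mem_inter hj (show x ∈ {x | ∀ j k, ‖x j - x k‖ ≤ 2 * r} from hx)),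
      ← ENNReal.ofReal_add (by positivity) (by positivity), ← ENNReal.ofReal_natCast]
    refine ENNReal.ofReal_le_ofReal (hk.trans ?_)
    rw [pow_succ]
    linarith
  by_cases h : ∃ j, x ∉ pairEvent n d (ε * (1 / 2) ^ j)
  · classical
    rcases Nat.eq_zero_or_pos (Nat.find h) with h0 | h0
    · refine le_trans ?_ le_self_add
      have hs := Nat.find_spec h
      rw [h0] at hs
      have := hrun 0 hs
      rw [← ENNReal.ofReal_natCast]
      exact ENNReal.ofReal_le_ofReal (by simpa using this)
    · obtain ⟨m, hm⟩ : ∃ m, Nat.find h = m + 1 := ⟨Nat.find h - 1, by omega⟩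
      have hs := Nat.find_spec h
      rw [hm] at hs
      exact hterm m (not_not.1 (Nat.find_min h (by omega))) (hrun _ hs)
  -- If the event occurs at every scale, a single term of large index already exceeds `k`.
  · push Not at h
    obtain ⟨j, hj⟩ := pow_unbounded_of_one_lt ((k : ℝ) / (1050 * (r * n / ε))) one_lt_two
    refine hterm j (h j) ?_
    rw [div_lt_iff₀ (by positivity)] at hj
    have : (0 : ℝ) < 2 ^ j := by positivity
    rw [pow_succ]
    nlinarith [sq_nonneg (n : ℝ)]

end expectation

section expectation
variable {n d : ℕ}

/-- What matters about `3 / 8` is that it exceeds `2 ^ (-3 / 2)` while `2 * (3 / 8) < 1`, so that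
the dyadic sum converges. -/
theorem half_pow_rpow_le {q : ℝ} (hq : 3 / 2 ≤ q) (j : ℕ) :
    (((1 : ℝ) / 2) ^ j) ^ q ≤ (3 / 8) ^ j := by
  have h1 : ((1 : ℝ) / 2) ^ (3 / 2 : ℝ) ≤ 3 / 8 := by
    refine le_of_sq_le_sq ?_ (by norm_num)
    rw [← Real.rpow_natCast, ← Real.rpow_mul (by norm_num)]
    norm_num
  calc (((1 : ℝ) / 2) ^ j) ^ q = (((1 : ℝ) / 2) ^ q) ^ j := by
        rw [← Real.rpow_natCast, ← Real.rpow_mul (by norm_num), mul_comm,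
          Real.rpow_mul (by norm_num), Real.rpow_natCast]
    _ ≤ _ := pow_le_pow_left₀ (by positivity)
        ((Real.rpow_le_rpow_of_exponent_ge (by norm_num) (by norm_num) hq).trans h1) j

theorem measure_pairEvent_half_pow_le (hd : 2 ≤ d) (hn : 0 < n) {σ : ℝ} (hσ : 0 < σ)
    {y : Fin n → EuclideanSpace ℝ (Fin d)} {r ε : ℝ} (hr : 0 < r)
    (hε : r * ε / σ ^ 2 = (n : ℝ) ^ (-(10 / 3) : ℝ)) (h0 : 0 < ε) (j : ℕ) :
    smoothedInstance y σ
      (pairEvent n d (ε * (1 / 2) ^ j) ∩ {x | ∀ j k, ‖x j - x k‖ ≤ 2 * r}) ≤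
      ENNReal.ofReal (2 * 10 ^ 10 * (3 / 8) ^ j) := by
  refine (measure_pairEvent_le hd hσ hr (by positivity)).trans (ENNReal.ofReal_le_ofReal ?_)
  have hn' : (0 : ℝ) < n := by exact_mod_cast hn
  have e : r * (ε * (1 / 2) ^ j) / σ ^ 2 = (n : ℝ) ^ (-(10 / 3) : ℝ) * (1 / 2) ^ j := by
    rw [← hε]; ring
  have key : ∀ (m : ℕ) (q : ℝ), (m : ℝ) = 10 / 3 * q → 3 / 2 ≤ q →
      (n : ℝ) ^ m * (r * (ε * (1 / 2) ^ j) / σ ^ 2) ^ q ≤ (3 / 8) ^ j := by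
    intro m q hm hq
    rw [e, Real.mul_rpow (by positivity) (by positivity), ← Real.rpow_mul hn'.le, ← mul_assoc,
      ← Real.rpow_natCast, ← Real.rpow_add hn', hm,
      show 10 / 3 * q + -(10 / 3) * q = 0 by ring, Real.rpow_zero, one_mul]
    exact half_pow_rpow_le hq j
  have h1 := key 6 (9 / 5) (by norm_num) (by norm_num)
  have h2 := key 5 (3 / 2) (by norm_num) (by norm_num)
  linarith

theorem setLIntegral_numIterations_le (hd : 2 ≤ d) (hn : 3 ≤ n) {σ : ℝ} (hσ : 0 < σ)
    {y : Fin n → EuclideanSpace ℝ (Fin d)} {r ε : ℝ} (hr : 0 < r)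
    (hε : r * ε / σ ^ 2 = (n : ℝ) ^ (-(10 / 3) : ℝ)) (h0 : 0 < ε) :
    ∫⁻ x in {x | ∀ j k, ‖x j - x k‖ ≤ 2 * r}, numIterations x ∂(smoothedInstance y σ) ≤
      ENNReal.ofReal (2 * 10 ^ 14 * (r * n / ε) + 355 * n ^ 2) := by
  have hq : 0 ≤ r * n / ε := by positivity
  have hm : ∀ j : ℕ, MeasurableSet
      (pairEvent n d (ε * (1 / 2) ^ j) ∩ {x | ∀ j k, ‖x j - x k‖ ≤ 2 * r}) := fun j =>
    (measurableSet_pairEvent _).inter (measurableSet_bounded r)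
  refine (setLIntegral_mono' (measurableSet_bounded r)
    fun x hx => numIterations_le hn hr h0 hx).trans ?_
  refine (setLIntegral_le_lintegral _ _).trans ?_
  rw [lintegral_add_left measurable_const, lintegral_const, measure_univ, mul_one,
    lintegral_tsum fun j => (measurable_const.indicator (hm j)).aemeasurable]
  have hsum : HasSum (fun j : ℕ => 42 * 10 ^ 12 * (r * n / ε) * (3 / 4 : ℝ) ^ j)
      (42 * 10 ^ 12 * (r * n / ε) * (1 - 3 / 4)⁻¹) :=
    (hasSum_geometric_of_lt_one (by norm_num) (by norm_num)).mul_left _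
  have hts : ∑' j : ℕ, ∫⁻ x, (pairEvent n d (ε * (1 / 2) ^ j) ∩
      {x | ∀ j k, ‖x j - x k‖ ≤ 2 * r}).indicator
        (fun _ => ENNReal.ofReal (2100 * (r * n / ε) * 2 ^ j)) x ∂(smoothedInstance y σ) ≤
      ENNReal.ofReal (42 * 10 ^ 12 * (r * n / ε) * (1 - 3 / 4)⁻¹) := by
    rw [← hsum.tsum_eq, ENNReal.ofReal_tsum_of_nonneg (fun j => by positivity) hsum.summable]
    refine ENNReal.tsum_le_tsum fun j => ?_
    rw [lintegral_indicator_const (hm j)]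
    refine (mul_le_mul_right (measure_pairEvent_half_pow_le hd (by omega) hσ hr hε h0 j) _).trans ?_
    rw [← ENNReal.ofReal_mul (by positivity)]
    refine ENNReal.ofReal_le_ofReal (le_of_eq ?_)
    rw [show (3 / 4 : ℝ) = 2 * (3 / 8) by norm_num, mul_pow]
    ring
  refine (add_le_add le_rfl hts).trans ?_
  rw [← ENNReal.ofReal_add (by positivity) (by positivity)]
  refine ENNReal.ofReal_le_ofReal ?_
  norm_num
  linarith

/-- The constant `4` in the radius makes the Gaussian tail `n ^ (-8n)`, which beats the factor `n!`
and the union bound over points; the union bound over coordinates leaves `d`. -/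
theorem setLIntegral_compl_numIterations_le (hd : 0 < d) (hn : 3 ≤ n) {σ : ℝ} (hσ : 0 < σ)
    {y : Fin n → EuclideanSpace ℝ (Fin d)} (hy : ∀ i j, y i j ∈ Set.Icc (-1 : ℝ) 1) {r : ℝ}
    (hr : √d * (1 + σ * (4 * √(n * Real.log n))) ≤ r) :
    ∫⁻ x in {x | ∀ j k, ‖x j - x k‖ ≤ 2 * r}ᶜ, numIterations x ∂(smoothedInstance y σ) ≤
      ENNReal.ofReal d := by
  have hn' : (3 : ℝ) ≤ n := by exact_mod_cast hn
  have hlog : 0 ≤ n * Real.log n := mul_nonneg (by linarith) (Real.log_nonneg (by linarith))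
  refine (lintegral_mono fun x => numIterations_le_factorial x).trans ?_
  rw [lintegral_const, Measure.restrict_apply_univ]
  refine (mul_le_mul_right (smoothedInstance_large_le hd hσ hy (by positivity) hr) _).trans ?_
  rw [← ENNReal.ofReal_natCast n.factorial, ← ENNReal.ofReal_natCast n, ← ENNReal.ofReal_natCast d,
    ← ENNReal.ofReal_mul (by positivity), ← ENNReal.ofReal_mul (by positivity),
    ← ENNReal.ofReal_mul (by positivity)]
  refine ENNReal.ofReal_le_ofReal ?_
  have h1 : (4 * √(n * Real.log n)) ^ 2 / 2 = 8 * (n * Real.log n) := by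
    rw [mul_pow, Real.sq_sqrt hlog]; ring
  have h2 : Real.exp (n * Real.log n) = (n : ℝ) ^ n := by
    rw [← Real.log_pow, Real.exp_log (by positivity)]
  have h3 : (n.factorial : ℝ) ≤ (n : ℝ) ^ n := by exact_mod_cast Nat.factorial_le_pow n
  have h4 : (2 : ℝ) * n ≤ (n : ℝ) ^ n := by
    calc (2 : ℝ) * n ≤ (n : ℝ) ^ 2 := by nlinarith
      _ ≤ (n : ℝ) ^ n := pow_le_pow_right₀ (by linarith) (by omega)
  have h5 : Real.exp (-(8 * (n * Real.log n))) ≤ Real.exp (-(n * Real.log n)) ^ 2 := by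
    rw [← Real.exp_nat_mul]
    refine Real.exp_le_exp.2 ?_
    push_cast
    linarith
  rw [h1]
  calc (n.factorial : ℝ) * (n * (d * (2 * Real.exp (-(8 * (n * Real.log n))))))
      = d * (n.factorial * (2 * n) * Real.exp (-(8 * (n * Real.log n)))) := by ring
    _ ≤ d * ((n : ℝ) ^ n * (n : ℝ) ^ n * Real.exp (-(n * Real.log n)) ^ 2) := by gcongr
    _ = d := by
      rw [Real.exp_neg, h2]
      have : (n : ℝ) ^ n ≠ 0 := by positivity
      field_simp

theorem expectedIterations_le (hd : 2 ≤ d) (hn : 3 ≤ n) {σ : ℝ} (hσ : 0 < σ) (hσ1 : σ ≤ 1)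
    {y : Fin n → EuclideanSpace ℝ (Fin d)} (hy : ∀ i j, y i j ∈ Set.Icc (-1 : ℝ) 1) :
    expectedIterations y σ ≤ ENNReal.ofReal (10 ^ 16 * d * (1 + σ * √(n * Real.log n)) ^ 2 *
      (n : ℝ) ^ (4 + 1 / 3 : ℝ) / σ ^ 2) := by
  have hn' : (3 : ℝ) ≤ n := by exact_mod_cast hn
  have hn0 : (0 : ℝ) < n := by linarith
  have hd' : (2 : ℝ) ≤ d := by exact_mod_cast hd
  set s := √(n * Real.log n) with hs
  have hs0 : 0 ≤ s := Real.sqrt_nonneg _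
  set D := 1 + σ * s with hD
  have hD1 : 1 ≤ D := by rw [hD]; nlinarith
  set r := 4 * √d * D with hr
  have hr0 : 0 < r := by positivity
  have hr2 : r ^ 2 = 16 * d * D ^ 2 := by
    rw [hr, mul_pow, mul_pow, Real.sq_sqrt (by positivity)]; norm_num
  -- The scale at which the union bounds `n ^ 6 * ρ ^ (9 / 5)` and `n ^ 5 * ρ ^ (3 / 2)` with `ρ = r
  -- * ε / σ ^ 2` are both equal to one.
  set ε := σ ^ 2 * (n : ℝ) ^ (-(10 / 3) : ℝ) / r with hε
  have hε0 : 0 < ε := by positivity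
  have hεr : r * ε / σ ^ 2 = (n : ℝ) ^ (-(10 / 3) : ℝ) := by
    rw [hε]; field_simp
  set Q := d * D ^ 2 * (n : ℝ) ^ (4 + 1 / 3 : ℝ) / σ ^ 2 with hQ
  have hq : r * n / ε = 16 * Q := by
    have h1 : (n : ℝ) ^ (4 + 1 / 3 : ℝ) * (n : ℝ) ^ (-(10 / 3) : ℝ) = n := by
      rw [← Real.rpow_add hn0]; norm_num
    rw [div_eq_iff hε0.ne', hQ, hε]
    have : 16 * (d * D ^ 2 * (n : ℝ) ^ (4 + 1 / 3 : ℝ) / σ ^ 2) *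
        (σ ^ 2 * (n : ℝ) ^ (-(10 / 3) : ℝ) / r) =
        (16 * d * D ^ 2) * ((n : ℝ) ^ (4 + 1 / 3 : ℝ) * (n : ℝ) ^ (-(10 / 3) : ℝ)) / r := by
      field_simp
    rw [this, h1, ← hr2]
    field_simp
  have hp : (n : ℝ) ^ 2 ≤ (n : ℝ) ^ (4 + 1 / 3 : ℝ) := by
    rw [← Real.rpow_natCast]
    exact Real.rpow_le_rpow_of_exponent_le (by linarith) (by norm_num)
  have hQ1 : d * (n : ℝ) ^ 2 ≤ Q := by
    rw [hQ, le_div_iff₀ (by positivity)]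
    calc d * (n : ℝ) ^ 2 * σ ^ 2 ≤ d * (n : ℝ) ^ 2 * 1 := by
          gcongr; exact pow_le_one₀ hσ.le hσ1
      _ = d * 1 * (n : ℝ) ^ 2 := by ring
      _ ≤ d * D ^ 2 * (n : ℝ) ^ (4 + 1 / 3 : ℝ) := by
          gcongr; exact one_le_pow₀ hD1
  have hrr : √d * (1 + σ * (4 * s)) ≤ r := by
    have : √(d : ℝ) * (1 + σ * (4 * s)) ≤ √d * (4 * D) :=
      mul_le_mul_of_nonneg_left (by rw [hD]; linarith) (Real.sqrt_nonneg _)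
    rw [hr]; linarith
  rw [expectedIterations, ← lintegral_add_compl _ (measurableSet_bounded r)]
  refine (add_le_add (setLIntegral_numIterations_le hd hn hσ hr0 hεr hε0)
    (setLIntegral_compl_numIterations_le (by omega) hn hσ hy hrr)).trans ?_
  rw [← ENNReal.ofReal_add (by positivity) (by positivity)]
  refine ENNReal.ofReal_le_ofReal ?_
  have e : 10 ^ 16 * d * D ^ 2 * (n : ℝ) ^ (4 + 1 / 3 : ℝ) / σ ^ 2 = 10 ^ 16 * Q := by
    rw [hQ]; ring
  have h1 : (n : ℝ) ^ 2 ≤ d * (n : ℝ) ^ 2 := le_mul_of_one_le_left (by positivity) (by linarith)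
  have h2 : (d : ℝ) ≤ d * (n : ℝ) ^ 2 :=
    le_mul_of_one_le_right (by positivity) (one_le_pow₀ (by linarith))
  rw [hq, e]
  linarith

/-- The conversion to exchanges needs three cities, so the small cases are separate. For `n = 0` the
right-hand side vanishes, and indeed an empty tour cannot be shortened; otherwise there are at most
two permutations. -/
theorem expectedIterations_le_of_le_two (hd : 2 ≤ d) (hn : n ≤ 2) {σ : ℝ} (hσ : 0 < σ)
    (hσ1 : σ ≤ 1) (y : Fin n → EuclideanSpace ℝ (Fin d)) :
    expectedIterations y σ ≤ ENNReal.ofReal (10 ^ 16 * d * (1 + σ * √(n * Real.log n)) ^ 2 *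
      (n : ℝ) ^ (4 + 1 / 3 : ℝ) / σ ^ 2) := by
  rcases Nat.eq_zero_or_pos n with rfl | hn0
  · have h : ∀ x : Fin 0 → EuclideanSpace ℝ (Fin d), numIterations x = 0 := by
      intro x
      refine le_antisymm (iSup_le fun k => iSup_le fun T => iSup_le fun hT => ?_) bot_le
      rcases Nat.eq_zero_or_pos k with rfl | hk
      · simp
      · exact absurd (hT ⟨0, hk⟩).2 (by simp [tourLength])
    simp [expectedIterations, h]
  have hn' : (1 : ℝ) ≤ n := by exact_mod_cast hn0
  have hd' : (2 : ℝ) ≤ d := by exact_mod_cast hd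
  have h1 : expectedIterations y σ ≤ ENNReal.ofReal 2 := by
    refine (lintegral_mono fun x => numIterations_le_factorial x).trans ?_
    rw [lintegral_const, measure_univ, mul_one, ← ENNReal.ofReal_natCast]
    refine ENNReal.ofReal_le_ofReal ?_
    exact_mod_cast Nat.factorial_le hn
  refine h1.trans (ENNReal.ofReal_le_ofReal ?_)
  have hs : 0 ≤ σ * √(n * Real.log n) := by positivity
  rw [le_div_iff₀ (by positivity)]
  calc (2 : ℝ) * σ ^ 2 ≤ 2 * 1 := by gcongr; exact pow_le_one₀ hσ.le hσ1
    _ ≤ 10 ^ 16 * 2 * 1 * 1 := by norm_num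
    _ ≤ _ := by
      gcongr
      · exact one_le_pow₀ (by linarith)
      · exact Real.one_le_rpow hn' (by norm_num)

end expectation

end TwoOpt

theorem mainTheorem1 :
    ∃ C : ℝ, 0 < C ∧
      ∀ (d n : ℕ) (σ : ℝ) (y : Fin n → EuclideanSpace ℝ (Fin d)),
        2 ≤ d → 0 < σ → σ ≤ 1 →
        (∀ i j, y i j ∈ Set.Icc (-1 : ℝ) 1) →
        TwoOpt.expectedIterations y σ ≤
          ENNReal.ofReal
            (C * (d : ℝ) * (1 + σ * Real.sqrt ((n : ℝ) * Real.log (n : ℝ))) ^ 2 *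
              (n : ℝ) ^ (4 + 1 / 3 : ℝ) / σ ^ 2) := by
  refine ⟨10 ^ 16, by norm_num, fun d n σ y hd hσ hσ1 hy => ?_⟩
  rcases Nat.lt_or_ge 2 n with hn | hn
  · exact TwoOpt.expectedIterations_le hd hn hσ hσ1 hy
  · exact TwoOpt.expectedIterations_le_of_le_two hd hn hσ hσ1 y
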